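/- Fix a finite alphabet $\Sigma$ and an infinite set $\mathsf{Vars}$ of variables. A \emph{span} of a string $\mathbf{s}\in\Sigma^*$ is an expression $[i,j\rangle$ with $1\le i\le j\le|\mathbf{s}|+1$. A \emph{document spanner} $P$ consists of a finite set $V\subseteq\mathsf{Vars}$ and, for every $\mathbf{s}\in\Sigma^*$, a set $P(\mathbf{s})$ of functions (records) from $V$ to the spans of $\mathbf{s}$. It is \emph{computable in polynomial time} if, for some enumeration of $V$, there is a Turing machine that on input $\mathbf{s}$ writes, within a number of steps polynomial in $|\mathbf{s}|$, a list of the records in $P(\mathbf{s})$ (each as a tuple of spans, and each span as its two positions in unary). A \emph{regex formula} is a regular expression $\gamma ::= \emptyset\mid\epsilon\mid\sigma\mid\gamma\vee\gamma\mid\gamma\cdot\gamma\mid\gamma^*\mid x\{\gamma\}$ (with $\sigma\in\Sigma$, $x\in\mathsf{Vars}$) that is functional: every parse tree of every string contains, for each variable $x$ that occurs in $\gamma$, exactly one node for $x$. On $\mathbf{s}$ it extracts the records that map each of its variables to the span captured by it, one record for each parse tree of the whole string $\mathbf{s}$. An \emph{RGXlog program} consists of a finite signature $\mathcal{I}$ of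 relation symbols with arities, a finite set of rules $\varphi\leftarrow\psi_1,\dots,\psi_m$, an output symbol $\mathrm{Out}\in\mathcal{I}$ of some arity $k$, and a sequence $x_1,\dots,x_k$ of distinct variables. Here $\varphi$ is an atom $R(y_1,\dots,y_\ell)$ with $R\in\mathcal{I}$ of arity $\ell$ and variables $y_1,\dots,y_\ell$ (not necessarily distinct), each $\psi_i$ is such an atom or a regex formula, and every variable of $\varphi$ occurs in some $\psi_i$; there are no constants and no negation, and recursion is allowed. On a string $\mathbf{s}$ the program evaluates to the minimal interpretation of $\mathcal{I}$ by relations over spans that satisfies all rules, read as universally quantified implications, where a regex formula holds under an assignment if the restriction of the assignment to its variables is one of the records that it extracts from $\mathbf{s}$. The program \emph{defines} the spanner with variables $x_1,\dots,x_k$ that maps $\mathbf{s}$ to the set of records $x_i\mapsto a_i$ for the tuples $(a_1,\dots,a_k)$ in the relation $\mathrm{Out}$ so obtained. \textbf{Theorem.} A document spanner $P$ is definable by an RGXlog program if and only if it is computable in polynomial time. Moreover, if $P$ is computable in polynomial time, then it is definable by an RGXlog program all of whose regex formulas are binary, that is, have exactly two variables. -/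

import Mathlib

namespace RGXlog

universe u

/-! ### Spans and document spanners -/

/-- A pair of positions `[start, finish⟩`. Positions are counted from `1`. -/
@[ext]
structure Span where
  start : ℕ
  finish : ℕ

/-- `σ` is a span of the string `s`: `1 ≤ start ≤ finish ≤ |s| + 1`. -/
def Span.IsSpanOf {Alph : Type} (σ : Span) (s : List Alph) : Prop :=
  1 ≤ σ.start ∧ σ.start ≤ σ.finish ∧ σ.finish ≤ s.length + 1

/-- A document spanner over the alphabet `Alph`: a finite set `vars` of variables, and for every
string `s` a set of records, each of which maps the variables in `vars` to spans of `s`. -/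
structure Spanner (Alph : Type) (Var : Type u) where
  vars : Finset Var
  rel : List Alph → Set (vars → Span)
  isSpanOf : ∀ s, ∀ r ∈ rel s, ∀ x, (r x).IsSpanOf s

/-! ### Regex formulas -/

/-- Regular expressions with capture variables. -/
inductive VRegex (Alph : Type) (Var : Type u) : Type u
  /-- the empty language -/
  | empty : VRegex Alph Var
  /-- the empty string -/
  | eps : VRegex Alph Var
  /-- a single symbol -/
  | symbol (a : Alph) : VRegex Alph Var
  /-- disjunction -/
  | or (γ₁ γ₂ : VRegex Alph Var) : VRegex Alph Var
  /-- concatenation -/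
  | cat (γ₁ γ₂ : VRegex Alph Var) : VRegex Alph Var
  /-- Kleene star -/
  | star (γ : VRegex Alph Var) : VRegex Alph Var
  /-- `x{γ}`: capture in `x` the span matched by `γ` -/
  | capture (x : Var) (γ : VRegex Alph Var) : VRegex Alph Var

namespace VRegex

variable {Alph : Type} {Var : Type u}

/-- The variables that occur in an expression. -/
def vars [DecidableEq Var] : VRegex Alph Var → Finset Var
  | empty => ∅
  | eps => ∅
  | symbol _ => ∅
  | or γ₁ γ₂ => γ₁.vars ∪ γ₂.vars
  | cat γ₁ γ₂ => γ₁.vars ∪ γ₂.vars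
  | star γ => γ.vars
  | capture x γ => insert x γ.vars

/-- `Parse s γ i j c`: there is a parse tree of the substring `s_[i, j⟩` by `γ` whose nodes
labeled by variables, listed with their spans in preorder, form the list `c`. -/
inductive Parse (s : List Alph) : VRegex Alph Var → ℕ → ℕ → List (Var × Span) → Prop
  | eps {i : ℕ} : 1 ≤ i → i ≤ s.length + 1 → Parse s eps i i []
  | symbol {a : Alph} {i : ℕ} : s[i]? = some a → Parse s (symbol a) (i + 1) (i + 2) []
  | or_left {γ₁ γ₂ : VRegex Alph Var} {i j : ℕ} {c : List (Var × Span)} :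
      Parse s γ₁ i j c → Parse s (or γ₁ γ₂) i j c
  | or_right {γ₁ γ₂ : VRegex Alph Var} {i j : ℕ} {c : List (Var × Span)} :
      Parse s γ₂ i j c → Parse s (or γ₁ γ₂) i j c
  | cat {γ₁ γ₂ : VRegex Alph Var} {i k j : ℕ} {c₁ c₂ : List (Var × Span)} :
      Parse s γ₁ i k c₁ → Parse s γ₂ k j c₂ → Parse s (cat γ₁ γ₂) i j (c₁ ++ c₂)
  | star_nil {γ : VRegex Alph Var} {i : ℕ} :
      1 ≤ i → i ≤ s.length + 1 → Parse s (star γ) i i []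
  | star_cons {γ : VRegex Alph Var} {i k j : ℕ} {c₁ c₂ : List (Var × Span)} :
      Parse s γ i k c₁ → Parse s (star γ) k j c₂ → Parse s (star γ) i j (c₁ ++ c₂)
  | capture {x : Var} {γ : VRegex Alph Var} {i j : ℕ} {c : List (Var × Span)} :
      Parse s γ i j c → Parse s (capture x γ) i j ((x, ⟨i, j⟩) :: c)

/-- An expression is functional if every variable that occurs in it labels exactly one node of
each parse tree of each (whole) string. -/
def Functional [DecidableEq Var] (γ : VRegex Alph Var) : Prop :=
  ∀ (s : List Alph) (c : List (Var × Span)), γ.Parse s 1 (s.length + 1) c →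
    ∀ x ∈ γ.vars, (c.map Prod.fst).count x = 1

/-- The records extracted from `s`: every parse tree of `s` assigns to each variable the span
that is captured in it. -/
def rel [DecidableEq Var] (γ : VRegex Alph Var) (s : List Alph) : Set (γ.vars → Span) :=
  {r | ∃ c, γ.Parse s 1 (s.length + 1) c ∧ ∀ x : γ.vars, ((x : Var), r x) ∈ c}

theorem Parse.bounds {s : List Alph} {γ : VRegex Alph Var} {i j : ℕ} {c : List (Var × Span)}
    (h : γ.Parse s i j c) :
    (1 ≤ i ∧ i ≤ j ∧ j ≤ s.length + 1) ∧ ∀ p ∈ c, p.2.IsSpanOf s := by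
  induction h with
  | eps h₁ h₂ => exact ⟨⟨h₁, le_rfl, h₂⟩, by simp⟩
  | symbol h =>
    obtain ⟨h', -⟩ := List.getElem?_eq_some_iff.mp h
    exact ⟨⟨by omega, by omega, by omega⟩, by simp⟩
  | or_left _ ih => exact ih
  | or_right _ ih => exact ih
  | cat _ _ ih₁ ih₂ =>
    refine ⟨⟨ih₁.1.1, ih₁.1.2.1.trans ih₂.1.2.1, ih₂.1.2.2⟩, fun p hp => ?_⟩
    rcases List.mem_append.mp hp with hp | hp
    · exact ih₁.2 p hp
    · exact ih₂.2 p hp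
  | star_nil h₁ h₂ => exact ⟨⟨h₁, le_rfl, h₂⟩, by simp⟩
  | star_cons _ _ ih₁ ih₂ =>
    refine ⟨⟨ih₁.1.1, ih₁.1.2.1.trans ih₂.1.2.1, ih₂.1.2.2⟩, fun p hp => ?_⟩
    rcases List.mem_append.mp hp with hp | hp
    · exact ih₁.2 p hp
    · exact ih₂.2 p hp
  | capture _ ih =>
    refine ⟨ih.1, fun p hp => ?_⟩
    rcases List.mem_cons.mp hp with rfl | hp
    · exact ih.1
    · exact ih.2 p hp

end VRegex

/-- A regex formula is a functional regular expression with capture variables. -/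
def RegexFormula (Alph : Type) (Var : Type u) [DecidableEq Var] : Type u :=
  {γ : VRegex Alph Var // γ.Functional}

/-! ### Programs -/

/-- A signature: finitely many relation symbols, with their arities. -/
structure Signature where
  Rel : Type
  arity : Rel → ℕ
  finite : Finite Rel

/-- An atom `R(x₁, …, x_k)`; the variables need not be distinct. -/
structure Atom (I : Signature) (Var : Type u) where
  symb : I.Rel
  args : Fin (I.arity symb) → Var

/-- A conjunct in the body of a rule: an atom over the IDB signature or a regex formula. -/
inductive BodyAtom (Alph : Type) (Var : Type u) [DecidableEq Var] (I : Signature) : Type u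
  | idb (a : Atom I Var) : BodyAtom Alph Var I
  | regex (γ : RegexFormula Alph Var) : BodyAtom Alph Var I

/-- A span database over `I`, without the finiteness requirement. -/
abbrev Database (I : Signature) : Type := (R : I.Rel) → Set (Fin (I.arity R) → Span)

section

variable {Alph : Type} {Var : Type u} [DecidableEq Var] {I : Signature}

/-- The variables of a conjunct. -/
def BodyAtom.vars : BodyAtom Alph Var I → Finset Var
  | idb a => Finset.univ.image a.args
  | regex γ => γ.1.vars

/-- The truth of a conjunct on the string `s`, in the database `D`, under the assignment `ν`. -/
def BodyAtom.Holds (s : List Alph) (D : Database I) (ν : Var → Span) : BodyAtom Alph Var I → Prop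
  | idb a => (fun i => ν (a.args i)) ∈ D a.symb
  | regex γ => (fun x : γ.1.vars => ν x) ∈ γ.1.rel s

end

/-- A rule `head ← body`, in which every head variable occurs in the body. -/
structure Rule (Alph : Type) (Var : Type u) [DecidableEq Var] (I : Signature) where
  head : Atom I Var
  body : List (BodyAtom Alph Var I)
  safe : ∀ i, ∃ b ∈ body, head.args i ∈ b.vars

/-- An RGXlog program: an IDB signature, a finite set of rules, an output relation symbol `out`,
and a sequence `outVars` of distinct variables, as many as the arity of `out`. -/
structure Program (Alph : Type) (Var : Type u) [DecidableEq Var] where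
  I : Signature
  rules : Set (Rule Alph Var I)
  rules_finite : rules.Finite
  out : I.Rel
  outVars : Fin (I.arity out) → Var
  outVars_injective : Function.Injective outVars

namespace Program

variable {Alph : Type} {Var : Type u} [DecidableEq Var] (Q : Program Alph Var)

/-- The database `D` satisfies all rules of `Q` on the string `s`. -/
def IsModel (s : List Alph) (D : Database Q.I) : Prop :=
  ∀ ρ ∈ Q.rules, ∀ ν : Var → Span, (∀ b ∈ ρ.body, b.Holds s D ν) →
    (fun i => ν (ρ.head.args i)) ∈ D ρ.head.symb

/-- The result of applying `Q` to `s`, the minimal database that satisfies all rules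
(see `eval_isLeast`). -/
def eval (s : List Alph) : Database Q.I :=
  fun R => {t | ∀ D : Database Q.I, Q.IsModel s D → t ∈ D R}

theorem eval_isLeast (s : List Alph) : IsLeast {D | Q.IsModel s D} (Q.eval s) := by
  refine ⟨fun ρ hρ ν hν D hD => hD ρ hρ ν fun b hb => ?_, fun D hD R t ht => ht D hD⟩
  have h := hν b hb
  cases b with
  | idb a => exact h D hD
  | regex γ => exact h

theorem eval_isSpanOf (s : List Alph) (R : Q.I.Rel) :
    ∀ t ∈ Q.eval s R, ∀ i, (t i).IsSpanOf s := by
  intro t ht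
  refine ht (fun _ => {t | ∀ i, (t i).IsSpanOf s}) fun ρ _ ν hν i => ?_
  obtain ⟨b, hb, hx⟩ := ρ.safe i
  have h := hν b hb
  cases b with
  | idb a =>
    obtain ⟨j, -, hj⟩ := Finset.mem_image.mp hx
    have h' : (ν (a.args j)).IsSpanOf s := h j
    rwa [hj] at h'
  | regex γ =>
    obtain ⟨c, hc, hm⟩ := h
    exact hc.bounds.2 _ (hm ⟨_, hx⟩)

/-- The spanner defined by `Q`: the tuples of the output relation, viewed as assignments to the
output variables. -/
def toSpanner : Spanner Alph Var where
  vars := Finset.univ.image Q.outVars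
  rel s := {r | ∃ t ∈ Q.eval s Q.out,
    ∀ i, r ⟨Q.outVars i, Finset.mem_image_of_mem Q.outVars (Finset.mem_univ i)⟩ = t i}
  isSpanOf := by
    rintro s r ⟨t, ht, hr⟩ ⟨x, hx⟩
    obtain ⟨i, -, rfl⟩ := Finset.mem_image.mp hx
    rw [hr i]
    exact Q.eval_isSpanOf s Q.out t ht i

/-- Every regex formula in the program has exactly two variables. -/
def IsBinary : Prop :=
  ∀ ρ ∈ Q.rules, ∀ γ : RegexFormula Alph Var, BodyAtom.regex γ ∈ ρ.body → γ.1.vars.card = 2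

end Program

/-! ### Polynomial time -/

/-- The output alphabet of the machines that compute spanners. -/
inductive OutSymbol : Type
  /-- a unary digit -/
  | one : OutSymbol
  /-- the end of a number -/
  | sep : OutSymbol
  /-- the end of a tuple -/
  | mark : OutSymbol

/-- A span is written as its two positions. The unary notation is polynomially equivalent to the
binary one, since the positions in a string `s` do not exceed `|s| + 1`. -/
def encodeSpan (σ : Span) : List OutSymbol :=
  List.replicate σ.start OutSymbol.one ++ [OutSymbol.sep] ++
    (List.replicate σ.finish OutSymbol.one ++ [OutSymbol.sep])

/-- A tuple of spans is written as the sequence of its entries, followed by an end mark. -/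
def encodeTuple {k : ℕ} (t : Fin k → Span) : List OutSymbol :=
  (List.ofFn t).flatMap encodeSpan ++ [OutSymbol.mark]

/-- A finite relation, given by a list of its tuples, is written tuple by tuple. -/
def encodeRelation {k : ℕ} (l : List (Fin k → Span)) : List OutSymbol :=
  l.flatMap encodeTuple

/-- A spanner is computable in polynomial time if, for an enumeration of its variables, some
polynomial-time Turing machine writes, on each input string `s`, a list of the records that the
spanner extracts from `s`. -/
def Spanner.PolyTime {Alph : Type} {Var : Type u} (P : Spanner Alph Var) : Prop :=
  ∃ (k : ℕ) (e : P.vars ≃ Fin k) (f : List Alph → List (Fin k → Span)),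
    Nonempty (Turing.TM2ComputableInPolyTime (id : List Alph → List Alph) encodeRelation f) ∧
    ∀ (s : List Alph) (r : P.vars → Span), r ∈ P.rel s ↔ ∃ t ∈ f s, ∀ x, r x = t (e x)

end RGXlog

/-!
A spanner that is defined by a program is computable in polynomial time, because the program can
be read as a Datalog program over positions of the string. A span is a pair of positions. The
regex formulas are eliminated: for each of their subexpressions there is a relation that holds for
two positions and an assignment of spans to variables if the expression can be parsed between
these positions so that each captured span is the assigned one. Functionality ensures that such a
parse tree of a formula determines its record. The rules over positions derive only what holds in
each model of the program (`Fact.meaning`), and what they derive is a model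
(`Program.isModel_derived`). The number of facts over positions is polynomial, since the arity is
fixed. So the naive fixpoint iteration takes polynomial time: the facts are kept on a tape that is
addressed by the argument tuples, read as numbers to the base `n + 2` (`Runs.saturate`). The
algorithm is written in a small structured language with counters and a tape, whose programs are
compiled to Turing machines with stacks (`Prog.computableInPolyTime`). This gives
`exists_computable_of_rules` and then `Program.polyTime_toSpanner`.

Conversely, a Turing machine is first replaced by a stack machine that performs one operation on
one stack in each step (`exists_stackMachine`). Its run is described by rules. A tuple of `d`
empty spans is a number with `d` digits to the base `n + 1`, and if `n ≠ 0` then `d` can be chosen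
such that these numbers suffice as times (`exists_eval_lt_pow`). The contents of a stack form a
linked list. They are never stored as a whole: a cell is created by a push operation and has as
its address the time after that operation, so that a configuration consists of a state, a time,
and for each stack the address of its topmost cell. The input, which is not created by push
operations, is addressed by prefixes of the string. Further rules read the result off the output
stack, with numbers in unary notation. All conditions on spans that are needed (first and last
position, the two positions around a symbol, the ends of a span, prefixes) are expressed by
formulas of the shape `A x{B y{C} D} E`, which have two variables. The derived facts are correct
because they hold in the intended database (`closed_simDb`), and by induction along the run and
along the output all records are derived (`SimDb.Closed.out_of_mem`). On the empty string there is
one span only, hence one time; a separate rule provides the only possible record there. This is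
`Spanner.PolyTime.exists_program`.
-/

namespace RGXlog

universe u

open Turing

/-! ### Polynomially bounded functions -/

/-- A function on the natural numbers that is bounded by a polynomial. -/
def PolyBounded (t : ℕ → ℕ) : Prop :=
  ∃ p : Polynomial ℕ, ∀ n, t n ≤ p.eval n

namespace PolyBounded

theorem const (c : ℕ) : PolyBounded fun _ => c :=
  ⟨Polynomial.C c, by simp⟩

theorem id : PolyBounded fun n => n :=
  ⟨Polynomial.X, by simp⟩

theorem add {f g : ℕ → ℕ} (hf : PolyBounded f) (hg : PolyBounded g) :
    PolyBounded fun n => f n + g n := by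
  obtain ⟨p, hp⟩ := hf
  obtain ⟨q, hq⟩ := hg
  exact ⟨p + q, fun n => by simpa using add_le_add (hp n) (hq n)⟩

theorem mul {f g : ℕ → ℕ} (hf : PolyBounded f) (hg : PolyBounded g) :
    PolyBounded fun n => f n * g n := by
  obtain ⟨p, hp⟩ := hf
  obtain ⟨q, hq⟩ := hg
  exact ⟨p * q, fun n => by simpa using Nat.mul_le_mul (hp n) (hq n)⟩

theorem pow {f : ℕ → ℕ} (hf : PolyBounded f) (k : ℕ) : PolyBounded fun n => f n ^ k := by
  obtain ⟨p, hp⟩ := hf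
  exact ⟨p ^ k, fun n => by simpa using Nat.pow_le_pow_left (hp n) k⟩

end PolyBounded

/-! ### A structured programming language for stack machines -/

section Programs

/-- The counters of a program: for each variable `v` of a set `V` the counter `x v`, which holds
its value, and `y v`, which holds the number of values still to come; three counters for
arithmetic; and the base of the positional number system that addresses the tape. -/
inductive Counter (V : Type) : Type
  | x (v : V) : Counter V
  | y (v : V) : Counter V
  | acc : Counter V
  | aux : Counter V
  | tmp : Counter V
  | base : Counter V
  deriving DecidableEq, Fintype

/-- The part of the memory that is not a counter. The tape, whose cells hold sets of elements of
`N`, is split at the head into `left` (reversed) and `right`; a cell beyond the right end is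
`∅`. -/
@[ext]
structure Data (Alph N : Type) where
  inp : List Alph
  out : List OutSymbol
  left : List (Finset N)
  right : List (Finset N)
  flag : Bool
  changed : Bool

/-- The memory of a program. -/
@[ext]
structure Store (Alph N V : Type) where
  ctr : Counter V → ℕ
  data : Data Alph N

/-- The stacks of the machine into which programs are compiled. -/
inductive StackName (V : Type) : Type
  | inp : StackName V
  | out : StackName V
  | left : StackName V
  | right : StackName V
  | ctr (c : Counter V) : StackName V
  deriving DecidableEq, Fintype

/-- The stack alphabets; counters are kept in unary. -/
def StackName.Symb (Alph N : Type) {V : Type} : StackName V → Type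
  | inp => Alph
  | out => OutSymbol
  | left => Finset N
  | right => Finset N
  | ctr _ => Unit

/-- The finite memory of the machine: the two flags of the program, and a bit and a cell that are
used within single steps only. -/
structure Register (N : Type) where
  flag : Bool
  changed : Bool
  test : Bool
  cell : Finset N

/-- Elementary instructions. -/
inductive Act (Alph N V : Type) : Type
  | nop : Act Alph N V
  | inc (c : Counter V) : Act Alph N V
  | dec (c : Counter V) : Act Alph N V
  | moveR : Act Alph N V
  | moveL : Act Alph N V
  | dropR : Act Alph N V
  | emit (o : OutSymbol) : Act Alph N V
  /-- read an input symbol and write an associated cell to the left of the head -/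
  | readInp (g : Option Alph → Finset N) : Act Alph N V
  | setFlag (b : Bool) : Act Alph N V
  | setChanged (b : Bool) : Act Alph N V
  /-- clear the flag unless the current cell contains `r` -/
  | test (r : N) : Act Alph N V
  /-- insert `r` into the current cell, and record whether this changes the cell -/
  | put (r : N) : Act Alph N V

/-- Tests. -/
inductive Cond (V : Type) : Type
  | pos (c : Counter V) : Cond V
  | inp : Cond V
  | left : Cond V
  | right : Cond V
  | flag : Cond V
  | changed : Cond V

/-- Programs. -/
inductive Prog (Alph N V : Type) : Type
  | act (a : Act Alph N V) : Prog Alph N V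
  | seq (p q : Prog Alph N V) : Prog Alph N V
  | ite (c : Cond V) (p q : Prog Alph N V) : Prog Alph N V
  | whileDo (c : Cond V) (p : Prog Alph N V) : Prog Alph N V

variable {Alph N V : Type} [DecidableEq N] [DecidableEq V]

/-- The effect of an instruction. -/
def Act.run : Act Alph N V → Store Alph N V → Store Alph N V
  | nop, S => S
  | inc c, S => { S with ctr := Function.update S.ctr c (S.ctr c + 1) }
  | dec c, S => { S with ctr := Function.update S.ctr c (S.ctr c - 1) }
  | moveR, ⟨c, d⟩ => ⟨c, { d with
      left := d.right.head?.getD ∅ :: d.left, right := d.right.tail }⟩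
  | moveL, ⟨c, d⟩ => ⟨c, { d with
      left := d.left.tail, right := d.left.head?.getD ∅ :: d.right }⟩
  | dropR, ⟨c, d⟩ => ⟨c, { d with right := d.right.tail }⟩
  | emit o, ⟨c, d⟩ => ⟨c, { d with out := o :: d.out }⟩
  | readInp g, ⟨c, d⟩ => ⟨c, { d with inp := d.inp.tail, left := g d.inp.head? :: d.left }⟩
  | setFlag b, ⟨c, d⟩ => ⟨c, { d with flag := b }⟩
  | setChanged b, ⟨c, d⟩ => ⟨c, { d with changed := b }⟩
  | test r, ⟨c, d⟩ => ⟨c, { d with flag := d.flag && decide (r ∈ d.right.head?.getD ∅) }⟩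
  | put r, ⟨c, d⟩ => ⟨c, { d with
      right := insert r (d.right.head?.getD ∅) :: d.right.tail
      changed := d.changed || decide (r ∉ d.right.head?.getD ∅) }⟩

/-- The value of a test. -/
def Cond.eval : Cond V → Store Alph N V → Bool
  | pos c, S => decide (0 < S.ctr c)
  | inp, S => !S.data.inp.isEmpty
  | left, S => !S.data.left.isEmpty
  | right, S => !S.data.right.isEmpty
  | flag, S => S.data.flag
  | changed, S => S.data.changed

/-- `Run p S S' t`: the program `p`, started in the memory `S`, stops in the memory `S'` after
exactly `t` steps. -/
inductive Run : Prog Alph N V → Store Alph N V → Store Alph N V → ℕ → Prop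
  | act (a : Act Alph N V) (S : Store Alph N V) : Run (.act a) S (a.run S) 1
  | seq {p q : Prog Alph N V} {S S₁ S₂ : Store Alph N V} {t₁ t₂ : ℕ} :
      Run p S S₁ t₁ → Run q S₁ S₂ t₂ → Run (.seq p q) S S₂ (t₁ + t₂)
  | ite_true {c : Cond V} {p q : Prog Alph N V} {S S' : Store Alph N V} {t : ℕ} :
      c.eval S = true → Run p S S' t → Run (.ite c p q) S S' (1 + t)
  | ite_false {c : Cond V} {p q : Prog Alph N V} {S S' : Store Alph N V} {t : ℕ} :
      c.eval S = false → Run q S S' t → Run (.ite c p q) S S' (1 + t)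
  | while_false {c : Cond V} {p : Prog Alph N V} {S : Store Alph N V} :
      c.eval S = false → Run (.whileDo c p) S S 1
  | while_true {c : Cond V} {p : Prog Alph N V} {S S₁ S₂ : Store Alph N V} {t₁ t₂ : ℕ} :
      c.eval S = true → Run p S S₁ t₁ → Run (.whileDo c p) S₁ S₂ t₂ →
      Run (.whileDo c p) S S₂ (1 + (t₁ + t₂))

/-! ### Compilation of programs to stack machines -/

namespace Store

/-- The stacks that represent a memory. -/
def stk (S : Store Alph N V) : ∀ k : StackName V, List (k.Symb Alph N)
  | .inp => S.data.inp
  | .out => S.data.out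
  | .left => S.data.left
  | .right => S.data.right
  | .ctr c => List.replicate (S.ctr c) ()

/-- The finite memory that represents a memory. -/
def register (S : Store Alph N V) : Register N :=
  ⟨S.data.flag, S.data.changed, false, ∅⟩

end Store

section Compile

variable {L : Type}

open TM2.Stmt

/-- An instruction followed by a statement. -/
def Act.stmt (a : Act Alph N V)
    (q : TM2.Stmt (StackName.Symb Alph N (V := V)) L (Register N)) :
    TM2.Stmt (StackName.Symb Alph N (V := V)) L (Register N) :=
  match a with
  | nop => q
  | inc c => push (.ctr c) (fun _ => ()) q
  | dec c => pop (.ctr c) (fun v _ => v) q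
  | moveR => pop .right (fun v o => { v with cell := Option.getD (α := Finset N) o ∅ })
      (push .left (fun v => v.cell) (load (fun v => { v with cell := ∅ }) q))
  | moveL => pop .left (fun v o => { v with cell := Option.getD (α := Finset N) o ∅ })
      (push .right (fun v => v.cell) (load (fun v => { v with cell := ∅ }) q))
  | dropR => pop .right (fun v _ => v) q
  | emit o => push .out (fun _ => o) q
  | readInp g => pop .inp (fun v o => { v with cell := g o })
      (push .left (fun v => v.cell) (load (fun v => { v with cell := ∅ }) q))
  | setFlag b => load (fun v => { v with flag := b }) q
  | setChanged b => load (fun v => { v with changed := b }) q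
  | test r => peek .right (fun v o =>
      { v with flag := v.flag && decide (r ∈ Option.getD (α := Finset N) o ∅) }) q
  | put r => pop .right (fun v o => { v with cell := Option.getD (α := Finset N) o ∅ })
      (push .right (fun v => (insert r v.cell : Finset N))
        (load (fun v => { v with changed := v.changed || decide (r ∉ v.cell), cell := ∅ }) q))

/-- A test followed by one of two jumps. -/
def Cond.stmt (c : Cond V) (l₁ l₂ : L) :
    TM2.Stmt (StackName.Symb Alph N (V := V)) L (Register N) :=
  let nonempty (k : StackName V) : TM2.Stmt (StackName.Symb Alph N (V := V)) L (Register N) :=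
    peek k (fun v o => { v with test := o.isSome })
      (branch (fun v => v.test) (load (fun v => { v with test := false }) (goto fun _ => l₁))
        (load (fun v => { v with test := false }) (goto fun _ => l₂)))
  match c with
  | pos c => nonempty (.ctr c)
  | inp => nonempty .inp
  | left => nonempty .left
  | right => nonempty .right
  | flag => branch (fun v => v.flag) (goto fun _ => l₁) (goto fun _ => l₂)
  | changed => branch (fun v => v.changed) (goto fun _ => l₁) (goto fun _ => l₂)

/-- The labels of the code of a program. -/
def Prog.Label : Prog Alph N V → Type
  | act _ => Unit
  | seq p q => p.Label ⊕ q.Label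
  | ite _ p q => Option (p.Label ⊕ q.Label)
  | whileDo _ p => Option p.Label

instance Prog.fintypeLabel : ∀ p : Prog Alph N V, Fintype p.Label
  | act _ => inferInstanceAs (Fintype Unit)
  | seq p q =>
    letI := p.fintypeLabel; letI := q.fintypeLabel
    inferInstanceAs (Fintype (p.Label ⊕ q.Label))
  | ite _ p q =>
    letI := p.fintypeLabel; letI := q.fintypeLabel
    inferInstanceAs (Fintype (Option (p.Label ⊕ q.Label)))
  | whileDo _ p =>
    letI := p.fintypeLabel
    inferInstanceAs (Fintype (Option p.Label))

/-- The label at which the code of a program is entered. -/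
def Prog.entry : ∀ p : Prog Alph N V, p.Label
  | act _ => ()
  | seq p _ => Sum.inl p.entry
  | ite _ _ _ => none
  | whileDo _ _ => none

/-- The code of a program inside a machine with labels `L`: `emb` embeds the labels of the program
and `exit` is the label to which control passes at the end. -/
def Prog.code : ∀ p : Prog Alph N V, (p.Label → L) → L →
    p.Label → TM2.Stmt (StackName.Symb Alph N (V := V)) L (Register N)
  | act a, _, exit, _ => a.stmt (goto fun _ => exit)
  | seq p q, emb, exit, l =>
    match l with
    | Sum.inl l => p.code (fun l => emb (Sum.inl l)) (emb (Sum.inr q.entry)) l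
    | Sum.inr l => q.code (fun l => emb (Sum.inr l)) exit l
  | ite c p q, emb, exit, l =>
    match l with
    | none => c.stmt (emb (some (Sum.inl p.entry))) (emb (some (Sum.inr q.entry)))
    | some (Sum.inl l) => p.code (fun l => emb (some (Sum.inl l))) exit l
    | some (Sum.inr l) => q.code (fun l => emb (some (Sum.inr l))) exit l
  | .whileDo c p, emb, exit, l =>
    match l with
    | none => c.stmt (emb (some p.entry)) exit
    | some l => p.code (fun l => emb (some l)) (emb none) l

/-- The configuration of the machine at the label `l` with the memory `S`. -/
def Store.cfg (S : Store Alph N V) (l : Option L) :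
    TM2.Cfg (StackName.Symb Alph N (V := V)) L (Register N) :=
  ⟨l, S.register, S.stk⟩

theorem Act.stepAux_stmt (a : Act Alph N V) (S : Store Alph N V)
    (q : TM2.Stmt (StackName.Symb Alph N (V := V)) L (Register N)) :
    TM2.stepAux (a.stmt q) S.register S.stk =
      TM2.stepAux q (a.run S).register (a.run S).stk := by
  obtain ⟨c, d⟩ := S
  cases a
  case inc c' =>
    simp only [Act.stmt, TM2.stepAux]
    congr 1
    funext k
    by_cases hk : k = .ctr c'
    · subst hk
      simp only [Act.run, Store.stk, Function.update_self]
      exact (List.replicate_succ (n := c c') (a := ())).symm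
    · rw [Function.update_of_ne hk]
      cases k <;> try rfl
      rename_i c''
      have hc : c'' ≠ c' := fun h => hk (congrArg _ h)
      simp [Act.run, Store.stk, hc]
  case dec c' =>
    simp only [Act.stmt, TM2.stepAux]
    congr 1
    funext k
    by_cases hk : k = .ctr c'
    · subst hk
      simp only [Act.run, Store.stk, Function.update_self]
      exact List.tail_replicate
    · rw [Function.update_of_ne hk]
      cases k <;> try rfl
      rename_i c''
      have hc : c'' ≠ c' := fun h => hk (congrArg _ h)
      simp [Act.run, Store.stk, hc]
  all_goals
    simp only [Act.stmt, TM2.stepAux]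
    congr 1
    try (funext k; cases k <;> rfl)

omit [DecidableEq N] in
theorem Cond.stepAux_stmt (c : Cond V) (S : Store Alph N V) (l₁ l₂ : L) :
    TM2.stepAux (c.stmt (Alph := Alph) l₁ l₂) S.register S.stk =
      S.cfg (some (if c.eval S then l₁ else l₂)) := by
  obtain ⟨ctr, ⟨inp, out, left, right, flag, changed⟩⟩ := S
  cases c with
  | pos c =>
    change (bif (List.replicate (ctr c) ()).head?.isSome then _ else _) = _
    cases h : ctr c <;> simp only [Cond.eval, h] <;> rfl
  | inp => cases inp <;> rfl
  | left => cases left <;> rfl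
  | right => cases right <;> rfl
  | flag => cases flag <;> simp [Cond.stmt, Cond.eval, Store.cfg, Store.register]
  | changed => cases changed <;> simp [Cond.stmt, Cond.eval, Store.cfg, Store.register]

/-- The code of a program simulates it step by step. -/
theorem Run.simulate {p : Prog Alph N V} {S S' : Store Alph N V} {t : ℕ} (h : Run p S S' t)
    {L : Type} (M : L → TM2.Stmt (StackName.Symb Alph N (V := V)) L (Register N))
    (emb : p.Label → L) (exit : L) (hM : ∀ l, M (emb l) = p.code emb exit l) :
    (flip bind (TM2.step M))^[t] (some (S.cfg (some (emb p.entry)))) =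
      some (S'.cfg (some exit)) := by
  induction h generalizing exit with
  | act a S =>
    change some (TM2.stepAux (M _) _ _) = _
    rw [hM]
    change some (TM2.stepAux (a.stmt _) _ _) = _
    rw [Act.stepAux_stmt]
    rfl
  | @seq p q S S₁ S₂ t₁ t₂ _ _ ih₁ ih₂ =>
    rw [Nat.add_comm, Function.iterate_add_apply]
    have h₁ := ih₁ (fun l => emb (Sum.inl l)) (emb (Sum.inr q.entry)) fun l => hM (Sum.inl l)
    have h₂ := ih₂ (fun l => emb (Sum.inr l)) exit fun l => hM (Sum.inr l)
    exact (congrArg _ h₁).trans h₂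
  | @ite_true c p q S S' t hc _ ih =>
    rw [Nat.add_comm, Function.iterate_add_apply]
    have h := ih (fun l => emb (some (Sum.inl l))) exit fun l => hM (some (Sum.inl l))
    refine Eq.trans (congrArg _ ?_) h
    change some (TM2.stepAux (M _) _ _) = _
    rw [hM]
    change some (TM2.stepAux (c.stmt _ _) _ _) = _
    rw [Cond.stepAux_stmt, hc]
    rfl
  | @ite_false c p q S S' t hc _ ih =>
    rw [Nat.add_comm, Function.iterate_add_apply]
    have h := ih (fun l => emb (some (Sum.inr l))) exit fun l => hM (some (Sum.inr l))
    refine Eq.trans (congrArg _ ?_) h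
    change some (TM2.stepAux (M _) _ _) = _
    rw [hM]
    change some (TM2.stepAux (c.stmt _ _) _ _) = _
    rw [Cond.stepAux_stmt, hc]
    rfl
  | @while_false c p S hc =>
    change some (TM2.stepAux (M _) _ _) = _
    rw [hM]
    change some (TM2.stepAux (c.stmt _ _) _ _) = _
    rw [Cond.stepAux_stmt, hc]
    rfl
  | @while_true c p S S₁ S₂ t₁ t₂ hc _ _ ih₁ ih₂ =>
    rw [Nat.add_comm, Function.iterate_add_apply, Nat.add_comm, Function.iterate_add_apply]
    have h₁ := ih₁ (fun l => emb (some l)) (emb none) fun l => hM (some l)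
    refine Eq.trans (congrArg _ ?_) (ih₂ emb exit hM)
    refine Eq.trans (congrArg _ ?_) h₁
    change some (TM2.stepAux (M _) _ _) = _
    rw [hM]
    change some (TM2.stepAux (c.stmt _ _) _ _) = _
    rw [Cond.stepAux_stmt, hc]
    rfl

end Compile

/-- `Runs p S S' t`: the program `p`, started in the memory `S`, stops in the memory `S'` within
`t` steps. -/
def Runs (p : Prog Alph N V) (S S' : Store Alph N V) (t : ℕ) : Prop :=
  ∃ t' ≤ t, Run p S S' t'

/-- The memory in which a computation on the input `s` starts. -/
def Store.init (s : List Alph) : Store Alph N V :=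
  ⟨fun _ => 0, ⟨s, [], [], [], false, false⟩⟩

/-- The memory in which a computation with the output `w` ends. -/
def Store.final (w : List OutSymbol) : Store Alph N V :=
  ⟨fun _ => 0, ⟨[], w, [], [], false, false⟩⟩

/-- The machine that executes a program; after the last instruction, one step is used to halt. -/
noncomputable def Prog.machine [Fintype Alph] [Fintype N] [Fintype V] (p : Prog Alph N V) :
    FinTM2 where
  K := StackName V
  k₀ := .inp
  k₁ := .out
  Γ := StackName.Symb Alph N
  Λ := Option p.Label
  main := some p.entry
  σ := Register N
  initialState := ⟨false, false, false, ∅⟩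
  σFin := Fintype.ofInjective (β := Bool × Bool × Bool × Finset N)
    (fun v => (v.flag, v.changed, v.test, v.cell)) (by
      rintro ⟨⟩ ⟨⟩ h
      simpa using h)
  Γk₀Fin := inferInstanceAs (Fintype Alph)
  m l := match l with
    | none => .halt
    | some l => p.code some none l

/-- A function is computable in polynomial time by a Turing machine if it is computable in
polynomial time by a program that cleans up its memory. -/
theorem Prog.computableInPolyTime [Fintype Alph] [Fintype N] [Fintype V] (p : Prog Alph N V)
    {β : Type} (enc : β → List OutSymbol) (f : List Alph → β) {T : ℕ → ℕ} (hT : PolyBounded T)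
    (h : ∀ s, Runs p (Store.init s) (Store.final (enc (f s))) (T s.length)) :
    Nonempty (TM2ComputableInPolyTime (id : List Alph → List Alph) enc f) := by
  obtain ⟨P, hP⟩ := hT
  refine ⟨{ tm := p.machine, inputAlphabet := Equiv.refl Alph, outputAlphabet := Equiv.refl _,
            time := P + 1, outputsFun := fun s => ?_ }⟩
  have hr := h s
  refine { steps := 1 + hr.choose, evals_in_steps := ?_, steps_le_m := ?_ }
  · have hsim := (hr.choose_spec.2).simulate p.machine.m some none fun _ => rfl
    have h₀ : initList p.machine (List.map (Equiv.refl Alph).invFun (id s)) =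
        (Store.init s : Store Alph N V).cfg (some (some p.entry)) := by
      refine congrArg (TM2.Cfg.mk _ _) (funext fun k => ?_)
      cases k
      case inp => exact List.map_id s
      all_goals rfl
    have h₁ : haltList p.machine (List.map (Equiv.refl OutSymbol).invFun (enc (f s))) =
        (Store.final (enc (f s)) : Store Alph N V).cfg none := by
      refine congrArg (TM2.Cfg.mk _ _) (funext fun k => ?_)
      cases k
      case out => exact List.map_id (enc (f s))
      all_goals rfl
    rw [Function.iterate_add_apply]
    refine Eq.trans (congrArg _ ((congrArg _ (congrArg some h₀)).trans hsim)) ?_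
    exact (congrArg some h₁).symm
  · have := hr.choose_spec.1
    have := hP s.length
    simp only [id, Polynomial.eval_add, Polynomial.eval_one]
    omega

/-! ### Loops and arithmetic on counters -/

section Macros

open Counter

namespace Runs

variable {p q : Prog Alph N V} {S S₁ S₂ S' : Store Alph N V} {t t' t₁ t₂ : ℕ}

theorem mono (h : Runs p S S' t) (ht : t ≤ t') : Runs p S S' t' := by
  obtain ⟨u, hu, hr⟩ := h
  exact ⟨u, hu.trans ht, hr⟩

theorem congr {T T' : Store Alph N V} (h : Runs p S S' t) (hS : S = T) (hS' : S' = T')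
    (ht : t ≤ t') : Runs p T T' t' := by
  subst hS hS'
  exact h.mono ht

theorem act (a : Act Alph N V) (S : Store Alph N V) : Runs (.act a) S (a.run S) 1 :=
  ⟨1, le_rfl, .act a S⟩

theorem seq (h₁ : Runs p S S₁ t₁) (h₂ : Runs q S₁ S₂ t₂) :
    Runs (.seq p q) S S₂ (t₁ + t₂) := by
  obtain ⟨u₁, hu₁, hr₁⟩ := h₁
  obtain ⟨u₂, hu₂, hr₂⟩ := h₂
  exact ⟨u₁ + u₂, add_le_add hu₁ hu₂, .seq hr₁ hr₂⟩

theorem ite_true {c : Cond V} (hc : c.eval S = true) (h : Runs p S S' t) :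
    Runs (.ite c p q) S S' (1 + t) := by
  obtain ⟨u, hu, hr⟩ := h
  exact ⟨1 + u, by omega, .ite_true hc hr⟩

theorem ite_false {c : Cond V} (hc : c.eval S = false) (h : Runs q S S' t) :
    Runs (.ite c p q) S S' (1 + t) := by
  obtain ⟨u, hu, hr⟩ := h
  exact ⟨1 + u, by omega, .ite_false hc hr⟩

theorem while_false {c : Cond V} (hc : c.eval S = false) : Runs (.whileDo c p) S S 1 :=
  ⟨1, le_rfl, .while_false hc⟩

theorem while_true {c : Cond V} (hc : c.eval S = true) (h₁ : Runs p S S₁ t₁)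
    (h₂ : Runs (.whileDo c p) S₁ S₂ t₂) : Runs (.whileDo c p) S S₂ (1 + (t₁ + t₂)) := by
  obtain ⟨u₁, hu₁, hr₁⟩ := h₁
  obtain ⟨u₂, hu₂, hr₂⟩ := h₂
  exact ⟨1 + (u₁ + u₂), by omega, .while_true hc hr₁ hr₂⟩

end Runs

/-- Count the counter `a` down to zero, and execute `p` each time. -/
def Prog.loop (a : Counter V) (p : Prog Alph N V) : Prog Alph N V :=
  .whileDo (.pos a) (.seq (.act (.dec a)) p)

/-- The rule for loops: the invariant `I i` holds after `i` rounds, and the counter `a` holds the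
number of rounds that remain. -/
theorem Runs.loop_of_invariant {a : Counter V} {p : Prog Alph N V} {t k : ℕ}
    (I : ℕ → Store Alph N V → Prop) (ha : ∀ i S, I i S → S.ctr a = k - i)
    (h : ∀ i < k, ∀ S, I i S → ∃ S', I (i + 1) S' ∧ Runs p ((Act.dec a).run S) S' t)
    {S : Store Alph N V} (hS : I 0 S) :
    ∃ S', I k S' ∧ Runs (p.loop a) S S' (k * (t + 2) + 1) := by
  have key : ∀ j ≤ k, ∀ S, I (k - j) S →
      ∃ S', I k S' ∧ Runs (p.loop a) S S' (j * (t + 2) + 1) := by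
    intro j
    induction j with
    | zero =>
      intro _ S hS
      refine ⟨S, hS, (Runs.while_false ?_).mono (by omega)⟩
      simp [Cond.eval, ha _ _ hS]
    | succ j ih =>
      intro hj S hS
      obtain ⟨S₁, h₁, hr₁⟩ := h _ (by omega) S hS
      rw [show k - (j + 1) + 1 = k - j by omega] at h₁
      obtain ⟨S', h', hr'⟩ := ih (by omega) S₁ h₁
      refine ⟨S', h', (Runs.while_true ?_ ((Runs.act _ _).seq hr₁) hr').mono ?_⟩
      · simp only [Cond.eval, ha _ _ hS, decide_eq_true_eq]
        omega
      · rw [Nat.succ_mul]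
        omega
  exact key k le_rfl S (by simpa using hS)

/-- The rule for loops whose memory after `i` rounds is known exactly. -/
theorem Runs.loop {a : Counter V} {p : Prog Alph N V} {t k : ℕ} (F : ℕ → Store Alph N V)
    (ha : ∀ i, (F i).ctr a = k - i)
    (h : ∀ i < k, Runs p ((Act.dec a).run (F i)) (F (i + 1)) t) :
    Runs (p.loop a) (F 0) (F k) (k * (t + 2) + 1) := by
  obtain ⟨S', rfl, h'⟩ := Runs.loop_of_invariant (p := p) (fun i S => S = F i)
    (by rintro i _ rfl; exact ha i) (fun i hi S hS => ⟨_, rfl, hS ▸ h i hi⟩) (S := F 0) rfl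
  exact h'

/-- Move the contents of the counter `a` to the counter `b`. -/
def Prog.transfer (a b : Counter V) : Prog Alph N V :=
  (Prog.act (.inc b)).loop a

theorem Runs.transfer {a b : Counter V} (hab : a ≠ b) (c : Counter V → ℕ) (d : Data Alph N) :
    Runs (Prog.transfer a b) ⟨c, d⟩
      ⟨Function.update (Function.update c b (c b + c a)) a 0, d⟩ (c a * 3 + 1) := by
  have := Runs.loop (a := a) (p := Prog.act (.inc b)) (t := 1) (k := c a)
    (fun i => ⟨Function.update (Function.update c b (c b + i)) a (c a - i), d⟩)
    (fun i => by simp) fun i hi => by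
      refine (Runs.act _ _).congr rfl ?_ le_rfl
      refine Store.ext (funext fun z => ?_) rfl
      simp only [Act.run]
      by_cases hz : z = a
      · subst hz
        simp [hab]
        omega
      · by_cases hz' : z = b
        · subst hz'
          simp [hz]
          omega
        · simp [hz, hz']
  exact this.congr (by simp) (by simp) (by simp)

/-- Execute `p` as often as the counter `a` says, without changing `a`. -/
def Prog.repeat (a : Counter V) (p : Prog Alph N V) : Prog Alph N V :=
  .seq ((Prog.seq (.act (.inc tmp)) p).loop a) (Prog.transfer tmp a)

/-- The body has to work for all values of `a` and `tmp`, which change while the loop runs and are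
restored after it. -/
theorem Runs.repeat {a : Counter V} (hat : a ≠ tmp) {p : Prog Alph N V} {t k : ℕ}
    (G : ℕ → Store Alph N V) (ha : ∀ i, (G i).ctr a = k) (htmp : ∀ i, (G i).ctr tmp = 0)
    (h : ∀ i < k, ∀ u v,
      Runs p ⟨Function.update (Function.update (G i).ctr a u) tmp v, (G i).data⟩
        ⟨Function.update (Function.update (G (i + 1)).ctr a u) tmp v, (G (i + 1)).data⟩ t) :
    Runs (p.repeat a) (G 0) (G k) (k * (t + 6) + 2) := by
  have h₁ := Runs.loop (a := a) (p := Prog.seq (.act (.inc tmp)) p) (t := 1 + t) (k := k)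
    (fun i => ⟨Function.update (Function.update (G i).ctr a (k - i)) tmp i, (G i).data⟩)
    (fun i => by simp [hat]) fun i hi => by
      refine Runs.seq (Runs.act _ _) ?_
      refine (h i hi (k - (i + 1)) (i + 1)).congr ?_ rfl le_rfl
      refine Store.ext (funext fun z => ?_) rfl
      simp only [Act.run]
      by_cases hz : z = a
      · subst hz
        simp [hat]
        omega
      · by_cases hz' : z = tmp
        · subst hz'
          simp [hat.symm]
        · simp [hz, hz']
  have h₂ := Runs.transfer (Alph := Alph) (N := N) (Ne.symm hat)
    (Function.update (Function.update (G k).ctr a (k - k)) tmp k) (G k).data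
  refine (h₁.seq h₂).congr ?_ ?_ (by simp; ring_nf; omega)
  · refine Store.ext (funext fun z => ?_) rfl
    by_cases hz : z = a
    · subst hz
      simp [hat, ha]
    · by_cases hz' : z = tmp
      · subst hz'
        simp [htmp]
      · simp [hz, hz']
  · refine Store.ext (funext fun z => ?_) rfl
    by_cases hz : z = a
    · subst hz
      simp [hat, ha]
    · by_cases hz' : z = tmp
      · subst hz'
        simp [htmp]
      · simp [hz, hz']

/-- Add the counter `a` to the counter `b`. -/
def Prog.addTo (a b : Counter V) : Prog Alph N V :=
  (Prog.act (.inc b)).repeat a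

theorem Runs.addTo {a b : Counter V} (hab : a ≠ b) (hat : a ≠ tmp) (hbt : b ≠ tmp)
    (c : Counter V → ℕ) (hc : c tmp = 0) (d : Data Alph N) :
    Runs (Prog.addTo a b) ⟨c, d⟩ ⟨Function.update c b (c b + c a), d⟩ (c a * 7 + 2) := by
  have := Runs.repeat (a := a) hat (p := Prog.act (.inc b)) (t := 1) (k := c a)
    (fun i => ⟨Function.update c b (c b + i), d⟩)
    (fun i => by simp [hab]) (fun i => by simp [hbt.symm, hc]) fun i hi u v => by
      refine (Runs.act _ _).congr rfl ?_ le_rfl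
      refine Store.ext (funext fun z => ?_) rfl
      simp only [Act.run]
      by_cases hz : z = a
      · subst hz
        simp [hat, hab]
      · by_cases hz' : z = tmp
        · subst hz'
          simp [hbt.symm]
        · by_cases hz'' : z = b
          · subst hz''
            simp [hz, hz']
            omega
          · simp [hz, hz', hz'']
  exact this.congr (by simp) rfl le_rfl

/-- Multiply `acc` by `base`. -/
def Prog.mulBase : Prog Alph N V :=
  .seq ((Prog.addTo base aux).loop acc) (Prog.transfer aux acc)

theorem Runs.mulBase (c : Counter V → ℕ) (htmp : c tmp = 0) (haux : c aux = 0)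
    (d : Data Alph N) :
    Runs Prog.mulBase ⟨c, d⟩ ⟨Function.update c acc (c acc * c base), d⟩
      (c acc * (c base * 10 + 4) + 2) := by
  have h₁ := Runs.loop (a := acc) (p := Prog.addTo base aux) (t := c base * 7 + 2) (k := c acc)
    (fun i => ⟨Function.update (Function.update c aux (i * c base)) acc (c acc - i), d⟩)
    (fun i => by simp) fun i hi => by
      have := Runs.addTo (a := base) (b := aux) (by simp) (by simp) (by simp)
        (Function.update (Function.update c aux (i * c base)) acc (c acc - (i + 1)))
        (by simp [htmp]) d
      refine this.congr ?_ ?_ (by simp)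
      · refine Store.ext (funext fun z => ?_) rfl
        cases z <;> simp [Act.run]
        omega
      · refine Store.ext (funext fun z => ?_) rfl
        cases z <;> simp
        ring
  have h₂ := Runs.transfer (Alph := Alph) (N := N) (a := aux) (b := acc) (by simp)
    (Function.update (Function.update c aux (c acc * c base)) acc (c acc - c acc)) d
  refine (h₁.seq h₂).congr ?_ ?_ (by simp; ring_nf; omega)
  · refine Store.ext (funext fun z => ?_) rfl
    cases z <;> simp [haux]
  · refine Store.ext (funext fun z => ?_) rfl
    cases z <;> simp [haux]

end Macros

/-! ### Datalog over string positions -/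

/-- A term over variables that range over the positions `0, …, n` of a string of length `n`. -/
inductive Term (V : Type) : Type
  | zero : Term V
  | var (v : V) : Term V
  | succ (v : V) : Term V

/-- The value of a term. -/
def Term.eval (x : V → ℕ) : Term V → ℕ
  | zero => 0
  | var v => x v
  | succ v => x v + 1

/-- An atom; all relation symbols have the arity `m + 1`. -/
structure PosAtom (N V : Type) (m : ℕ) where
  rel : N
  args : Fin (m + 1) → Term V

/-- A rule; its variables range over all positions, whether they occur in the body or not. -/
structure PosRule (N V : Type) (m : ℕ) where
  head : PosAtom N V m
  body : List (PosAtom N V m)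

/-- The facts that the rules derive on the string `s`. Initially, there is a fact for each
position `i`, whose relation symbol `sy s[i]?` tells which symbol follows (`none` at the end). -/
inductive Fact {m : ℕ} (sy : Option Alph → N) (rules : List (PosRule N V m)) (s : List Alph) :
    N → (Fin (m + 1) → ℕ) → Prop
  | symbol (i : ℕ) (hi : i ≤ s.length) : Fact sy rules s (sy s[i]?) (Fin.cons i fun _ => 0)
  | rule (ρ : PosRule N V m) (hρ : ρ ∈ rules) (x : V → ℕ) (hx : ∀ v, x v ≤ s.length)
      (h : ∀ a ∈ ρ.body, Fact sy rules s a.rel fun i => (a.args i).eval x) :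
      Fact sy rules s ρ.head.rel fun i => (ρ.head.args i).eval x

/-- The cell of the tape that represents an argument tuple: the number with these digits. -/
def PosAtom.addr {m : ℕ} (a : PosAtom N V m) (B : ℕ) (x : V → ℕ) : ℕ :=
  Nat.ofDigits B ((List.ofFn a.args).map (Term.eval x))

/-- An atom holds in a tape `T` under the assignment `x`. -/
def PosAtom.Sat {m : ℕ} (a : PosAtom N V m) (B : ℕ) (T : ℕ → Finset N) (x : V → ℕ) : Prop :=
  a.rel ∈ T (a.addr B x)

/-! ### Access to the tape -/

section Tape

open Counter

/-- Add the value of a term to `acc`. -/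
def Prog.addTerm : Term V → Prog Alph N V
  | .zero => .act .nop
  | .var v => Prog.addTo (x v) acc
  | .succ v => .seq (Prog.addTo (x v) acc) (.act (.inc acc))

theorem Runs.addTerm (u : Term V) (c : Counter V → ℕ) (htmp : c tmp = 0) {n : ℕ}
    (hx : ∀ v, c (x v) ≤ n) (d : Data Alph N) :
    Runs (Prog.addTerm u) ⟨c, d⟩
      ⟨Function.update c acc (c acc + u.eval fun v => c (x v)), d⟩ (n * 7 + 3) := by
  cases u with
  | zero =>
    exact (Runs.act _ _).congr rfl (Store.ext (by simp [Term.eval, Act.run]) rfl) (by omega)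
  | var v =>
    refine (Runs.addTo (by simp) (by simp) (by simp) c htmp d).congr rfl rfl ?_
    have := hx v
    omega
  | succ v =>
    refine ((Runs.addTo (by simp) (by simp) (by simp) c htmp d).seq (Runs.act _ _)).congr rfl
      (Store.ext ?_ rfl) ?_
    · simp [Act.run, Term.eval, add_assoc]
    · have := hx v
      omega

/-- Compute in `acc` the number whose digits are the values of the given terms. -/
def Prog.horner : List (Term V) → Prog Alph N V
  | [] => .act .nop
  | u :: us => .seq (Prog.horner us) (.seq .mulBase (.addTerm u))

/-- A time bound for `Prog.horner` with `k` terms. -/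
def hornerTime (n : ℕ) : ℕ → ℕ
  | 0 => 1
  | k + 1 => hornerTime n k + ((n + 2) ^ k * ((n + 2) * 10 + 4) + 2 + (n * 7 + 3))

omit [DecidableEq N] [DecidableEq V] in
theorem Term.eval_lt {n : ℕ} {y : V → ℕ} (hy : ∀ v, y v ≤ n) (u : Term V) :
    u.eval y < n + 2 := by
  cases u with
  | zero => simp [Term.eval]
  | var v => exact (hy v).trans_lt (by omega)
  | succ v => exact Nat.succ_lt_succ ((hy v).trans_lt (by omega))

omit [DecidableEq N] [DecidableEq V] in
theorem Term.ofDigits_lt {n : ℕ} {y : V → ℕ} (hy : ∀ v, y v ≤ n) (us : List (Term V)) :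
    Nat.ofDigits (n + 2) (us.map (Term.eval y)) < (n + 2) ^ us.length := by
  have := Nat.ofDigits_lt_base_pow_length (b := n + 2) (l := us.map (Term.eval y)) (by omega)
    (by simpa using fun u _ => Term.eval_lt hy u)
  simpa using this

/-- The arguments of an atom are evaluated to the address of a cell by Horner's scheme. The base is
`n + 2`, since a term is at most `n + 1`. -/
theorem Runs.horner {n : ℕ} (us : List (Term V)) (c : Counter V → ℕ) (htmp : c tmp = 0)
    (hacc : c acc = 0) (haux : c aux = 0) (hbase : c base = n + 2) (hx : ∀ v, c (x v) ≤ n)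
    (d : Data Alph N) :
    Runs (Prog.horner us) ⟨c, d⟩
      ⟨Function.update c acc (Nat.ofDigits (n + 2) (us.map (Term.eval fun v => c (x v)))), d⟩
      (hornerTime n us.length) := by
  induction us with
  | nil =>
    exact (Runs.act _ _).congr rfl (Store.ext (by simp [Act.run, ← hacc]) rfl) le_rfl
  | cons u us ih =>
    have hlt := Term.ofDigits_lt hx us
    set D := Nat.ofDigits (n + 2) (us.map (Term.eval fun v => c (x v))) with hD
    have h₁ := Runs.mulBase (Function.update c acc D) (by simp [htmp]) (by simp [haux]) d
    have h₂ := Runs.addTerm (n := n) u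
      (Function.update (Function.update c acc D) acc (D * (n + 2))) (by simp [htmp])
      (by simpa using hx) d
    refine (ih.seq (h₁.seq (h₂.congr ?_ rfl le_rfl))).congr rfl ?_ ?_
    · simp [hbase]
    · refine Store.ext ?_ rfl
      simp only [Nat.ofDigits_cons, ← hD, List.map_cons]
      simp
      ring_nf
    · simp only [List.length_cons, hornerTime]
      refine Nat.add_le_add_left (Nat.add_le_add_right (Nat.add_le_add_right ?_ _) _) _
      simpa [hbase] using hlt.le

/-- The content of the tape when the head is at its left end. -/
def Data.view (d : Data Alph N) (i : ℕ) : Finset N :=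
  d.right.getD i ∅

/-- Go to the cell whose address is given by the terms `us`, execute `a` there, and return. -/
def Prog.visit (us : List (Term V)) (a : Act Alph N V) : Prog Alph N V :=
  .seq (.horner us) (.seq ((Prog.act .moveR).loop acc)
    (.seq (.act a) (.whileDo .left (.act .moveL))))

theorem Runs.rewind (c : Counter V → ℕ) (d : Data Alph N) :
    Runs (.whileDo .left (.act .moveL)) ⟨c, d⟩
      ⟨c, { d with left := [], right := d.left.reverse ++ d.right }⟩ (d.left.length * 2 + 1) := by
  obtain ⟨inp, out, left, right, flag, changed⟩ := d
  induction left generalizing right with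
  | nil => exact Runs.while_false rfl
  | cons b left ih =>
    refine (Runs.while_true rfl (Runs.act _ _) (ih (b :: right))).congr rfl ?_ ?_
    · simp
    · simp only [List.length_cons]
      omega

theorem Runs.seek (c : Counter V → ℕ) (d : Data Alph N) (hd : d.left = []) :
    Runs ((Prog.act .moveR).loop acc) ⟨c, d⟩
      ⟨Function.update c acc 0,
        { d with left := ((List.range (c acc)).map d.view).reverse
                 right := d.right.drop (c acc) }⟩ (c acc * 3 + 1) := by
  have := Runs.loop (a := acc) (p := Prog.act .moveR) (t := 1) (k := c acc)
    (fun i => ⟨Function.update c acc (c acc - i),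
      { d with left := ((List.range i).map d.view).reverse, right := d.right.drop i }⟩)
    (fun i => by simp) fun i hi => by
      refine (Runs.act _ _).congr rfl ?_ le_rfl
      simp only [Act.run, Store.mk.injEq, Data.mk.injEq, true_and, and_true]
      refine ⟨?_, ?_, ?_⟩
      · simp only [Function.update_self, Function.update_idem]
        congr 1
      · simp [List.range_succ, Data.view]
      · simp
  exact this.congr (Store.ext (by simp) (Data.ext rfl rfl (by simp [hd]) (by simp) rfl rfl))
    (by simp) le_rfl

/-- The tape after a visit to cell `a` that replaces the cell and what follows by `R`. -/
def Data.spliced (d : Data Alph N) (a : ℕ) (R : List (Finset N)) : List (Finset N) :=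
  (List.range a).map d.view ++ R

omit [DecidableEq N] in
theorem Data.getD_spliced (d : Data Alph N) (a : ℕ) (R : List (Finset N)) (i : ℕ) :
    (d.spliced a R).getD i ∅ = if i < a then d.view i else R.getD (i - a) ∅ := by
  unfold Data.spliced
  split_ifs with h
  · simp [List.getElem?_append, h]
  · simp [List.getElem?_append, h]

/-- Visiting a cell does not change the counters; so the instruction `e` at the cell determines the
effect. -/
theorem Runs.visit {n : ℕ} (us : List (Term V)) (e : Act Alph N V) (c : Counter V → ℕ)
    (htmp : c tmp = 0) (hacc : c acc = 0) (haux : c aux = 0) (hbase : c base = n + 2)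
    (hx : ∀ v, c (x v) ≤ n) (d d' : Data Alph N) (hd : d.left = []) {a : ℕ}
    (ha : a = Nat.ofDigits (n + 2) (us.map (Term.eval fun v => c (x v))))
    (hd' : d'.left = ((List.range a).map d.view).reverse)
    (he : ∀ c, e.run ⟨c, { d with left := ((List.range a).map d.view).reverse
                                  right := d.right.drop a }⟩ = ⟨c, d'⟩) :
    Runs (Prog.visit us e) ⟨c, d⟩ ⟨c, { d' with left := [], right := d.spliced a d'.right }⟩
      (hornerTime n us.length + (n + 2) ^ us.length * 5 + 3) := by
  have hlt := Term.ofDigits_lt hx us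
  rw [← ha] at hlt
  have h₁ := Runs.horner us c htmp hacc haux hbase hx d
  rw [← ha] at h₁
  have h₂ := Runs.seek (Function.update c acc a) d hd
  simp only [Function.update_self, Function.update_idem] at h₂
  have h₃ := Runs.act e ⟨Function.update c acc 0,
    { d with left := ((List.range a).map d.view).reverse, right := d.right.drop a }⟩
  rw [he] at h₃
  have h₄ := Runs.rewind (Function.update c acc 0) d'
  refine (h₁.seq (h₂.seq (h₃.seq h₄))).congr rfl ?_ ?_
  · rw [← hacc]
    simp [hd', Data.spliced]
  · simp only [hd', List.length_reverse, List.length_map, List.length_range]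
    omega

end Tape

/-! ### Loops over assignments -/

section Assignments

open Counter

/-- The counters are in the state in which the body of a loop over all assignments to variables
is executed, on a string of length `n`. -/
structure Ready (n : ℕ) (c : Counter V → ℕ) : Prop where
  tmp : c tmp = 0
  acc : c acc = 0
  aux : c aux = 0
  base : c base = n + 2
  x_le : ∀ v, c (x v) ≤ n

/-- From a tape with the head at its left end and from counters `c`, the program `p` reaches in
time `t` a tape with the head at its left end that is related by `P` to the original one; it
does not change the counters. -/
def Exec (c : Counter V → ℕ) (p : Prog Alph N V) (P : Data Alph N → Data Alph N → Prop) (t : ℕ) :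
    Prop :=
  ∀ d, d.left = [] → ∃ d', d'.left = [] ∧ P d d' ∧ Runs p ⟨c, d⟩ ⟨c, d'⟩ t

/-- Execute `p` for all values `0, …, n` of the variables in a list. -/
def Prog.forAll (p : Prog Alph N V) : List V → Prog Alph N V
  | [] => p
  | v :: vs =>
    .seq ((Prog.seq (p.forAll vs) (.act (.inc (x v)))).loop (y v)) (.transfer (x v) (y v))

/-- A time bound for `Prog.forAll` with `k` variables and a body that takes the time `t`. -/
def forAllTime (n t : ℕ) : ℕ → ℕ
  | 0 => t
  | k + 1 => (n + 1) * (forAllTime n t k + 6) + 2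

/-- If the effects of the body for sets of assignments compose, then the loop has the effect for the
set of all assignments to the variables of the loop. -/
theorem Exec.forAll {n t : ℕ} {p : Prog Alph N V}
    (P : Set (V → ℕ) → Data Alph N → Data Alph N → Prop) (hnil : ∀ d, P ∅ d d)
    (hcomp : ∀ A B d d₁ d₂, P A d d₁ → P B d₁ d₂ → P (A ∪ B) d d₂)
    (hp : ∀ c, Ready n c → Exec c p (P {fun v => c (x v)}) t) (vs : List V) (hvs : vs.Nodup)
    (c : Counter V → ℕ) (hc : Ready n c) (hx : ∀ v ∈ vs, c (x v) = 0)
    (hy : ∀ v ∈ vs, c (y v) = n + 1) :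
    Exec c (p.forAll vs)
      (P {z | (∀ v ∉ vs, z v = c (x v)) ∧ ∀ v ∈ vs, z v ≤ n}) (forAllTime n t vs.length) := by
  induction vs generalizing c with
  | nil =>
    have : {z : V → ℕ | (∀ v ∉ ([] : List V), z v = c (x v)) ∧ ∀ v ∈ ([] : List V), z v ≤ n} =
        {fun v => c (x v)} := by
      ext z
      simp [funext_iff]
    rw [this]
    exact hp c hc
  | cons v vs ih =>
    intro d hd
    obtain ⟨hv, hvs⟩ := List.nodup_cons.mp hvs
    set A : ℕ → Set (V → ℕ) := fun i =>
      {z | (∀ w ∉ v :: vs, z w = c (x w)) ∧ z v < i ∧ ∀ w ∈ vs, z w ≤ n} with hA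
    set C : ℕ → Counter V → ℕ := fun i =>
      Function.update (Function.update c (x v) i) (y v) (n + 1 - i) with hC
    obtain ⟨S, ⟨d', rfl, hd', hP⟩, hr⟩ := Runs.loop_of_invariant (a := y v) (k := n + 1)
      (p := Prog.seq (p.forAll vs) (.act (.inc (x v)))) (t := forAllTime n t vs.length + 1)
      (fun i S => ∃ d', S = ⟨C i, d'⟩ ∧ d'.left = [] ∧ P (A i) d d')
      (by rintro i _ ⟨d', rfl, -⟩; simp [hC]) (by
        rintro i hi _ ⟨d₁, rfl, hd₁, hP₁⟩
        have hready : Ready n ((Act.dec (y v)).run (⟨C i, d₁⟩ : Store Alph N V)).ctr := by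
          refine ⟨?_, ?_, ?_, ?_, fun w => ?_⟩
          · simp [Act.run, hC, hc.tmp]
          · simp [Act.run, hC, hc.acc]
          · simp [Act.run, hC, hc.aux]
          · simp [Act.run, hC, hc.base]
          · by_cases hw : w = v
            · subst hw
              simp [Act.run, hC]
              omega
            · simp [Act.run, hC, hw, hc.x_le]
        have hne : ∀ w ∈ vs, w ≠ v := fun w hw h => hv (h ▸ hw)
        obtain ⟨d₂, hd₂, hP₂, hr₂⟩ := ih hvs _ hready
          (fun w hw => by
            simp [Act.run, hC, hne w hw, hx w (List.mem_cons_of_mem _ hw)])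
          (fun w hw => by
            simp [Act.run, hC, hne w hw, hy w (List.mem_cons_of_mem _ hw)])
          d₁ hd₁
        refine ⟨⟨C (i + 1), d₂⟩, ⟨d₂, rfl, hd₂, ?_⟩,
          (hr₂.seq (Runs.act _ _)).congr rfl (Store.ext (funext fun z => ?_) rfl) le_rfl⟩
        · convert hcomp _ _ _ _ _ hP₁ hP₂ using 1
          ext z
          simp only [hA, Set.mem_ofPred_eq, Set.mem_union, Act.run, hC]
          constructor
          · rintro ⟨h₁, h₂, h₃⟩
            rcases Nat.lt_succ_iff_lt_or_eq.mp h₂ with h₂ | h₂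
            · exact Or.inl ⟨h₁, h₂, h₃⟩
            · refine Or.inr ⟨fun w hw => ?_, h₃⟩
              by_cases hwv : w = v
              · subst hwv
                simpa using h₂
              · simpa [hwv] using h₁ w (by simp [hwv, hw])
          · rintro (⟨h₁, h₂, h₃⟩ | ⟨h₁, h₃⟩)
            · exact ⟨h₁, by omega, h₃⟩
            · refine ⟨fun w hw => ?_, ?_, h₃⟩
              · simp only [List.mem_cons, not_or] at hw
                simpa [hw.1] using h₁ w hw.2
              · have := h₁ v hv
                simp at this
                omega
        · by_cases hz : z = x v
          · subst hz
            simp [Act.run, hC]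
          · by_cases hz' : z = y v
            · subst hz'
              simp [Act.run, hC]
              omega
            · simp [Act.run, hC, hz, hz'])
      (S := ⟨c, d⟩) ⟨d, by
        refine Store.ext (funext fun z => ?_) rfl
        by_cases hz : z = x v
        · subst hz
          simp [hC, hx]
        · by_cases hz' : z = y v
          · subst hz'
            simp [hC, hy]
          · simp [hC, hz, hz'], hd, by
        convert hnil d using 1
        ext z
        simp [hA]⟩
    refine ⟨d', hd', ?_, (hr.seq (Runs.transfer (by simp) _ _)).congr rfl
      (Store.ext (funext fun z => ?_) rfl) ?_⟩
    · convert hP using 1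
      ext z
      simp only [hA, Set.mem_ofPred_eq, List.mem_cons, forall_eq_or_imp, Nat.lt_succ_iff]
    · by_cases hz : z = x v
      · subst hz
        simp [hx]
      · by_cases hz' : z = y v
        · subst hz'
          simp [hC, hy]
        · simp [hC, hz, hz']
    · simp [hC, forAllTime]
      ring_nf
      omega

end Assignments

/-! ### Evaluation of rules on the tape -/

section Evaluation

open Counter

/-- A time bound for a visit to a cell. -/
def visitTime (m n : ℕ) : ℕ :=
  hornerTime n (m + 1) + (n + 2) ^ (m + 1) * 5 + 3

/-- The tape has the same content, up to cells `∅` that are appended within the first `l` cells;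
the input, the output and the mark `changed` are the same. -/
structure SameTape (l : ℕ) (d d' : Data Alph N) : Prop where
  view : d'.view = d.view
  inp : d'.inp = d.inp
  out : d'.out = d.out
  changed : d'.changed = d.changed
  length : d'.right.length ≤ max d.right.length l

namespace SameTape

variable {l : ℕ} {d d₁ d₂ : Data Alph N}

omit [DecidableEq N]

theorem refl (d : Data Alph N) : SameTape l d d :=
  ⟨rfl, rfl, rfl, rfl, le_max_left _ _⟩

theorem trans (h₁ : SameTape l d d₁) (h₂ : SameTape l d₁ d₂) : SameTape l d d₂ :=
  ⟨h₂.view.trans h₁.view, h₂.inp.trans h₁.inp, h₂.out.trans h₁.out,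
    h₂.changed.trans h₁.changed, by have := h₁.length; have := h₂.length; omega⟩

end SameTape

variable {m n : ℕ}

omit [DecidableEq N] [DecidableEq V] in
theorem PosAtom.addr_lt (a : PosAtom N V m) {z : V → ℕ} (hz : ∀ v, z v ≤ n) :
    a.addr (n + 2) z < (n + 2) ^ (m + 1) := by
  simpa [PosAtom.addr] using Term.ofDigits_lt hz (List.ofFn a.args)

theorem Exec.test (a : PosAtom N V m) {c : Counter V → ℕ} (hc : Ready n c) :
    Exec (Alph := Alph) c (Prog.visit (List.ofFn a.args) (.test a.rel))
      (fun d d' => SameTape ((n + 2) ^ (m + 1)) d d' ∧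
        (d'.flag = true ↔ d.flag = true ∧ a.Sat (n + 2) d.view fun v => c (x v)))
      (visitTime m n) := by
  intro d hd
  have hlt := a.addr_lt hc.x_le
  set k := a.addr (n + 2) fun v => c (x v) with hk
  have hrun := Runs.visit (List.ofFn a.args) (.test a.rel) c hc.tmp hc.acc hc.aux hc.base hc.x_le d
    { d with left := ((List.range k).map d.view).reverse
             right := d.right.drop k
             flag := d.flag && decide (a.rel ∈ (d.right.drop k).head?.getD ∅) } hd hk rfl
    fun _ => rfl
  refine ⟨{ d with left := []
                   right := d.spliced k (d.right.drop k)
                   flag := d.flag && decide (a.rel ∈ (d.right.drop k).head?.getD ∅) },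
    rfl, ⟨⟨?_, rfl, rfl, rfl, ?_⟩, ?_⟩, hrun.mono (by simp [visitTime])⟩
  · funext i
    simp only [Data.view]
    rw [Data.getD_spliced]
    split_ifs with h
    · rfl
    · simp only [List.getD_eq_getElem?_getD, List.getElem?_drop]
      congr 2
      omega
  · simp only [Data.spliced, List.length_append, List.length_map, List.length_range,
      List.length_drop]
    omega
  · simp [PosAtom.Sat, ← hk, Data.view]

theorem Exec.put (a : PosAtom N V m) {c : Counter V → ℕ} (hc : Ready n c) :
    Exec (Alph := Alph) c (Prog.visit (List.ofFn a.args) (.put a.rel))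
      (fun d d' => d'.inp = d.inp ∧ d'.out = d.out ∧
        d'.right.length ≤ max d.right.length ((n + 2) ^ (m + 1)) ∧
        (d'.changed = true ↔ d.changed = true ∨ ¬ a.Sat (n + 2) d.view fun v => c (x v)) ∧
        d'.view = Function.update d.view (a.addr (n + 2) fun v => c (x v))
          (insert a.rel (d.view (a.addr (n + 2) fun v => c (x v)))))
      (visitTime m n) := by
  intro d hd
  have hlt := a.addr_lt hc.x_le
  set k := a.addr (n + 2) fun v => c (x v) with hk
  have hrun := Runs.visit (List.ofFn a.args) (.put a.rel) c hc.tmp hc.acc hc.aux hc.base hc.x_le d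
    { d with left := ((List.range k).map d.view).reverse
             right := insert a.rel ((d.right.drop k).head?.getD ∅) :: (d.right.drop k).tail
             changed := d.changed || decide (a.rel ∉ (d.right.drop k).head?.getD ∅) } hd hk rfl
    fun _ => rfl
  refine ⟨{ d with
      left := []
      right := d.spliced k
        (insert a.rel ((d.right.drop k).head?.getD ∅) :: (d.right.drop k).tail)
      changed := d.changed || decide (a.rel ∉ (d.right.drop k).head?.getD ∅) },
    rfl, ⟨rfl, rfl, ?_, ?_, ?_⟩, hrun.mono (by simp [visitTime])⟩
  · simp only [Data.spliced, List.length_append, List.length_map, List.length_range,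
      List.length_cons, List.length_tail, List.length_drop]
    omega
  · simp [PosAtom.Sat, ← hk, Data.view]
  · funext i
    simp only [Data.view]
    rw [Data.getD_spliced]
    split_ifs with h
    · rw [Function.update_of_ne (by omega)]
    · rcases eq_or_lt_of_le (not_lt.mp h) with rfl | h'
      · simp
      · rw [Function.update_of_ne (by omega)]
        obtain ⟨j, rfl⟩ := Nat.exists_eq_add_of_lt h'
        rw [show k + j + 1 - k = j + 1 by omega]
        simp [Data.view, Nat.add_assoc, Nat.add_comm 1]

/-- Clear the flag unless all given atoms hold. -/
def Prog.testAll : List (PosAtom N V m) → Prog Alph N V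
  | [] => .act .nop
  | a :: as => .seq (.visit (List.ofFn a.args) (.test a.rel)) (Prog.testAll as)

theorem Exec.testAll (as : List (PosAtom N V m)) {c : Counter V → ℕ} (hc : Ready n c) :
    Exec (Alph := Alph) c (Prog.testAll as)
      (fun d d' => SameTape ((n + 2) ^ (m + 1)) d d' ∧
        (d'.flag = true ↔ d.flag = true ∧ ∀ a ∈ as, a.Sat (n + 2) d.view fun v => c (x v)))
      (as.length * visitTime m n + 1) := by
  induction as with
  | nil => exact fun d hd => ⟨d, hd, ⟨.refl d, by simp⟩, (Runs.act _ _).mono (by simp)⟩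
  | cons a as ih =>
    intro d hd
    obtain ⟨d₁, hd₁, ⟨hs₁, hf₁⟩, hr₁⟩ := Exec.test a hc d hd
    obtain ⟨d₂, hd₂, ⟨hs₂, hf₂⟩, hr₂⟩ := ih d₁ hd₁
    refine ⟨d₂, hd₂, ⟨hs₁.trans hs₂, ?_⟩, (hr₁.seq hr₂).mono ?_⟩
    · rw [hf₂, hf₁, hs₁.view]
      simp [and_assoc]
    · rw [List.length_cons, Nat.succ_mul]
      omega

/-- Apply a rule under the current assignment. -/
def Prog.fire (ρ : PosRule N V m) : Prog Alph N V :=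
  .seq (.act (.setFlag true)) (.seq (.testAll ρ.body)
    (.ite .flag (.visit (List.ofFn ρ.head.args) (.put ρ.head.rel)) (.act .nop)))

/-- Apply some rules, one after the other. -/
def Prog.fireAll : List (PosRule N V m) → Prog Alph N V
  | [] => .act .nop
  | ρ :: ρs => .seq (.fire ρ) (Prog.fireAll ρs)

/-- A tape is closed under a set of rule instances. -/
def ClosedUnder (B : ℕ) (I : Set ((V → ℕ) × PosRule N V m)) (T : ℕ → Finset N) : Prop :=
  ∀ i ∈ I, (∀ a ∈ i.2.body, a.Sat B T i.1) → i.2.head.Sat B T i.1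

/-- The effect of applying the rule instances in `I`, one after the other. The last three fields
are what matters: if no change is recorded then the tape has not changed and is closed under all
instances; a change is recorded only if there is one; and whatever is closed under the instances
remains an upper bound of the tape. -/
structure Improves (B l : ℕ) (I : Set ((V → ℕ) × PosRule N V m)) (d d' : Data Alph N) : Prop where
  inp : d'.inp = d.inp
  out : d'.out = d.out
  length : d'.right.length ≤ max d.right.length l
  mono : d.view ≤ d'.view
  changed_mono : d.changed = true → d'.changed = true
  stable : d'.changed = false → d'.view = d.view ∧ ClosedUnder B I d.view
  grow : d.changed = false → d'.changed = true → d'.view ≠ d.view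
  sound : ∀ T, d.view ≤ T → ClosedUnder B I T → d'.view ≤ T

namespace Improves

variable {B l : ℕ} {I J : Set ((V → ℕ) × PosRule N V m)} {d d₁ d₂ : Data Alph N}

omit [DecidableEq N] [DecidableEq V]

theorem of_empty (d : Data Alph N) : Improves B l (∅ : Set ((V → ℕ) × PosRule N V m)) d d :=
  ⟨rfl, rfl, le_max_left _ _, le_rfl, id, fun _ => ⟨rfl, fun _ h => h.elim⟩,
    fun h h' => by simp [h] at h', fun _ h _ => h⟩

theorem union (h₁ : Improves B l I d d₁) (h₂ : Improves B l J d₁ d₂) :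
    Improves B l (I ∪ J) d d₂ := by
  refine ⟨h₂.inp.trans h₁.inp, h₂.out.trans h₁.out, ?_, h₁.mono.trans h₂.mono,
    fun h => h₂.changed_mono (h₁.changed_mono h), fun h => ?_, fun h h' => ?_,
    fun T hT hI => ?_⟩
  · have := h₁.length
    have := h₂.length
    omega
  · obtain ⟨hv₂, hc₂⟩ := h₂.stable h
    have h' : d₁.changed = false := by
      by_contra hne
      rw [h₂.changed_mono (by simpa using hne)] at h
      exact absurd h (by simp)
    obtain ⟨hv₁, hc₁⟩ := h₁.stable h'
    rw [hv₁] at hc₂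
    exact ⟨hv₂.trans hv₁, fun i hi => hi.elim (hc₁ i) (hc₂ i)⟩
  · cases h₀ : d₁.changed with
    | false =>
      rw [← (h₁.stable h₀).1]
      exact h₂.grow h₀ h'
    | true =>
      intro he
      exact h₁.grow h h₀ (le_antisymm (he ▸ h₂.mono) h₁.mono)
  · exact h₂.sound T (h₁.sound T hT fun i hi => hI i (Or.inl hi)) fun i hi => hI i (Or.inr hi)

end Improves

/-- If the rule adds a fact, this is recorded in `changed`. If it adds none, then the tape was
closed under this instance of the rule before. -/
theorem Exec.fire (ρ : PosRule N V m) {c : Counter V → ℕ} (hc : Ready n c) :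
    Exec (Alph := Alph) c (Prog.fire ρ)
      (Improves (n + 2) ((n + 2) ^ (m + 1)) {((fun v => c (x v)), ρ)})
      ((ρ.body.length + 1) * visitTime m n + 4) := by
  intro d hd
  obtain ⟨d₁, hd₁, ⟨hs, hf⟩, hr₁⟩ := Exec.testAll ρ.body hc { d with flag := true } hd
  have hv : d₁.view = d.view := hs.view
  have hrs := Runs.act (.setFlag true) (⟨c, d⟩ : Store Alph N V)
  by_cases hbody : ∀ a ∈ ρ.body, a.Sat (n + 2) d.view fun v => c (x v)
  · obtain ⟨d₂, hd₂, ⟨hi, ho, hl, hch, hv₂⟩, hr₂⟩ := Exec.put ρ.head hc d₁ hd₁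
    have hf₁ : d₁.flag = true := hf.mpr ⟨rfl, hbody⟩
    rw [hv] at hv₂ hch
    have hch₁ : d₁.changed = d.changed := hs.changed
    rw [hch₁] at hch
    have hmono : d.view ≤ d₂.view := by
      rw [hv₂]
      intro i
      by_cases h : i = ρ.head.addr (n + 2) fun v => c (x v)
      · subst h
        simp
      · simp [h]
    refine ⟨d₂, hd₂, ⟨hi.trans hs.inp, ho.trans hs.out, ?_, hmono, fun h => hch.mpr (Or.inl h),
      fun h => ?_, fun h h' he => ?_, fun T hT hcl => ?_⟩,
      (hrs.seq (hr₁.seq (Runs.ite_true (c := .flag) hf₁ hr₂))).mono ?_⟩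
    · have : d₁.right.length ≤ max d.right.length ((n + 2) ^ (m + 1)) := hs.length
      omega
    · have hsat : ρ.head.Sat (n + 2) d.view fun v => c (x v) := by
        by_contra hne
        rw [hch.mpr (Or.inr hne)] at h
        exact absurd h (by simp)
      refine ⟨?_, by rintro _ rfl _; exact hsat⟩
      rw [hv₂, Finset.insert_eq_of_mem hsat, Function.update_eq_self]
    · have hne : ¬ ρ.head.Sat (n + 2) d.view fun v => c (x v) := by
        simpa [h] using hch.mp h'
      refine hne ?_
      rw [PosAtom.Sat, ← he, hv₂]
      simp
    · rw [hv₂]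
      have hmem : ρ.head.Sat (n + 2) T fun v => c (x v) :=
        hcl _ rfl fun a ha => hT _ (hbody a ha)
      intro i
      by_cases h : i = ρ.head.addr (n + 2) fun v => c (x v)
      · subst h
        simpa [Finset.insert_subset_iff] using ⟨hmem, hT _⟩
      · simpa [h] using hT i
    · ring_nf
      omega
  · have hf₁ : d₁.flag = false := by
      by_contra hne
      exact hbody (hf.mp (by simpa using hne)).2
    have hch₁ : d₁.changed = d.changed := hs.changed
    refine ⟨d₁, hd₁, ⟨hs.inp, hs.out, hs.length, hv.ge, fun h => hch₁.trans h,
      fun h => ⟨hv, ?_⟩, fun h h' => ?_, fun T hT _ => hv.trans_le hT⟩,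
      (hrs.seq (hr₁.seq (Runs.ite_false (c := .flag) hf₁ (Runs.act _ _)))).mono ?_⟩
    · rintro _ rfl h
      exact absurd h hbody
    · rw [hch₁, h] at h'
      exact absurd h' (by simp)
    · ring_nf
      omega

/-- A time bound for `Prog.fireAll`. -/
def fireAllTime (ρs : List (PosRule N V m)) (n : ℕ) : ℕ :=
  match ρs with
  | [] => 1
  | ρ :: ρs => ((ρ.body.length + 1) * visitTime m n + 4) + fireAllTime ρs n

theorem Exec.fireAll (ρs : List (PosRule N V m)) {c : Counter V → ℕ} (hc : Ready n c) :
    Exec (Alph := Alph) c (Prog.fireAll ρs)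
      (Improves (n + 2) ((n + 2) ^ (m + 1)) ({fun v => c (x v)} ×ˢ {ρ | ρ ∈ ρs}))
      (fireAllTime ρs n) := by
  induction ρs with
  | nil =>
    intro d hd
    refine ⟨d, hd, ?_, Runs.act _ _⟩
    convert Improves.of_empty d using 1
    ext
    simp
  | cons ρ ρs ih =>
    intro d hd
    obtain ⟨d₁, hd₁, h₁, hr₁⟩ := Exec.fire ρ hc d hd
    obtain ⟨d₂, hd₂, h₂, hr₂⟩ := ih d₁ hd₁
    refine ⟨d₂, hd₂, ?_, hr₁.seq hr₂⟩
    convert h₁.union h₂ using 1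
    ext ⟨z, ρ'⟩
    simp only [Set.mem_prod, Set.mem_singleton_iff, Set.mem_ofPred_eq, List.mem_cons,
      Set.mem_union, Prod.mk.injEq]
    tauto

/-- The counters outside of loops over assignments. -/
def startCounters (n : ℕ) : Counter V → ℕ
  | .y _ => n + 1
  | .base => n + 2
  | _ => 0

omit [DecidableEq V] in
theorem ready_startCounters : Ready n (startCounters n : Counter V → ℕ) :=
  ⟨rfl, rfl, rfl, rfl, fun _ => Nat.zero_le _⟩

/-- Apply all rules under all assignments, again and again until nothing changes. -/
def Prog.saturate (ρs : List (PosRule N V m)) (vs : List V) : Prog Alph N V :=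
  .whileDo .changed (.seq (.act (.setChanged false)) ((Prog.fireAll ρs).forAll vs))

/-- A time bound for one round of `Prog.saturate`. -/
def roundTime (ρs : List (PosRule N V m)) (n k : ℕ) : ℕ :=
  1 + forAllTime n (fireAllTime ρs n) k

/-- All instances of the rules on a string of length `n`. -/
def instances (ρs : List (PosRule N V m)) (n : ℕ) : Set ((V → ℕ) × PosRule N V m) :=
  {z | ∀ v, z v ≤ n} ×ˢ {ρ | ρ ∈ ρs}

/-- One round of `Prog.saturate` applies all instances of the rules. -/
theorem Exec.round (ρs : List (PosRule N V m)) (vs : List V) (hvs : vs.Nodup)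
    (hmem : ∀ v, v ∈ vs) :
    Exec (Alph := Alph) (startCounters n)
      (.seq (.act (.setChanged false)) ((Prog.fireAll ρs).forAll vs))
      (fun d d' => Improves (n + 2) ((n + 2) ^ (m + 1)) (instances ρs n)
        { d with changed := false } d') (roundTime ρs n vs.length) := by
  have h := Exec.forAll (Alph := Alph) (p := Prog.fireAll ρs)
    (fun A => Improves (n + 2) ((n + 2) ^ (m + 1)) (A ×ˢ {ρ | ρ ∈ ρs}))
    (fun d => by simpa using Improves.of_empty d)
    (fun A B d d₁ d₂ h₁ h₂ => by simpa [Set.union_prod] using h₁.union h₂)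
    (fun c hc => Exec.fireAll ρs hc) vs hvs (startCounters n) ready_startCounters
    (fun _ _ => rfl) fun _ _ => rfl
  intro d hd
  obtain ⟨d', hd', hi, hr⟩ := h { d with changed := false } hd
  refine ⟨d', hd', ?_, (Runs.act _ _).seq hr⟩
  simpa [instances, hmem] using hi

omit [DecidableEq N] in
theorem Data.view_eq_empty (d : Data Alph N) {i : ℕ} (hi : d.right.length ≤ i) :
    d.view i = ∅ := by
  simp [Data.view, hi]

/-- The fixpoint iteration. Each round but the last one inserts an element into one of the cells,
and there are `(n + 2) ^ (m + 1)` cells with at most `card N` elements; the number `k` of rounds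
that remain is bounded by the number of elements that are still missing. -/
theorem Runs.saturate [Fintype N] (ρs : List (PosRule N V m)) (vs : List V) (hvs : vs.Nodup)
    (hmem : ∀ v, v ∈ vs) (k : ℕ) (d : Data Alph N) (hd : d.left = [])
    (hlen : d.right.length ≤ (n + 2) ^ (m + 1))
    (hk : (n + 2) ^ (m + 1) * Fintype.card N <
      ∑ i ∈ Finset.range ((n + 2) ^ (m + 1)), (d.view i).card + k) :
    ∃ d', d'.left = [] ∧ d'.inp = d.inp ∧ d'.out = d.out ∧ d'.changed = false ∧
      d'.right.length ≤ (n + 2) ^ (m + 1) ∧ d.view ≤ d'.view ∧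
      (d.changed = true → ClosedUnder (n + 2) (instances ρs n) d'.view) ∧
      (∀ T, d.view ≤ T → ClosedUnder (n + 2) (instances ρs n) T → d'.view ≤ T) ∧
      Runs (Prog.saturate ρs vs) ⟨startCounters n, d⟩ ⟨startCounters n, d'⟩
        (k * (roundTime ρs n vs.length + 1) + 1) := by
  induction k generalizing d with
  | zero =>
    exfalso
    -- Without remaining rounds there would be more elements than the cells can hold.
    have : ∑ i ∈ Finset.range ((n + 2) ^ (m + 1)), (d.view i).card ≤
        (n + 2) ^ (m + 1) * Fintype.card N := by
      simpa using Finset.sum_le_card_nsmul (Finset.range ((n + 2) ^ (m + 1)))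
        (fun i => (d.view i).card) (Fintype.card N) fun i _ => Finset.card_le_univ _
    omega
  | succ k ih =>
    cases hch : d.changed with
    | false =>
      exact ⟨d, hd, rfl, rfl, hch, hlen, le_rfl, by simp, fun _ h _ => h,
        (Runs.while_false (c := .changed) (S := ⟨_, d⟩) hch).mono (by simp)⟩
    | true =>
      obtain ⟨d₁, hd₁, h₁, hr₁⟩ := Exec.round (n := n) ρs vs hvs hmem d hd
      have hlen₁ : d₁.right.length ≤ (n + 2) ^ (m + 1) :=
        h₁.length.trans (max_le hlen le_rfl)
      have hmono : d.view ≤ d₁.view := h₁.mono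
      cases hch₁ : d₁.changed with
      | false =>
        obtain ⟨hv, hcl⟩ := h₁.stable hch₁
        refine ⟨d₁, hd₁, h₁.inp, h₁.out, hch₁, hlen₁, hmono, fun _ => ?_, h₁.sound,
          (Runs.while_true (c := .changed) (S := ⟨_, d⟩) hch hr₁
            (Runs.while_false (c := .changed) hch₁)).mono ?_⟩
        · rw [hv]
          exact hcl
        · ring_nf
          omega
      | true =>
        -- The round changed the tape; so the number of elements has grown.
        have hne : d₁.view ≠ d.view := h₁.grow rfl hch₁
        have hlt : ∑ i ∈ Finset.range ((n + 2) ^ (m + 1)), (d.view i).card <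
            ∑ i ∈ Finset.range ((n + 2) ^ (m + 1)), (d₁.view i).card := by
          obtain ⟨i, hi⟩ := Function.ne_iff.mp hne
          refine Finset.sum_lt_sum (fun j _ => Finset.card_le_card (hmono j)) ⟨i, ?_, ?_⟩
          · rw [Finset.mem_range]
            by_contra hge
            rw [d₁.view_eq_empty (by omega), d.view_eq_empty (by omega)] at hi
            exact hi rfl
          · exact Finset.card_lt_card ((hmono i).lt_of_ne (Ne.symm hi))
        obtain ⟨d', hd', hi, ho, hch', hlen', hmono', hcl, hs, hr⟩ :=
          ih d₁ hd₁ hlen₁ (by omega)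
        refine ⟨d', hd', hi.trans h₁.inp, ho.trans h₁.out, hch', hlen', hmono.trans hmono',
          fun _ => hcl hch₁, fun T hT hT' => hs T (h₁.sound T hT hT') hT',
          (Runs.while_true (c := .changed) (S := ⟨_, d⟩) hch hr₁ hr).mono ?_⟩
        rw [Nat.succ_mul k]
        omega

end Evaluation

/-! ### Output of the result -/

section Output

open Counter

variable {m n : ℕ}

/-- Write the value of the variable `v` plus one, in unary. -/
def Prog.emitPosition (v : V) : Prog Alph N V :=
  .seq (.act (.emit .sep)) (.seq ((Prog.act (.emit .one)).repeat (x v)) (.act (.emit .one)))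

theorem Runs.emitPosition (v : V) {c : Counter V → ℕ} (hc : Ready n c) (d : Data Alph N) :
    Runs (Prog.emitPosition v) ⟨c, d⟩
      ⟨c, { d with out := List.replicate (c (x v) + 1) .one ++ .sep :: d.out }⟩ (n * 7 + 4) := by
  have h := Runs.repeat (Alph := Alph) (N := N) (a := x v) (by simp)
    (p := Prog.act (.emit .one)) (t := 1)
    (k := c (x v)) (fun i => ⟨c, { d with out := List.replicate i .one ++ .sep :: d.out }⟩)
    (fun i => rfl) (fun i => hc.tmp) fun i _ u w => Runs.act _ _
  refine ((Runs.act _ _).seq (h.seq (Runs.act _ _))).congr rfl ?_ ?_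
  · simp [Act.run, List.replicate_succ]
  · have := hc.x_le v
    omega

/-- Write a tuple of spans; since the output is a stack, this is done from right to left. -/
def Prog.emitTuple : List (V × V) → Prog Alph N V
  | [] => .act (.emit .mark)
  | e :: es => .seq (Prog.emitTuple es) (.seq (.emitPosition e.2) (.emitPosition e.1))

theorem Runs.emitTuple (es : List (V × V)) {c : Counter V → ℕ} (hc : Ready n c)
    (d : Data Alph N) :
    Runs (Prog.emitTuple es) ⟨c, d⟩
      ⟨c, { d with out := es.flatMap (fun e => encodeSpan ⟨c (x e.1) + 1, c (x e.2) + 1⟩) ++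
        .mark :: d.out }⟩ (es.length * (n * 14 + 8) + 1) := by
  induction es with
  | nil => exact (Runs.act _ _).congr rfl rfl (by simp)
  | cons e es ih =>
    refine (ih.seq ((Runs.emitPosition e.2 hc _).seq (Runs.emitPosition e.1 hc _))).congr rfl
      ?_ ?_
    · simp [encodeSpan]
    · rw [List.length_cons, Nat.succ_mul]
      omega

/-- Write the tuple given by `es` if the atom `goal` holds. -/
def Prog.output (goal : PosAtom N V m) (es : List (V × V)) : Prog Alph N V :=
  .seq (.act (.setFlag true)) (.seq (.visit (List.ofFn goal.args) (.test goal.rel))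
    (.ite .flag (.emitTuple es) (.act .nop)))

/-- The effect of the output of all tuples that belong to the assignments in `A`. -/
structure Outputs {k : ℕ} (B l : ℕ) (goal : PosAtom N V m) (e : Fin k → V × V)
    (A : Set (V → ℕ)) (d d' : Data Alph N) : Prop where
  view : d'.view = d.view
  inp : d'.inp = d.inp
  changed : d'.changed = d.changed
  length : d'.right.length ≤ max d.right.length l
  out : ∃ o : List (Fin k → Span), d'.out = encodeRelation o ++ d.out ∧
    ∀ t, t ∈ o ↔ ∃ z ∈ A, goal.Sat B d.view z ∧ t = fun i => ⟨z (e i).1 + 1, z (e i).2 + 1⟩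

/-- The body of the output loop: the record of the current assignment is written if the goal holds.
-/
theorem Exec.output {k : ℕ} (goal : PosAtom N V m) (e : Fin k → V × V) {c : Counter V → ℕ}
    (hc : Ready n c) :
    Exec (Alph := Alph) c (Prog.output goal (List.ofFn e))
      (Outputs (n + 2) ((n + 2) ^ (m + 1)) goal e {fun v => c (x v)})
      (visitTime m n + k * (n * 14 + 8) + 4) := by
  intro d hd
  have hr₀ := Runs.act (.setFlag true) (⟨c, d⟩ : Store Alph N V)
  obtain ⟨d₁, hd₁, ⟨hs, hf⟩, hr₁⟩ := Exec.test goal hc { d with flag := true } hd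
  have hv : d₁.view = d.view := hs.view
  have ho : d₁.out = d.out := hs.out
  by_cases hsat : goal.Sat (n + 2) d.view fun v => c (x v)
  · have hf₁ : d₁.flag = true := hf.mpr ⟨rfl, hsat⟩
    refine ⟨_, ?_, ?_, (hr₀.seq (hr₁.seq (Runs.ite_true (c := .flag) hf₁
      (Runs.emitTuple _ hc d₁)))).mono ?_⟩
    · exact hd₁
    · refine ⟨hv, hs.inp, hs.changed, hs.length, [fun i => ⟨c (x (e i).1) + 1, c (x (e i).2) + 1⟩],
        ?_, fun t => ?_⟩
      · have hmap : (List.ofFn e).flatMap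
            (fun e => encodeSpan ⟨c (x e.1) + 1, c (x e.2) + 1⟩) =
            (List.ofFn fun i => (⟨c (x (e i).1) + 1, c (x (e i).2) + 1⟩ : Span)).flatMap
              encodeSpan := by
          rw [show (fun i => (⟨c (x (e i).1) + 1, c (x (e i).2) + 1⟩ : Span)) =
            (fun e => ⟨c (x e.1) + 1, c (x e.2) + 1⟩) ∘ e from rfl, ← List.map_ofFn,
            List.flatMap_map]
        simp [encodeRelation, encodeTuple, ho, hmap]
      · simp [hsat]
    · simp only [List.length_ofFn]
      omega
  · have hf₁ : d₁.flag = false := by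
      by_contra hne
      exact hsat (hf.mp (by simpa using hne)).2
    refine ⟨d₁, hd₁, ⟨hv, hs.inp, hs.changed, hs.length, [], ?_, fun t => ?_⟩,
      (hr₀.seq (hr₁.seq (Runs.ite_false (c := .flag) hf₁ (Runs.act _ _)))).mono ?_⟩
    · simp [encodeRelation, ho]
    · simp [hsat]
    · omega

omit [DecidableEq N] [DecidableEq V] in
theorem Outputs.union {k B l : ℕ} {goal : PosAtom N V m} {e : Fin k → V × V}
    {A A' : Set (V → ℕ)} {d d₁ d₂ : Data Alph N} (h₁ : Outputs B l goal e A d d₁)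
    (h₂ : Outputs B l goal e A' d₁ d₂) : Outputs B l goal e (A ∪ A') d d₂ := by
  obtain ⟨o₁, ho₁, hm₁⟩ := h₁.out
  obtain ⟨o₂, ho₂, hm₂⟩ := h₂.out
  refine ⟨h₂.view.trans h₁.view, h₂.inp.trans h₁.inp, h₂.changed.trans h₁.changed, ?_, o₂ ++ o₁,
    ?_, fun t => ?_⟩
  · have := h₁.length
    have := h₂.length
    omega
  · rw [ho₂, ho₁]
    simp [encodeRelation]
  · rw [List.mem_append, hm₁, hm₂, h₁.view]
    simp only [Set.mem_union]
    grind

end Output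

/-! ### Initialization and cleaning up -/

section Setup

open Counter

/-- Copy `base` to the counters `y v`. -/
def Prog.fillCounters : List V → Prog Alph N V
  | [] => .act .nop
  | v :: vs => .seq (Prog.addTo base (y v)) (Prog.fillCounters vs)

theorem Runs.fillCounters (vs : List V) (hvs : vs.Nodup) (c : Counter V → ℕ) (htmp : c tmp = 0)
    (hy : ∀ v ∈ vs, c (y v) = 0) (d : Data Alph N) :
    Runs (Prog.fillCounters vs) ⟨c, d⟩
      ⟨fun z => match z with
        | .y v => if v ∈ vs then c base else c (y v)
        | z => c z, d⟩ (vs.length * (c base * 7 + 2) + 1) := by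
  induction vs generalizing c with
  | nil =>
    refine (Runs.act _ _).congr rfl (Store.ext (funext fun z => ?_) rfl) (by simp)
    cases z <;> simp [Act.run]
  | cons v vs ih =>
    obtain ⟨hv, hvs⟩ := List.nodup_cons.mp hvs
    have h₁ := Runs.addTo (a := base) (b := y v) (by simp) (by simp) (by simp) c htmp d
    have h₂ := ih hvs (Function.update c (y v) (c (y v) + c base)) (by simp [htmp])
      fun w hw => by
        have : w ≠ v := fun h => hv (h ▸ hw)
        simp [this, hy w (List.mem_cons_of_mem _ hw)]
    refine (h₁.seq h₂).congr rfl (Store.ext (funext fun z => ?_) rfl) ?_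
    · cases z with
      | y w =>
        by_cases hw : w = v
        · subst hw
          simp [hv, hy w]
        · simp [hw]
      | _ => simp
    · simp only [ne_eq, reduceCtorEq, not_false_eq_true, Function.update_of_ne, List.length_cons,
        Nat.succ_mul]
      omega

/-- Set a counter to zero. -/
def Prog.clear (a : Counter V) : Prog Alph N V :=
  (Prog.act .nop).loop a

theorem Runs.clear (a : Counter V) (c : Counter V → ℕ) (d : Data Alph N) :
    Runs (Prog.clear a) ⟨c, d⟩ ⟨Function.update c a 0, d⟩ (c a * 3 + 1) := by
  have := Runs.loop (a := a) (p := Prog.act .nop) (t := 1) (k := c a)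
    (fun i => ⟨Function.update c a (c a - i), d⟩) (fun i => by simp) fun i hi => by
      refine (Runs.act _ _).congr rfl (Store.ext ?_ rfl) le_rfl
      simp [Act.run, Nat.sub_sub]
  exact this.congr (by simp) (by simp) le_rfl

/-- Set the counters `y v` to zero. -/
def Prog.clearCounters : List V → Prog Alph N V
  | [] => .act .nop
  | v :: vs => .seq (Prog.clear (y v)) (Prog.clearCounters vs)

theorem Runs.clearCounters (vs : List V) (c : Counter V → ℕ) {n : ℕ} (hy : ∀ v, c (y v) ≤ n)
    (d : Data Alph N) :
    Runs (Prog.clearCounters vs) ⟨c, d⟩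
      ⟨fun z => match z with
        | .y v => if v ∈ vs then 0 else c (y v)
        | z => c z, d⟩ (vs.length * (n * 3 + 1) + 1) := by
  induction vs generalizing c with
  | nil =>
    refine (Runs.act _ _).congr rfl (Store.ext (funext fun z => ?_) rfl) (by simp)
    cases z <;> simp [Act.run]
  | cons v vs ih =>
    have h₁ := Runs.clear (y v) c d
    have h₂ := ih (Function.update c (y v) 0) fun w => by
      by_cases hw : w = v
      · simp [hw]
      · simp [hw, hy]
    refine (h₁.seq h₂).congr rfl (Store.ext (funext fun z => ?_) rfl) ?_
    · cases z with
      | y w =>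
        by_cases hw : w = v
        · subst hw
          simp
        · simp [hw]
      | _ => simp
    · have := hy v
      simp only [List.length_cons, Nat.succ_mul]
      omega

theorem Runs.readAll (g : Option Alph → Finset N) (c : Counter V → ℕ) (d : Data Alph N) :
    Runs (.whileDo .inp (.seq (.act (.readInp g)) (.act (.inc base)))) ⟨c, d⟩
      ⟨Function.update c base (c base + d.inp.length),
        { d with inp := [], left := (d.inp.map fun a => g (some a)).reverse ++ d.left }⟩
      (d.inp.length * 3 + 1) := by
  obtain ⟨inp, out, left, right, flag, changed⟩ := d
  induction inp generalizing c left with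
  | nil => exact (Runs.while_false rfl).congr rfl (by simp) le_rfl
  | cons a w ih =>
    refine (Runs.while_true rfl ((Runs.act _ _).seq (Runs.act _ _)) (ih _ _)).congr rfl
      (Store.ext ?_ ?_) ?_
    · simp only [Act.run, Function.update_self, Function.update_idem, List.length_cons]
      congr 1
      omega
    · simp
    · simp only [List.length_cons]
      omega

/-- Write the symbols of the input to the tape, and set the counters. -/
def Prog.setup (g : Option Alph → Finset N) (vs : List V) : Prog Alph N V :=
  .seq (.whileDo .inp (.seq (.act (.readInp g)) (.act (.inc base))))
    (.seq (.act (.readInp g)) (.seq (.whileDo .left (.act .moveL))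
      (.seq (.act (.inc base)) (.seq (.fillCounters vs)
        (.seq (.act (.inc base)) (.act (.setChanged true)))))))

/-- The tape after reading the input `s`. -/
def startTape (g : Option Alph → Finset N) (s : List Alph) : List (Finset N) :=
  (s.map fun a => g (some a)) ++ [g none]

omit [DecidableEq N] in
theorem getD_startTape (g : Option Alph → Finset N) (s : List Alph) (i : ℕ) :
    (startTape g s).getD i ∅ = if i ≤ s.length then g s[i]? else ∅ := by
  unfold startTape
  split_ifs with h
  · rcases h.lt_or_eq with h | rfl
    · simp [List.getElem?_append, h]
    · simp
  · simp only [List.getD_eq_getElem?_getD]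
    rw [List.getElem?_eq_none (by simp; omega)]
    rfl

/-- The input becomes the initial tape, and the counters get their values outside of loops. -/
theorem Runs.setup (g : Option Alph → Finset N) (vs : List V) (hvs : vs.Nodup)
    (hmem : ∀ v, v ∈ vs) (s : List Alph) :
    Runs (Prog.setup g vs) (Store.init s)
      ⟨startCounters s.length, ⟨[], [], [], startTape g s, false, true⟩⟩
      (s.length * 5 + vs.length * (s.length * 7 + 9) + 9) := by
  have h₁ := Runs.readAll (V := V) g (fun _ => 0) (⟨s, [], [], [], false, false⟩ : Data Alph N)
  have h₂ := (Runs.rewind (V := V) (Function.update (fun _ => 0) base s.length)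
    (⟨[], [], g none :: (s.map fun a => g (some a)).reverse, [], false, false⟩ :
      Data Alph N)).congr (t' := s.length * 2 + 3) rfl
      (T' := ⟨Function.update (fun _ => 0) base s.length,
        ⟨[], [], [], startTape g s, false, false⟩⟩) (by simp [startTape]) (by simp; omega)
  have h₃ := Runs.fillCounters (Alph := Alph) (N := N) vs hvs
    (Function.update (fun _ => 0) base (s.length + 1)) (by simp) (by simp)
    ⟨[], [], [], startTape g s, false, false⟩
  refine (h₁.seq ((Runs.act _ _).seq ((h₂.congr ?_ rfl le_rfl).seq
    ((Runs.act _ _).seq ((h₃.congr ?_ rfl le_rfl).seq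
      ((Runs.act _ _).seq (Runs.act _ _))))))).congr rfl ?_ ?_
  · simp [Act.run]
  · simp [Act.run]
  · refine Store.ext (funext fun z => ?_) rfl
    cases z <;> simp [Act.run, startCounters, hmem]
  · simp
    ring_nf
    omega

/-- Empty the tape and all counters. -/
def Prog.cleanUp (vs : List V) : Prog Alph N V :=
  .seq (.whileDo .right (.act .dropR)) (.seq (.clear base) (.seq (.clearCounters vs)
    (.act (.setFlag false))))

theorem Runs.dropAll (c : Counter V → ℕ) (d : Data Alph N) :
    Runs (.whileDo .right (.act .dropR)) ⟨c, d⟩ ⟨c, { d with right := [] }⟩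
      (d.right.length * 2 + 1) := by
  obtain ⟨inp, out, left, right, flag, changed⟩ := d
  induction right with
  | nil => exact Runs.while_false rfl
  | cons b right ih =>
    refine (Runs.while_true rfl (Runs.act _ _) ih).mono ?_
    simp only [List.length_cons]
    omega

/-- A Turing machine has to stop with empty stacks, except for the output. -/
theorem Runs.cleanUp (vs : List V) (hmem : ∀ v, v ∈ vs) (n : ℕ) (d : Data Alph N)
    (hleft : d.left = []) (hinp : d.inp = []) (hch : d.changed = false) :
    Runs (Prog.cleanUp vs) ⟨startCounters n, d⟩ (Store.final d.out)
      (d.right.length * 2 + vs.length * (n * 3 + 4) + n * 3 + 10) := by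
  have h₁ := Runs.dropAll (V := V) (startCounters n) d
  have h₂ := Runs.clear (Alph := Alph) (N := N) base (startCounters n : Counter V → ℕ)
    { d with right := [] }
  have h₃ := Runs.clearCounters (Alph := Alph) (N := N) vs
    (Function.update (startCounters n : Counter V → ℕ) base 0) (n := n + 1)
    (fun v => by simp [startCounters]) { d with right := [] }
  refine (h₁.seq (h₂.seq (h₃.seq (Runs.act _ _)))).congr rfl (Store.ext (funext fun z => ?_) ?_) ?_
  · cases z <;> simp [Act.run, startCounters, hmem, Store.final]
  · simp [Act.run, Store.final, hleft, hinp, hch]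
  · simp [startCounters]
    ring_nf
    omega

end Setup

/-! ### Rules over string positions are evaluated in polynomial time -/

theorem polyBounded_hornerTime (k : ℕ) : PolyBounded fun n => hornerTime n k := by
  induction k with
  | zero => exact .const 1
  | succ k ih =>
    exact ih.add (((((PolyBounded.id.add (.const 2)).pow k).mul
      (((PolyBounded.id.add (.const 2)).mul (.const 10)).add (.const 4))).add (.const 2)).add
      ((PolyBounded.id.mul (.const 7)).add (.const 3)))

theorem polyBounded_visitTime (m : ℕ) : PolyBounded (visitTime m) :=
  ((polyBounded_hornerTime (m + 1)).add
    (((PolyBounded.id.add (.const 2)).pow (m + 1)).mul (.const 5))).add (.const 3)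

omit [DecidableEq N] [DecidableEq V] in
theorem polyBounded_fireAllTime {m : ℕ} (ρs : List (PosRule N V m)) :
    PolyBounded (fireAllTime ρs) := by
  induction ρs with
  | nil => exact .const 1
  | cons ρ ρs ih =>
    exact (((PolyBounded.const (ρ.body.length + 1)).mul (polyBounded_visitTime m)).add
      (.const 4)).add ih

theorem polyBounded_forAllTime {t : ℕ → ℕ} (ht : PolyBounded t) (k : ℕ) :
    PolyBounded fun n => forAllTime n (t n) k := by
  induction k with
  | zero => exact ht
  | succ k ih =>
    exact ((PolyBounded.id.add (.const 1)).mul (ih.add (.const 6))).add (.const 2)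

omit [DecidableEq N] [DecidableEq V] in
/-- Distinct argument tuples have distinct addresses. -/
theorem PosAtom.addr_eq_iff {m n : ℕ} (a : PosAtom N V m) {z : V → ℕ} (hz : ∀ v, z v ≤ n)
    {t : Fin (m + 1) → ℕ} (ht : ∀ i, t i < n + 2) :
    Nat.ofDigits (n + 2) (List.ofFn t) = a.addr (n + 2) z ↔ t = fun i => (a.args i).eval z := by
  unfold PosAtom.addr
  rw [List.map_ofFn]
  refine ⟨fun h => List.ofFn_injective (Nat.ofDigits_inj_of_len_eq (by omega) (by simp) ?_ ?_ h),
    fun h => by rw [h]; rfl⟩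
  · rw [List.forall_mem_ofFn_iff]
    exact ht
  · rw [List.forall_mem_ofFn_iff]
    exact fun i => Term.eval_lt hz (a.args i)

omit [DecidableEq N] [DecidableEq V] in
/-- The least tape that contains the initial facts and is closed under all rule instances holds
exactly the derivable facts. -/
theorem sat_iff_fact {m : ℕ} (sy : Option Alph → N) (ρs : List (PosRule N V m)) (s : List Alph)
    {T : ℕ → Finset N} (hT : ClosedUnder (s.length + 2) (instances ρs s.length) T)
    (hinit : ∀ i ≤ s.length, sy s[i]? ∈ T i)
    (hmin : ∀ T', (∀ i ≤ s.length, sy s[i]? ∈ T' i) →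
      ClosedUnder (s.length + 2) (instances ρs s.length) T' → T ≤ T')
    (hfin : Finite N) (a : PosAtom N V m) {z : V → ℕ} (hz : ∀ v, z v ≤ s.length) :
    a.Sat (s.length + 2) T z ↔ Fact sy ρs s a.rel fun i => (a.args i).eval z := by
  classical
  have := Fintype.ofFinite N
  constructor
  -- By minimality, it suffices that the tape of all derivable facts is closed.
  · set T' : ℕ → Finset N := fun j => Finset.univ.filter fun r => ∃ t : Fin (m + 1) → ℕ,
      (∀ i, t i < s.length + 2) ∧ Nat.ofDigits (s.length + 2) (List.ofFn t) = j ∧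
        Fact sy ρs s r t with hT'
    have hmem : ∀ (b : PosAtom N V m) {y : V → ℕ}, (∀ v, y v ≤ s.length) →
        (b.Sat (s.length + 2) T' y ↔ Fact sy ρs s b.rel fun i => (b.args i).eval y) := by
      intro b y hy
      simp only [PosAtom.Sat, hT', Finset.mem_filter, Finset.mem_univ, true_and]
      constructor
      · rintro ⟨t, ht, he, hf⟩
        rwa [(b.addr_eq_iff hy ht).mp he] at hf
      · exact fun hf => ⟨_, fun i => Term.eval_lt hy _,
          (b.addr_eq_iff hy fun i => Term.eval_lt hy _).mpr rfl, hf⟩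
    intro h
    refine (hmem a hz).mp (hmin T' (fun i hi => ?_) ?_ _ h)
    · simp only [hT', Finset.mem_filter, Finset.mem_univ, true_and]
      refine ⟨Fin.cons i fun _ => 0, fun j => ?_, ?_, .symbol i hi⟩
      · refine Fin.cases ?_ (fun j => ?_) j
        · simp only [Fin.cons_zero]
          omega
        · simp
      · rw [List.ofFn_cons, List.ofFn_const, Nat.ofDigits_cons]
        simp [Nat.ofDigits_replicate_zero]
    · rintro ⟨y, ρ⟩ ⟨hy, hρ⟩ hb
      exact (hmem ρ.head hy).mpr (.rule ρ hρ y hy fun b hb' => (hmem b hy).mp (hb b hb'))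
  · have key : ∀ r t, Fact sy ρs s r t →
        r ∈ T (Nat.ofDigits (s.length + 2) (List.ofFn t)) := by
      intro r t h
      induction h with
      | symbol i hi =>
        rw [List.ofFn_cons, List.ofFn_const, Nat.ofDigits_cons]
        simpa [Nat.ofDigits_replicate_zero] using hinit i hi
      | rule ρ hρ y hy _ ih =>
        have := hT (y, ρ) ⟨hy, hρ⟩ fun b hb => by
          have := ih b hb
          rwa [(b.addr_eq_iff hy fun i => Term.eval_lt hy _).mpr rfl] at this
        rwa [PosAtom.Sat, ← (ρ.head.addr_eq_iff hy fun i => Term.eval_lt hy _).mpr rfl] at this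
    intro h
    have := key _ _ h
    rwa [(a.addr_eq_iff hz fun i => Term.eval_lt hz _).mpr rfl] at this

/-- The relation that is defined by rules over string positions is computable in polynomial
time. -/
theorem exists_computable_of_rules [Fintype Alph] [Fintype N] [Fintype V] {m : ℕ}
    (sy : Option Alph → N) (ρs : List (PosRule N V m)) (goal : PosAtom N V m) {k : ℕ}
    (e : Fin k → V × V) :
    ∃ f : List Alph → List (Fin k → Span),
      Nonempty (TM2ComputableInPolyTime (id : List Alph → List Alph) encodeRelation f) ∧
      ∀ s t, t ∈ f s ↔ ∃ z : V → ℕ, (∀ v, z v ≤ s.length) ∧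
        (Fact sy ρs s goal.rel fun i => (goal.args i).eval z) ∧
        t = fun i => ⟨z (e i).1 + 1, z (e i).2 + 1⟩ := by
  classical
  set vs : List V := Finset.univ.toList with hvs
  have hnodup : vs.Nodup := Finset.nodup_toList _
  have hmem : ∀ v, v ∈ vs := by simp [hvs]
  set g : Option Alph → Finset N := fun o => {sy o} with hg
  set p : Prog Alph N V := .seq (.setup g vs) (.seq (.saturate ρs vs)
    (.seq ((Prog.output goal (List.ofFn e)).forAll vs) (.cleanUp vs))) with hp
  -- A bound for the number of rounds of the fixpoint iteration.
  set M : ℕ → ℕ := fun n => (n + 2) ^ (m + 1) * Fintype.card N + 1 with hM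
  -- The time for the initialization, the fixpoint iteration, the output and the cleaning up.
  set T : ℕ → ℕ := fun n => (n * 5 + vs.length * (n * 7 + 9) + 9) +
    ((M n * (roundTime ρs n vs.length + 1) + 1) +
    (forAllTime n (visitTime m n + k * (n * 14 + 8) + 4) vs.length +
    ((n + 2) ^ (m + 1) * 2 + vs.length * (n * 3 + 4) + n * 3 + 10))) with hTdef
  have hlin : ∀ a b, PolyBounded fun n => n * a + b := fun a b =>
    (PolyBounded.id.mul (.const a)).add (.const b)
  have hpow : PolyBounded fun n => (n + 2) ^ (m + 1) := (PolyBounded.id.add (.const 2)).pow _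
  have hT : PolyBounded T := by
    refine (((PolyBounded.id.mul (.const 5)).add ((PolyBounded.const vs.length).mul
      (hlin 7 9))).add (.const 9)).add (.add ?_ (.add ?_ ?_))
    · exact ((((hpow.mul (.const _)).add (.const 1)).mul
        (((PolyBounded.const 1).add (polyBounded_forAllTime (polyBounded_fireAllTime ρs)
          vs.length)).add (.const 1))).add (.const 1))
    · exact polyBounded_forAllTime (((polyBounded_visitTime m).add
        ((PolyBounded.const k).mul (hlin 14 8))).add (.const 4)) vs.length
    · exact (((hpow.mul (.const 2)).add ((PolyBounded.const vs.length).mul (hlin 3 4))).add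
        (PolyBounded.id.mul (.const 3))).add (.const 10)
  have key : ∀ s : List Alph, ∃ o : List (Fin k → Span),
      Runs p (Store.init s) (Store.final (encodeRelation o)) (T s.length) ∧
      ∀ t, t ∈ o ↔ ∃ z : V → ℕ, (∀ v, z v ≤ s.length) ∧
        (Fact sy ρs s goal.rel fun i => (goal.args i).eval z) ∧
        t = fun i => ⟨z (e i).1 + 1, z (e i).2 + 1⟩ := by
    intro s
    set n := s.length with hn
    have hr₁ := Runs.setup (V := V) g vs hnodup hmem s
    rw [← hn] at hr₁
    set d₀ : Data Alph N := ⟨[], [], [], startTape g s, false, true⟩ with hd₀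
    have hlen₀ : d₀.right.length ≤ (n + 2) ^ (m + 1) := by
      have : n + 2 ≤ (n + 2) ^ (m + 1) := Nat.le_self_pow (by omega) _
      simp only [hd₀, startTape, List.length_append, List.length_map, List.length_singleton]
      omega
    obtain ⟨d₁, hd₁, hi₁, ho₁, hc₁, hl₁, hm₁, hcl₁, hs₁, hr₂⟩ :=
      Runs.saturate (n := n) ρs vs hnodup hmem (M n) d₀ rfl hlen₀ (by simp only [hM]; omega)
    have hview₀ : ∀ i, d₀.view i = if i ≤ n then {sy s[i]?} else ∅ := getD_startTape g s
    obtain ⟨d₂, hd₂, hout, hr₃⟩ := Exec.forAll (Alph := Alph)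
      (Outputs (n + 2) ((n + 2) ^ (m + 1)) goal e)
      (fun d => ⟨rfl, rfl, rfl, le_max_left _ _, [], by simp [encodeRelation], by simp⟩)
      (fun A B d d₁ d₂ h₁ h₂ => h₁.union h₂) (fun c hc => Exec.output goal e hc) vs hnodup
      (startCounters n) ready_startCounters (fun _ _ => rfl) (fun _ _ => rfl) d₁ hd₁
    obtain ⟨o, ho, hmo⟩ := hout.out
    have hr₄ := Runs.cleanUp vs hmem n d₂ hd₂ (hout.inp.trans hi₁) (hout.changed.trans hc₁)
    have hl₂ := hout.length
    refine ⟨o, ?_, fun t => ?_⟩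
    · have : d₂.out = encodeRelation o := by
        rw [ho, ho₁]
        simp [hd₀]
      rw [← this]
      refine (hr₁.seq (hr₂.seq (hr₃.seq hr₄))).mono ?_
      simp only [hTdef]
      omega
    · rw [hmo]
      have hfact : ∀ z : V → ℕ, (∀ v, z v ≤ n) → (goal.Sat (n + 2) d₁.view z ↔
          Fact sy ρs s goal.rel fun i => (goal.args i).eval z) := fun z hz => by
        refine sat_iff_fact sy ρs s (hcl₁ rfl) (fun i hi => ?_) (fun T' hT' hcl => ?_)
          inferInstance goal hz
        · refine hm₁ i ?_
          rw [hview₀, if_pos hi]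
          exact Finset.mem_singleton_self _
        · refine hs₁ T' (fun i => ?_) hcl
          rw [hview₀]
          split_ifs with h
          · simpa using hT' i h
          · simp
      constructor
      · rintro ⟨z, ⟨-, hz⟩, hsat, rfl⟩
        exact ⟨z, fun v => hz v (hmem v), (hfact z fun v => hz v (hmem v)).mp hsat, rfl⟩
      · rintro ⟨z, hz, hf, rfl⟩
        exact ⟨z, ⟨fun v hv => absurd (hmem v) hv, fun v _ => hz v⟩, (hfact z hz).mpr hf, rfl⟩
  choose f hf hmf using key
  exact ⟨f, Prog.computableInPolyTime p encodeRelation f hT hf, hmf⟩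

end Programs

/-! ### Programs as rules over string positions -/

section Translation

variable {Alph : Type} {Var : Type u} {I : Signature} {w A K : ℕ}

/-- The arguments of a fact, apart from the first one, which is used for the symbols of the string
only: both ends of the spans of all variables, both ends of the part of the string that is
parsed, and the argument tuple of a relation of the program. -/
abbrev Coord (w A : ℕ) : Type := (Fin w × Bool) ⊕ Bool ⊕ (Fin A × Bool)

/-- The variables of rules over positions: both ends of the spans of all variables of the program,
and three further positions. -/
abbrev PosVar (w : ℕ) : Type := (Fin w × Bool) ⊕ Fin 3

/-- The relation symbols of rules over positions: those of the program, the symbols of the string,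
and one for each of `K` regular expressions. -/
abbrev PosRel (Alph : Type) (I : Signature) (K : ℕ) : Type := I.Rel ⊕ Option Alph ⊕ Fin K

/-- A tuple with given coordinates. -/
noncomputable def tuple {α : Type} (a : α) (g : Coord w A → α) :
    Fin (Fintype.card (Coord w A) + 1) → α :=
  Fin.cons a fun i => g ((Fintype.equivFin (Coord w A)).symm i)

/-- A coordinate of a tuple. -/
noncomputable def coordAt {α : Type} (t : Fin (Fintype.card (Coord w A) + 1) → α)
    (c : Coord w A) : α :=
  t (Fintype.equivFin (Coord w A) c).succ

@[simp]
theorem coordAt_tuple {α : Type} (a : α) (g : Coord w A → α) (c : Coord w A) :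
    coordAt (tuple a g) c = g c := by
  simp [coordAt, tuple]

theorem eval_tuple (a : Term (PosVar w)) (g : Coord w A → Term (PosVar w)) (x : PosVar w → ℕ) :
    (fun i => (tuple a g i).eval x) = tuple (a.eval x) fun c => (g c).eval x := by
  funext i
  refine Fin.cases ?_ (fun i => ?_) i <;> simp [tuple]

/-- `start` or `finish`. -/
def Span.bound (σ : Span) (b : Bool) : ℕ :=
  if b then σ.finish else σ.start

/-- The coordinates of a parse fact. -/
def parseCoord {α : Type} (z : α) (r : Fin w × Bool → α) (i j : α) : Coord w A → α
  | .inl p => r p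
  | .inr (.inl b) => if b then j else i
  | .inr (.inr _) => z

/-- The coordinates of a fact for a relation of the program. -/
def idbCoord {α : Type} (z : α) {k : ℕ} (t : Fin k → Bool → α) : Coord w A → α
  | .inr (.inr (i, b)) => if h : (i : ℕ) < k then t ⟨i, h⟩ b else z
  | _ => z

theorem eval_parseCoord (r : Fin w × Bool → Term (PosVar w)) (i j : Term (PosVar w))
    (x : PosVar w → ℕ) :
    (fun c => (parseCoord (A := A) .zero r i j c).eval x) =
      parseCoord 0 (fun p => (r p).eval x) (i.eval x) (j.eval x) := by
  funext c
  rcases c with c | c | c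
  · rfl
  · cases c <;> rfl
  · rfl

theorem eval_idbCoord {k : ℕ} (t : Fin k → Bool → Term (PosVar w)) (x : PosVar w → ℕ) :
    (fun c => (idbCoord (w := w) (A := A) .zero t c).eval x) =
      idbCoord 0 fun i b => (t i b).eval x := by
  funext c
  rcases c with c | c | ⟨i, b⟩
  · rfl
  · rfl
  · by_cases h : (i : ℕ) < k <;> simp [idbCoord, h, Term.eval]

/-- The symbol at a position. -/
noncomputable def symbolAtom (o : Option Alph) (t : Term (PosVar w)) :
    PosAtom (PosRel Alph I K) (PosVar w) (Fintype.card (Coord w A)) :=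
  ⟨.inr (.inl o), tuple t fun _ => .zero⟩

/-- The expression with the number `c` matches the string between two positions. -/
noncomputable def parseAtom (c : Fin K) (i j : Term (PosVar w)) :
    PosAtom (PosRel Alph I K) (PosVar w) (Fintype.card (Coord w A)) :=
  ⟨.inr (.inr c), tuple .zero (parseCoord .zero (fun p => .var (.inl p)) i j)⟩

/-- An atom of the program; `idx` numbers its variables. -/
noncomputable def idbAtom (idx : Var → Fin w) (a : Atom I Var) :
    PosAtom (PosRel Alph I K) (PosVar w) (Fintype.card (Coord w A)) :=
  ⟨.inl a.symb, tuple .zero (idbCoord .zero fun i b => .var (.inl (idx (a.args i), b)))⟩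

open Classical in
/-- The rules that describe how the expression with the number `c` is parsed. -/
noncomputable def parseRules (I : Signature) (A : ℕ) (idx : Var → Fin w)
    (e : Fin K → VRegex Alph Var) (c : Fin K) :
    List (PosRule (PosRel Alph I K) (PosVar w) (Fintype.card (Coord w A))) :=
  match e c with
  | .empty => []
  | .eps => [⟨parseAtom c (.var (.inr 0)) (.var (.inr 0)), []⟩]
  | .symbol a => [⟨parseAtom c (.var (.inr 0)) (.succ (.inr 0)),
      [symbolAtom (some a) (.var (.inr 0))]⟩]
  | .or γ₁ γ₂ => (List.finRange K).flatMap fun b => if e b = γ₁ ∨ e b = γ₂ then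
      [⟨parseAtom c (.var (.inr 0)) (.var (.inr 1)),
        [parseAtom b (.var (.inr 0)) (.var (.inr 1))]⟩] else []
  | .cat γ₁ γ₂ => (List.finRange K).flatMap fun b => (List.finRange K).flatMap fun b' =>
      if e b = γ₁ ∧ e b' = γ₂ then
        [⟨parseAtom c (.var (.inr 0)) (.var (.inr 1)),
          [parseAtom b (.var (.inr 0)) (.var (.inr 2)),
            parseAtom b' (.var (.inr 2)) (.var (.inr 1))]⟩] else []
  | .star γ => ⟨parseAtom c (.var (.inr 0)) (.var (.inr 0)), []⟩ ::
      (List.finRange K).flatMap fun b => if e b = γ then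
        [⟨parseAtom c (.var (.inr 0)) (.var (.inr 1)),
          [parseAtom b (.var (.inr 0)) (.var (.inr 2)),
            parseAtom c (.var (.inr 2)) (.var (.inr 1))]⟩] else []
  | .capture x γ => (List.finRange K).flatMap fun b => if e b = γ then
      [⟨parseAtom c (.var (.inl (idx x, false))) (.var (.inl (idx x, true))),
        [parseAtom b (.var (.inl (idx x, false))) (.var (.inl (idx x, true)))]⟩] else []

/-- There is a parse tree whose captured spans are those of the record `r`. -/
def Match (s : List Alph) (idx : Var → Fin w) (r : Fin w → Span) (γ : VRegex Alph Var)
    (i j : ℕ) : Prop :=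
  ∃ c, γ.Parse s i j c ∧ ∀ p ∈ c, p.2 = r (idx p.1)

/-- What a fact over positions says about the string and about a database. -/
def Meaning (s : List Alph) (hA : ∀ R, I.arity R ≤ A) (D : Database I) (idx : Var → Fin w)
    (e : Fin K → VRegex Alph Var) (r : PosRel Alph I K)
    (t : Fin (Fintype.card (Coord w A) + 1) → ℕ) : Prop :=
  match r with
  | .inl R => (fun i : Fin (I.arity R) =>
      (⟨coordAt t (.inr (.inr (i.castLE (hA R), false))) + 1,
        coordAt t (.inr (.inr (i.castLE (hA R), true))) + 1⟩ : Span)) ∈ D R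
  | .inr (.inl o) => s[t 0]? = o
  | .inr (.inr c) => Match s idx
      (fun a => ⟨coordAt t (.inl (a, false)) + 1, coordAt t (.inl (a, true)) + 1⟩) (e c)
      (coordAt t (.inr (.inl false)) + 1) (coordAt t (.inr (.inl true)) + 1)

variable [DecidableEq Var]

open Classical in
/-- The translation of a conjunct in the body of a rule. A regex formula has to match the string
between position zero and the position at which no symbol follows. -/
noncomputable def bodyAtoms (A : ℕ) (idx : Var → Fin w) (e : Fin K → VRegex Alph Var) :
    BodyAtom Alph Var I → List (PosAtom (PosRel Alph I K) (PosVar w) (Fintype.card (Coord w A)))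
  | .idb a => [idbAtom idx a]
  | .regex γ => symbolAtom none (.var (.inr 0)) ::
      ((List.finRange K).filter fun c => e c = γ.1).map fun c =>
        parseAtom c .zero (.var (.inr 0))

/-- The translation of a rule. -/
noncomputable def posRule (A : ℕ) (idx : Var → Fin w) (e : Fin K → VRegex Alph Var)
    (ρ : Rule Alph Var I) :
    PosRule (PosRel Alph I K) (PosVar w) (Fintype.card (Coord w A)) :=
  ⟨idbAtom idx ρ.head, ρ.body.flatMap (bodyAtoms A idx e)⟩

/-- The translation of a program. -/
noncomputable def posRules (Q : Program Alph Var) (A : ℕ) (idx : Var → Fin w)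
    (e : Fin K → VRegex Alph Var) :
    List (PosRule (PosRel Alph Q.I K) (PosVar w) (Fintype.card (Coord w A))) :=
  Q.rules_finite.toFinset.toList.map (posRule A idx e) ++
    (List.finRange K).flatMap (parseRules Q.I A idx e)

/-- For functional expressions, `Match` says that a record is extracted. -/
theorem mem_rel_of_match {s : List Alph} {idx : Var → Fin w} {r : Fin w → Span}
    {γ : VRegex Alph Var} (hγ : γ.Functional) (h : Match s idx r γ 1 (s.length + 1)) :
    (fun x : γ.vars => r (idx x)) ∈ γ.rel s := by
  obtain ⟨c, hc, hr⟩ := h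
  refine ⟨c, hc, fun x => ?_⟩
  have hx := hγ s c hc x x.2
  have hmem : (x : Var) ∈ c.map Prod.fst := List.count_pos_iff.mp (by omega)
  obtain ⟨⟨y, σ⟩, hy, hyx⟩ := List.mem_map.mp hmem
  simp only at hyx
  subst hyx
  have := hr _ hy
  simp only at this
  simpa only [← this] using hy

/-- In a functional expression each variable is captured once; so all captured spans are those of
the record. -/
theorem match_of_mem_rel {s : List Alph} {γ : VRegex Alph Var} (hγ : γ.Functional)
    {r : γ.vars → Span} (h : r ∈ γ.rel s) :
    ∃ c, γ.Parse s 1 (s.length + 1) c ∧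
      ∀ p ∈ c, ∀ hp : p.1 ∈ γ.vars, p.2 = r ⟨p.1, hp⟩ := by
  obtain ⟨c, hc, hr⟩ := h
  refine ⟨c, hc, fun p hp hx => ?_⟩
  have h₁ := hγ s c hc p.1 hx
  have h₂ := hr ⟨p.1, hx⟩
  by_contra hne
  have hsub : [p, (p.1, r ⟨p.1, hx⟩)].Subperm c := by
    refine List.subperm_of_subset ?_ ?_
    · simp only [List.nodup_cons, List.mem_singleton, List.not_mem_nil, not_false_eq_true,
        List.nodup_nil, and_true]
      exact fun h => hne (congrArg Prod.snd h)
    · intro q hq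
      simp only [List.mem_cons, List.not_mem_nil, or_false] at hq
      rcases hq with rfl | rfl
      · exact hp
      · exact h₂
  have := hsub.countP_le fun q => q.1 == p.1
  rw [List.count, List.countP_map] at h₁
  simp only [List.countP_cons, beq_self_eq_true, if_true, List.countP_nil] at this
  change _ ≤ List.countP ((fun q => q == p.1) ∘ Prod.fst) c at this
  omega

theorem VRegex.Parse.vars_subset {s : List Alph} {γ : VRegex Alph Var}
    {i j : ℕ} {c : List (Var × Span)} (h : γ.Parse s i j c) : ∀ p ∈ c, p.1 ∈ γ.vars := by
  induction h with
  | eps => simp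
  | symbol => simp
  | or_left _ ih => exact fun p hp => Finset.mem_union_left _ (ih p hp)
  | or_right _ ih => exact fun p hp => Finset.mem_union_right _ (ih p hp)
  | cat _ _ ih₁ ih₂ =>
    intro p hp
    rcases List.mem_append.mp hp with hp | hp
    · exact Finset.mem_union_left _ (ih₁ p hp)
    · exact Finset.mem_union_right _ (ih₂ p hp)
  | star_nil => simp
  | star_cons _ _ ih₁ ih₂ =>
    intro p hp
    rcases List.mem_append.mp hp with hp | hp
    · exact ih₁ p hp
    · exact ih₂ p hp
  | capture _ ih =>
    intro p hp
    rcases List.mem_cons.mp hp with rfl | hp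
    · exact Finset.mem_insert_self _ _
    · exact Finset.mem_insert_of_mem (ih p hp)

end Translation

/-! ### Soundness of the translation -/

section Soundness

variable {Alph : Type} {Var : Type u} {w A K : ℕ}

theorem meaning_symbolAtom {I : Signature} {s : List Alph} {hA : ∀ R, I.arity R ≤ A}
    {D : Database I} {idx : Var → Fin w} {e : Fin K → VRegex Alph Var} (o : Option Alph)
    (u : Term (PosVar w)) (x : PosVar w → ℕ) :
    Meaning s hA D idx e (symbolAtom (A := A) (I := I) (K := K) o u).rel
      (fun i => ((symbolAtom (A := A) (I := I) (K := K) o u).args i).eval x) ↔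
      s[u.eval x]? = o := by
  rfl

theorem meaning_parseAtom {I : Signature} {s : List Alph} {hA : ∀ R, I.arity R ≤ A}
    {D : Database I} {idx : Var → Fin w} {e : Fin K → VRegex Alph Var} (c : Fin K)
    (i j : Term (PosVar w)) (x : PosVar w → ℕ) :
    Meaning s hA D idx e (parseAtom (Alph := Alph) (A := A) (I := I) c i j).rel
      (fun k => ((parseAtom (Alph := Alph) (A := A) (I := I) c i j).args k).eval x) ↔
      Match s idx (fun a => ⟨x (.inl (a, false)) + 1, x (.inl (a, true)) + 1⟩) (e c)
        (i.eval x + 1) (j.eval x + 1) := by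
  simp only [parseAtom, eval_tuple, eval_parseCoord, Meaning, coordAt_tuple]
  rfl

theorem meaning_idbAtom {I : Signature} {s : List Alph} {hA : ∀ R, I.arity R ≤ A}
    {D : Database I} {idx : Var → Fin w} {e : Fin K → VRegex Alph Var} (a : Atom I Var)
    (x : PosVar w → ℕ) :
    Meaning s hA D idx e (idbAtom (Alph := Alph) (A := A) (K := K) idx a).rel
      (fun k => ((idbAtom (Alph := Alph) (A := A) (K := K) idx a).args k).eval x) ↔
      (fun i => (⟨x (.inl (idx (a.args i), false)) + 1,
        x (.inl (idx (a.args i), true)) + 1⟩ : Span)) ∈ D a.symb := by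
  simp only [idbAtom, eval_tuple, eval_idbCoord, Meaning, coordAt_tuple]
  simp [idbCoord, Term.eval]

variable [DecidableEq Var]

/-- Facts over positions are true in each model of the program. -/
theorem Fact.meaning {Q : Program Alph Var} {s : List Alph} {hA : ∀ R, Q.I.arity R ≤ A}
    {idx : Var → Fin w} {e : Fin K → VRegex Alph Var} {D : Database Q.I} (hD : Q.IsModel s D)
    (he : ∀ ρ ∈ Q.rules, ∀ γ, BodyAtom.regex γ ∈ ρ.body → ∃ c, e c = γ.1)
    {r : PosRel Alph Q.I K} {t : Fin (Fintype.card (Coord w A) + 1) → ℕ}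
    (h : Fact (fun o => .inr (.inl o)) (posRules Q A idx e) s r t) :
    Meaning s hA D idx e r t := by
  induction h with
  | symbol i hi => rfl
  | rule ρ hρ x hx _ ih =>
    rcases List.mem_append.mp hρ with hρ | hρ
    · simp only [List.mem_map, Finset.mem_toList, Set.Finite.mem_toFinset] at hρ
      obtain ⟨ρ, hρ', rfl⟩ := hρ
      refine (meaning_idbAtom ρ.head x).mpr ?_
      refine hD ρ hρ' (fun y => ⟨x (.inl (idx y, false)) + 1, x (.inl (idx y, true)) + 1⟩)
        fun b hb => ?_
      have ih' : ∀ a ∈ bodyAtoms A idx e b, Meaning s hA D idx e a.rel fun i =>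
          (a.args i).eval x := fun a ha => ih a (List.mem_flatMap.mpr ⟨b, hb, ha⟩)
      cases b with
      | idb a => exact (meaning_idbAtom a x).mp (ih' _ (by simp [bodyAtoms]))
      | regex γ =>
        obtain ⟨c, hc⟩ := he ρ hρ' γ hb
        have h₁ := (meaning_symbolAtom none (.var (.inr 0)) x).mp
          (ih' (symbolAtom none (.var (.inr 0))) (by simp [bodyAtoms]))
        have h₂ := (meaning_parseAtom c .zero (.var (.inr 0)) x).mp
          (ih' (parseAtom c .zero (.var (.inr 0)))
            (List.mem_cons_of_mem _ (List.mem_map.mpr ⟨c, by simp [hc], rfl⟩)))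
        have h₃ : x (.inr 0) = s.length :=
          le_antisymm (hx _) (List.getElem?_eq_none_iff.mp h₁)
        simp only [Term.eval, h₃, hc] at h₂
        exact mem_rel_of_match γ.2 h₂
    · obtain ⟨c, -, hρ⟩ := List.mem_flatMap.mp hρ
      unfold parseRules at hρ
      split at hρ
      · simp at hρ
      · rename_i hc
        simp only [List.mem_singleton] at hρ
        subst hρ
        refine (meaning_parseAtom _ _ _ x).mpr ⟨[], ?_, by simp⟩
        rw [hc]
        exact .eps (by omega) (Nat.succ_le_succ (hx _))
      · rename_i a hc
        simp only [List.mem_singleton] at hρ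
        subst hρ
        have h := (meaning_symbolAtom _ _ x).mp (ih _ (List.mem_singleton_self _))
        refine (meaning_parseAtom _ _ _ x).mpr ⟨[], ?_, by simp⟩
        rw [hc]
        exact .symbol h
      · rename_i γ₁ γ₂ hc
        simp only [List.mem_flatMap] at hρ
        obtain ⟨b, -, hb⟩ := hρ
        split_ifs at hb with h'
        · simp only [List.mem_singleton] at hb
          subst hb
          obtain ⟨l, hl, hm⟩ := (meaning_parseAtom _ _ _ x).mp (ih _ (List.mem_singleton_self _))
          refine (meaning_parseAtom _ _ _ x).mpr ⟨l, ?_, hm⟩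
          rw [hc]
          rcases h' with h' | h'
          · exact .or_left (h' ▸ hl)
          · exact .or_right (h' ▸ hl)
        · simp at hb
      · rename_i γ₁ γ₂ hc
        simp only [List.mem_flatMap] at hρ
        obtain ⟨b, -, b', -, hb⟩ := hρ
        split_ifs at hb with h'
        · simp only [List.mem_singleton] at hb
          subst hb
          obtain ⟨l, hl, hm⟩ := (meaning_parseAtom _ _ _ x).mp
              (ih (parseAtom b (.var (.inr 0)) (.var (.inr 2))) (by simp))
          obtain ⟨l', hl', hm'⟩ := (meaning_parseAtom _ _ _ x).mp
            (ih (parseAtom b' (.var (.inr 2)) (.var (.inr 1))) (by simp))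
          refine (meaning_parseAtom _ _ _ x).mpr ⟨l ++ l', ?_, fun p hp => ?_⟩
          · rw [hc]
            exact .cat (h'.1 ▸ hl) (h'.2 ▸ hl')
          · rcases List.mem_append.mp hp with hp | hp
            · exact hm p hp
            · exact hm' p hp
        · simp at hb
      · rename_i γ hc
        simp only [List.mem_cons, List.mem_flatMap] at hρ
        rcases hρ with rfl | ⟨b, -, hb⟩
        · refine (meaning_parseAtom _ _ _ x).mpr ⟨[], ?_, by simp⟩
          rw [hc]
          exact .star_nil (by omega) (Nat.succ_le_succ (hx _))
        · split_ifs at hb with h'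
          · simp only [List.mem_singleton] at hb
            subst hb
            obtain ⟨l, hl, hm⟩ := (meaning_parseAtom _ _ _ x).mp
                (ih (parseAtom b (.var (.inr 0)) (.var (.inr 2))) (by simp))
            obtain ⟨l', hl', hm'⟩ := (meaning_parseAtom _ _ _ x).mp
              (ih (parseAtom c (.var (.inr 2)) (.var (.inr 1))) (by simp))
            refine (meaning_parseAtom _ _ _ x).mpr ⟨l ++ l', ?_, fun p hp => ?_⟩
            · rw [hc] at hl' ⊢
              exact .star_cons (h' ▸ hl) hl'
            · rcases List.mem_append.mp hp with hp | hp
              · exact hm p hp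
              · exact hm' p hp
          · simp at hb
      · rename_i y γ hc
        simp only [List.mem_flatMap] at hρ
        obtain ⟨b, -, hb⟩ := hρ
        split_ifs at hb with h'
        · simp only [List.mem_singleton] at hb
          subst hb
          obtain ⟨l, hl, hm⟩ := (meaning_parseAtom _ _ _ x).mp (ih _ (List.mem_singleton_self _))
          refine (meaning_parseAtom _ _ _ x).mpr ⟨(y, ⟨x (.inl (idx y, false)) + 1,
            x (.inl (idx y, true)) + 1⟩) :: l, ?_, fun p hp => ?_⟩
          · rw [hc]
            exact .capture (h' ▸ hl)
          · rcases List.mem_cons.mp hp with rfl | hp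
            · rfl
            · exact hm p hp
        · simp at hb

end Soundness

/-! ### Completeness of the translation -/

section Completeness

variable {Alph : Type} {Var : Type u} {w A K : ℕ}

/-- The subexpressions of an expression. -/
def VRegex.subexprs : VRegex Alph Var → List (VRegex Alph Var)
  | empty => [empty]
  | eps => [eps]
  | symbol a => [symbol a]
  | or γ₁ γ₂ => or γ₁ γ₂ :: (γ₁.subexprs ++ γ₂.subexprs)
  | cat γ₁ γ₂ => cat γ₁ γ₂ :: (γ₁.subexprs ++ γ₂.subexprs)
  | star γ => star γ :: γ.subexprs
  | capture x γ => capture x γ :: γ.subexprs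

theorem VRegex.self_mem_subexprs (γ : VRegex Alph Var) : γ ∈ γ.subexprs := by
  cases γ <;> simp [subexprs]

theorem VRegex.subexprs_subset {γ δ : VRegex Alph Var} (h : δ ∈ γ.subexprs) :
    δ.subexprs ⊆ γ.subexprs := by
  induction γ with
  | empty | eps | symbol =>
    simp only [subexprs, List.mem_singleton] at h
    subst h
    simp [subexprs]
  | or γ₁ γ₂ ih₁ ih₂ | cat γ₁ γ₂ ih₁ ih₂ =>
    simp only [subexprs, List.mem_cons, List.mem_append] at h
    rcases h with rfl | h | h
    · exact List.Subset.refl _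
    · exact fun x hx => List.mem_cons_of_mem _ (List.mem_append_left _ (ih₁ h hx))
    · exact fun x hx => List.mem_cons_of_mem _ (List.mem_append_right _ (ih₂ h hx))
  | star γ ih | capture x γ ih =>
    simp only [subexprs, List.mem_cons] at h
    rcases h with rfl | h
    · exact List.Subset.refl _
    · exact fun x hx => List.mem_cons_of_mem _ (ih h hx)

theorem eval_parseAtom {I : Signature} (c : Fin K) (i j : Term (PosVar w)) (x : PosVar w → ℕ) :
    (fun k => ((parseAtom (Alph := Alph) (A := A) (I := I) c i j).args k).eval x) =
      tuple 0 (parseCoord 0 (fun p => x (.inl p)) (i.eval x) (j.eval x)) := by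
  simp only [parseAtom, eval_tuple, eval_parseCoord]
  rfl

theorem eval_idbAtom {I : Signature} (idx : Var → Fin w) (a : Atom I Var) (x : PosVar w → ℕ) :
    (fun k => ((idbAtom (Alph := Alph) (A := A) (K := K) idx a).args k).eval x) =
      tuple 0 (idbCoord 0 fun i b => x (.inl (idx (a.args i), b))) := by
  simp only [idbAtom, eval_tuple, eval_idbCoord]
  rfl

variable [DecidableEq Var]

/-- The facts that the translation of a program derives on the string `s`. -/
abbrev Program.Derives (Q : Program Alph Var) (A : ℕ) (idx : Var → Fin w)
    (e : Fin K → VRegex Alph Var) (s : List Alph) :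
    PosRel Alph Q.I K → (Fin (Fintype.card (Coord w A) + 1) → ℕ) → Prop :=
  Fact (fun o => .inr (.inl o)) (posRules Q A idx e) s

variable {Q : Program Alph Var} {idx : Var → Fin w} {e : Fin K → VRegex Alph Var} {s : List Alph}

theorem Program.Derives.symbol {i : ℕ} (hi : i ≤ s.length) {o : Option Alph} (ho : s[i]? = o)
    (u : Term (PosVar w)) (x : PosVar w → ℕ) (hu : u.eval x = i) :
    Q.Derives A idx e s (symbolAtom (A := A) (I := Q.I) (K := K) o u).rel
      fun k => ((symbolAtom (A := A) (I := Q.I) (K := K) o u).args k).eval x := by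
  have h := Fact.symbol (sy := fun o => .inr (.inl o)) (rules := posRules Q A idx e) i hi
  rw [ho] at h
  have heval : (fun k => ((symbolAtom (A := A) (I := Q.I) (K := K) o u).args k).eval x) =
      tuple (u.eval x) fun _ => 0 :=
    eval_tuple (A := A) u (fun _ => .zero) x
  rw [heval, hu]
  exact h

/-- A rule for the expression with the number `c`, applied to the positions `i`, `j` and `k`. -/
theorem Program.Derives.parse_rule {c : Fin K} {r : Fin w × Bool → ℕ} (hr : ∀ p, r p ≤ s.length)
    {i j k : ℕ} (hi : i ≤ s.length) (hj : j ≤ s.length) (hk : k ≤ s.length)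
    {u v : Term (PosVar w)}
    {body : List (PosAtom (PosRel Alph Q.I K) (PosVar w) (Fintype.card (Coord w A)))}
    (hρ : ⟨parseAtom c u v, body⟩ ∈ parseRules Q.I A idx e c)
    (h : ∀ a ∈ body, Q.Derives A idx e s a.rel fun l => (a.args l).eval (Sum.elim r ![i, j, k])) :
    Q.Derives A idx e s (.inr (.inr c)) (tuple 0 (parseCoord 0 r
      (u.eval (Sum.elim r ![i, j, k])) (v.eval (Sum.elim r ![i, j, k])))) := by
  have := Fact.rule (sy := fun o => .inr (.inl o)) (rules := posRules Q A idx e) (s := s)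
    ⟨parseAtom c u v, body⟩
    (List.mem_append_right _ (List.mem_flatMap.mpr ⟨c, List.mem_finRange c, hρ⟩))
    (Sum.elim r ![i, j, k]) (by
      rintro (p | l)
      · exact hr p
      · fin_cases l
        · exact hi
        · exact hj
        · exact hk) h
  rw [eval_parseAtom] at this
  exact this

/-- Each parse tree is found by the rules. -/
theorem Program.Derives.of_parse (he : ∀ c, ∀ δ ∈ (e c).subexprs, ∃ b, e b = δ)
    {r : Fin w × Bool → ℕ} (hr : ∀ p, r p ≤ s.length) {γ : VRegex Alph Var} {i j : ℕ}
    {l : List (Var × Span)} (h : γ.Parse s i j l)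
    (hl : ∀ p ∈ l, r (idx p.1, false) = p.2.start - 1 ∧ r (idx p.1, true) = p.2.finish - 1)
    (c : Fin K) (hc : e c = γ) :
    Q.Derives A idx e s (.inr (.inr c)) (tuple 0 (parseCoord 0 r (i - 1) (j - 1))) := by
  induction h generalizing c with
  | @eps i h₁ h₂ =>
    exact parse_rule (i := i - 1) (j := 0) (k := 0) (u := .var (.inr 0)) (v := .var (.inr 0))
      (body := []) hr (by omega) (by omega) (by omega) (by simp [parseRules, hc]) (by simp)
  | @symbol a i h =>
    have hi : i < s.length := (List.getElem?_eq_some_iff.mp h).1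
    refine parse_rule (i := i) (j := 0) (k := 0) (u := .var (.inr 0)) (v := .succ (.inr 0))
      (body := [symbolAtom (some a) (.var (.inr 0))]) hr (by omega) (by omega) (by omega)
      (by simp [parseRules, hc]) fun b hb => ?_
    rw [List.mem_singleton] at hb
    subst hb
    exact .symbol hi.le h _ _ rfl
  | @or_left γ₁ γ₂ i j l h ih =>
    obtain ⟨b, hb⟩ := he c γ₁ (by simp [hc, VRegex.subexprs, VRegex.self_mem_subexprs])
    have hij := h.bounds.1
    refine parse_rule (i := i - 1) (j := j - 1) (k := 0) (u := .var (.inr 0)) (v := .var (.inr 1))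
      (body := [parseAtom b (.var (.inr 0)) (.var (.inr 1))]) hr (by omega) (by omega) (by omega)
      ?_ fun a ha => ?_
    · simp only [parseRules, hc, List.mem_flatMap]
      exact ⟨b, List.mem_finRange b, by simp [hb]⟩
    · rw [List.mem_singleton] at ha
      subst ha
      rw [eval_parseAtom]
      exact ih hl b hb
  | @or_right γ₁ γ₂ i j l h ih =>
    obtain ⟨b, hb⟩ := he c γ₂ (by simp [hc, VRegex.subexprs, VRegex.self_mem_subexprs])
    have hij := h.bounds.1
    refine parse_rule (i := i - 1) (j := j - 1) (k := 0) (u := .var (.inr 0)) (v := .var (.inr 1))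
      (body := [parseAtom b (.var (.inr 0)) (.var (.inr 1))]) hr (by omega) (by omega) (by omega)
      ?_ fun a ha => ?_
    · simp only [parseRules, hc, List.mem_flatMap]
      exact ⟨b, List.mem_finRange b, by simp [hb]⟩
    · rw [List.mem_singleton] at ha
      subst ha
      rw [eval_parseAtom]
      exact ih hl b hb
  | @cat γ₁ γ₂ i k j l₁ l₂ h₁ h₂ ih₁ ih₂ =>
    obtain ⟨b₁, hb₁⟩ := he c γ₁ (by simp [hc, VRegex.subexprs, VRegex.self_mem_subexprs])
    obtain ⟨b₂, hb₂⟩ := he c γ₂ (by simp [hc, VRegex.subexprs, VRegex.self_mem_subexprs])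
    have hik := h₁.bounds.1
    have hkj := h₂.bounds.1
    refine parse_rule (i := i - 1) (j := j - 1) (k := k - 1) (u := .var (.inr 0))
      (v := .var (.inr 1))
      (body := [parseAtom b₁ (.var (.inr 0)) (.var (.inr 2)),
        parseAtom b₂ (.var (.inr 2)) (.var (.inr 1))]) hr (by omega) (by omega) (by omega)
      ?_ fun a ha => ?_
    · simp only [parseRules, hc, List.mem_flatMap]
      exact ⟨b₁, List.mem_finRange b₁, b₂, List.mem_finRange b₂, by simp [hb₁, hb₂]⟩
    · simp only [List.mem_cons, List.not_mem_nil, or_false] at ha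
      rcases ha with rfl | rfl
      · rw [eval_parseAtom]
        exact ih₁ (fun p hp => hl p (List.mem_append_left _ hp)) b₁ hb₁
      · rw [eval_parseAtom]
        exact ih₂ (fun p hp => hl p (List.mem_append_right _ hp)) b₂ hb₂
  | @star_nil γ i h₁ h₂ =>
    exact parse_rule (i := i - 1) (j := 0) (k := 0) (u := .var (.inr 0)) (v := .var (.inr 0))
      (body := []) hr (by omega) (by omega) (by omega) (by simp [parseRules, hc]) (by simp)
  | @star_cons γ i k j l₁ l₂ h₁ h₂ ih₁ ih₂ =>
    obtain ⟨b, hb⟩ := he c γ (by simp [hc, VRegex.subexprs, VRegex.self_mem_subexprs])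
    have hik := h₁.bounds.1
    have hkj := h₂.bounds.1
    refine parse_rule (i := i - 1) (j := j - 1) (k := k - 1) (u := .var (.inr 0))
      (v := .var (.inr 1))
      (body := [parseAtom b (.var (.inr 0)) (.var (.inr 2)),
        parseAtom c (.var (.inr 2)) (.var (.inr 1))]) hr (by omega) (by omega) (by omega)
      ?_ fun a ha => ?_
    · simp only [parseRules, hc, List.mem_cons, List.mem_flatMap]
      exact .inr ⟨b, List.mem_finRange b, by simp [hb]⟩
    · simp only [List.mem_cons, List.not_mem_nil, or_false] at ha
      rcases ha with rfl | rfl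
      · rw [eval_parseAtom]
        exact ih₁ (fun p hp => hl p (List.mem_append_left _ hp)) b hb
      · rw [eval_parseAtom]
        exact ih₂ (fun p hp => hl p (List.mem_append_right _ hp)) c hc
  | @capture x γ i j l h ih =>
    obtain ⟨b, hb⟩ := he c γ (by simp [hc, VRegex.subexprs, VRegex.self_mem_subexprs])
    obtain ⟨h₁, h₂⟩ := hl (x, ⟨i, j⟩) List.mem_cons_self
    have hρ : (⟨parseAtom c (.var (.inl (idx x, false))) (.var (.inl (idx x, true))),
        [parseAtom b (.var (.inl (idx x, false))) (.var (.inl (idx x, true)))]⟩ :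
        PosRule (PosRel Alph Q.I K) (PosVar w) (Fintype.card (Coord w A))) ∈
        parseRules Q.I A idx e c := by
      simp only [parseRules, hc, List.mem_flatMap]
      exact ⟨b, List.mem_finRange b, by simp [hb]⟩
    have := parse_rule (s := s) (i := 0) (j := 0) (k := 0) hr (by omega) (by omega) (by omega)
      hρ fun a ha => by
        rw [List.mem_singleton] at ha
        subst ha
        rw [eval_parseAtom]
        have := ih (fun p hp => hl p (List.mem_cons_of_mem _ hp)) b hb
        rw [← h₁, ← h₂] at this
        exact this
    change Q.Derives A idx e s (.inr (.inr c)) (tuple 0 (parseCoord 0 r (i - 1) (j - 1)))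
    rw [← h₁, ← h₂]
    exact this

/-- The database of the derived facts. -/
def Program.derived (Q : Program Alph Var) (A : ℕ) (idx : Var → Fin w)
    (e : Fin K → VRegex Alph Var) (s : List Alph) : Database Q.I :=
  fun R => {t | (∀ i, (t i).IsSpanOf s) ∧
    Q.Derives A idx e s (.inl R) (tuple 0 (idbCoord 0 fun i b => (t i).bound b - 1))}

/-- The derived facts, read as a database, satisfy the rules of the program; so the minimal model is
derived. The variables of the program in `W` have distinct numbers, and all expressions and their
subexpressions are numbered by `e`. -/
theorem Program.isModel_derived (he : ∀ c, ∀ δ ∈ (e c).subexprs, ∃ b, e b = δ)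
    {W : Set Var} (hidx : Set.InjOn idx W)
    (hW : ∀ ρ ∈ Q.rules, ∀ b ∈ ρ.body, ∀ y ∈ b.vars, y ∈ W) :
    Q.IsModel s (Q.derived A idx e s) := by
  classical
  intro ρ hρ ν hν
  have hspan : ∀ b ∈ ρ.body, ∀ y ∈ b.vars, (ν y).IsSpanOf s := by
    intro b hb y hy
    have h := hν b hb
    cases b with
    | idb a =>
      obtain ⟨j, -, rfl⟩ := Finset.mem_image.mp hy
      exact h.1 j
    | regex γ =>
      obtain ⟨c, hc, hm⟩ := h
      exact hc.bounds.2 _ (hm ⟨y, hy⟩)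
  -- The positions that are assigned to the variables of the translated rule. A variable that does
  -- not stand for a variable of the rule gets the position `0`.
  let r : Fin w × Bool → ℕ := fun p =>
    if h : ∃ y ∈ W, idx y = p.1 ∧ (ν y).IsSpanOf s then (ν h.choose).bound p.2 - 1 else 0
  have hr : ∀ p, r p ≤ s.length := by
    intro p
    by_cases h : ∃ y ∈ W, idx y = p.1 ∧ (ν y).IsSpanOf s
    · simp only [r, dif_pos h]
      obtain ⟨h₁, h₂, h₃⟩ := h.choose_spec.2.2
      unfold Span.bound
      split_ifs <;> omega
    · simp [r, dif_neg h]
  have hr' : ∀ b ∈ ρ.body, ∀ y ∈ b.vars, ∀ c, r (idx y, c) = (ν y).bound c - 1 := by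
    intro b hb y hy c
    have h : ∃ z ∈ W, idx z = (idx y, c).1 ∧ (ν z).IsSpanOf s :=
      ⟨y, hW ρ hρ b hb y hy, rfl, hspan b hb y hy⟩
    have h' : h.choose = y := hidx h.choose_spec.1 (hW ρ hρ b hb y hy) h.choose_spec.2.1
    simp only [r, dif_pos h, h']
  have hhead : ∀ i c, r (idx (ρ.head.args i), c) = (ν (ρ.head.args i)).bound c - 1 := by
    intro i c
    obtain ⟨b, hb, hi⟩ := ρ.safe i
    exact hr' b hb _ hi c
  refine ⟨fun i => ?_, ?_⟩
  · obtain ⟨b, hb, hi⟩ := ρ.safe i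
    exact hspan b hb _ hi
  have := Fact.rule (sy := fun o => .inr (.inl o)) (rules := posRules Q A idx e) (s := s)
    (posRule A idx e ρ) (List.mem_append_left _ (by simpa using ⟨ρ, hρ, rfl⟩))
    -- The first of the three further positions is the end of the string, as `bodyAtoms` requires.
    (Sum.elim r ![s.length, 0, 0]) (by
      rintro (p | l)
      · exact hr p
      · fin_cases l <;> simp) (by
      intro a ha
      obtain ⟨b, hb, ha⟩ := List.mem_flatMap.mp ha
      have hrb := hr' b hb
      have h := hν b hb
      cases b with
      | idb a' =>
        simp only [bodyAtoms, List.mem_singleton] at ha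
        subst ha
        have heq : (fun i c => Sum.elim r ![s.length, 0, 0] (.inl (idx (a'.args i), c))) =
            fun i c => (ν (a'.args i)).bound c - 1 := by
          funext i c
          exact hrb _ (Finset.mem_image_of_mem _ (Finset.mem_univ i)) c
        rw [eval_idbAtom, heq]
        exact h.2
      | regex γ =>
        obtain ⟨l, hl, hm⟩ := match_of_mem_rel γ.2 h
        simp only [bodyAtoms, List.mem_cons, List.mem_map, List.mem_filter] at ha
        rcases ha with rfl | ⟨c, ⟨-, hc⟩, rfl⟩
        · exact Program.Derives.symbol (i := s.length) le_rfl (by simp) _ _ rfl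
        · rw [eval_parseAtom]
          refine Program.Derives.of_parse he hr hl (fun p hp => ?_) c (by simpa using hc)
          have hv := hl.vars_subset p hp
          rw [hrb _ hv, hrb _ hv, hm p hp hv]
          exact ⟨rfl, rfl⟩)
  have heq : (fun i c => Sum.elim r ![s.length, 0, 0] (.inl (idx (ρ.head.args i), c))) =
      fun i c => (ν (ρ.head.args i)).bound c - 1 := by
    funext i c
    exact hhead i c
  rw [posRule, eval_idbAtom, heq] at this
  exact this

end Completeness

/-! ### Spanners defined by programs are computable in polynomial time -/

section

variable {Alph : Type} {Var : Type u} [DecidableEq Var]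

open Classical in
/-- The spanner that is defined by a program is computable in polynomial time. -/
theorem Program.polyTime_toSpanner [Finite Alph] (Q : Program Alph Var) :
    Q.toSpanner.PolyTime := by
  have := Q.I.finite
  cases nonempty_fintype Q.I.Rel
  cases nonempty_fintype Alph
  -- All subexpressions of the regex formulas of the program are listed, and its variables are
  -- numbered.
  let bodies : List (BodyAtom Alph Var Q.I) := Q.rules_finite.toFinset.toList.flatMap Rule.body
  let L : List (VRegex Alph Var) := bodies.flatMap fun b =>
    match b with
    | .idb _ => []
    | .regex γ => γ.1.subexprs
  let e : Fin L.length → VRegex Alph Var := L.get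
  have hmem : ∀ ρ ∈ Q.rules, ∀ b ∈ ρ.body, b ∈ bodies := fun ρ hρ b hb =>
    List.mem_flatMap.mpr ⟨ρ, by simpa using hρ, hb⟩
  have he : ∀ ρ ∈ Q.rules, ∀ γ, BodyAtom.regex γ ∈ ρ.body → ∃ c, e c = γ.1 := by
    intro ρ hρ γ hγ
    have : γ.1 ∈ L := List.mem_flatMap.mpr ⟨_, hmem ρ hρ _ hγ, γ.1.self_mem_subexprs⟩
    exact List.mem_iff_get.mp this
  have hsub : ∀ c, ∀ δ ∈ (e c).subexprs, ∃ b, e b = δ := by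
    intro c δ hδ
    obtain ⟨b, hb, hc⟩ := List.mem_flatMap.mp (L.get_mem c)
    cases b with
    | idb a => simp at hc
    | regex γ =>
      have : δ ∈ L := List.mem_flatMap.mpr ⟨_, hb, VRegex.subexprs_subset hc hδ⟩
      exact List.mem_iff_get.mp this
  let W : Finset Var := Finset.univ.image Q.outVars ∪ bodies.toFinset.biUnion BodyAtom.vars
  obtain ⟨idx, hidx⟩ : ∃ idx : Var → Fin (W.card + 1), Set.InjOn idx W := by
    refine ⟨fun y => if h : y ∈ W then (W.equivFin ⟨y, h⟩).castSucc else Fin.last _, ?_⟩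
    intro y hy z hz h
    rw [Finset.mem_coe] at hy hz
    simp only [dif_pos hy, dif_pos hz] at h
    simpa using h
  have hW : ∀ ρ ∈ Q.rules, ∀ b ∈ ρ.body, ∀ y ∈ b.vars, y ∈ (W : Set Var) := fun ρ hρ b hb y hy =>
    Finset.mem_union_right _ (Finset.mem_biUnion.mpr ⟨b, by simpa using hmem ρ hρ b hb, hy⟩)
  obtain ⟨A, hA⟩ : ∃ A, ∀ R, Q.I.arity R ≤ A := by
    obtain ⟨A, hA⟩ := (Set.finite_range Q.I.arity).bddAbove
    exact ⟨A, fun R => hA ⟨R, rfl⟩⟩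
  obtain ⟨f, hf, hf'⟩ := exists_computable_of_rules (fun o => .inr (.inl o)) (posRules Q A idx e)
    (idbAtom idx ⟨Q.out, Q.outVars⟩)
    (fun i => (.inl (idx (Q.outVars i), false), .inl (idx (Q.outVars i), true)))
  have hcongr : ∀ s t, t ∈ f s ↔ t ∈ Q.eval s Q.out := by
    intro s t
    rw [hf']
    constructor
    -- Soundness: derived facts hold in each model.
    · rintro ⟨z, hz, h, rfl⟩ D hD
      exact (meaning_idbAtom (hA := hA) _ _).mp (h.meaning hD he)
    -- Completeness: the derived database is one of the models.
    · intro ht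
      obtain ⟨h₁, h₂⟩ := ht _ (Program.isModel_derived (A := A) hsub hidx hW)
      -- The assignment that sends the output variables to the given tuple.
      let z : Fin (W.card + 1) × Bool → ℕ := fun p =>
        if h : ∃ i, idx (Q.outVars i) = p.1 then (t h.choose).bound p.2 - 1 else 0
      have hz : ∀ i b, z (idx (Q.outVars i), b) = (t i).bound b - 1 := by
        intro i b
        have h : ∃ j, idx (Q.outVars j) = (idx (Q.outVars i), b).1 := ⟨i, rfl⟩
        have h' : h.choose = i := Q.outVars_injective (hidx
          (Finset.mem_union_left _ (Finset.mem_image_of_mem _ (Finset.mem_univ _)))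
          (Finset.mem_union_left _ (Finset.mem_image_of_mem _ (Finset.mem_univ _))) h.choose_spec)
        simp only [z, dif_pos h, h']
      refine ⟨Sum.elim z fun _ => 0, ?_, ?_, ?_⟩
      · rintro (p | l)
        · simp only [Sum.elim_inl, z]
          split_ifs with h
          · obtain ⟨h₁, h₂, h₃⟩ := h₁ h.choose
            unfold Span.bound
            split_ifs <;> omega
          · omega
        · simp
      · rw [eval_idbAtom]
        simp only [Sum.elim_inl, hz]
        exact h₂
      · funext i
        obtain ⟨h₁, h₂, h₃⟩ := h₁ i
        simp only [Sum.elim_inl, hz, Span.bound]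
        ext <;> simp <;> omega
  let g : Fin (Q.I.arity Q.out) → Q.toSpanner.vars := fun i =>
    ⟨Q.outVars i, Finset.mem_image_of_mem Q.outVars (Finset.mem_univ i)⟩
  have hg : Function.Bijective g := by
    refine ⟨fun i j h => Q.outVars_injective (congrArg Subtype.val h), ?_⟩
    rintro ⟨x, hx⟩
    obtain ⟨i, -, rfl⟩ := Finset.mem_image.mp hx
    exact ⟨i, rfl⟩
  refine ⟨_, (Equiv.ofBijective g hg).symm, f, hf, fun s r => ?_⟩
  simp only [hcongr]
  refine exists_congr fun t => and_congr_right fun _ => ⟨fun h x => ?_, fun h i => ?_⟩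
  · obtain ⟨i, rfl⟩ := (Equiv.ofBijective g hg).surjective x
    rw [Equiv.symm_apply_apply]
    exact h i
  · have := h (Equiv.ofBijective g hg i)
    rw [Equiv.symm_apply_apply] at this
    exact this

end

/-! ### Binary regex formulas -/

/-- The variable-free expressions from which the binary regex formulas are built. -/
inductive Simple (Alph : Type) : Type
  /-- the empty string -/
  | eps : Simple Alph
  /-- a given symbol -/
  | letter (a : Alph) : Simple Alph
  /-- an arbitrary symbol -/
  | anyLetter : Simple Alph
  /-- an arbitrary string -/
  | any : Simple Alph

/-- The substring `s_[i, j⟩` is described by the expression. -/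
def Simple.Matches {Alph : Type} (s : List Alph) : Simple Alph → ℕ → ℕ → Prop
  | eps, i, j => 1 ≤ i ∧ i ≤ s.length + 1 ∧ j = i
  | letter a, i, j => 1 ≤ i ∧ s[i - 1]? = some a ∧ j = i + 1
  | anyLetter, i, j => 1 ≤ i ∧ i ≤ s.length ∧ j = i + 1
  | any, i, j => 1 ≤ i ∧ i ≤ j ∧ j ≤ s.length + 1

section

variable {Alph : Type} {Var : Type u}

/-- The expression as a disjunction of symbols. -/
def VRegex.oneOf (l : List Alph) : VRegex Alph Var :=
  l.foldr (fun a γ => or (symbol a) γ) empty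

theorem VRegex.parse_oneOf {s : List Alph} {l : List Alph} {i j : ℕ} {c : List (Var × Span)} :
    (oneOf l).Parse s i j c ↔ c = [] ∧ 1 ≤ i ∧ (∃ a ∈ l, s[i - 1]? = some a) ∧ j = i + 1 := by
  induction l with
  | nil =>
    simp only [oneOf, List.foldr_nil, List.not_mem_nil, false_and, exists_false, and_false,
      iff_false]
    rintro ⟨⟩
  | cons a l ih =>
    constructor
    · intro h
      cases h with
      | or_left h =>
        cases h with
        | symbol h => exact ⟨rfl, by omega, ⟨a, by simp, h⟩, rfl⟩
      | or_right h =>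
        obtain ⟨h₁, h₂, ⟨b, hb, hb'⟩, h₃⟩ := ih.mp h
        exact ⟨h₁, h₂, ⟨b, List.mem_cons_of_mem _ hb, hb'⟩, h₃⟩
    · rintro ⟨rfl, h, ⟨b, hb, hb'⟩, rfl⟩
      rcases List.mem_cons.mp hb with rfl | hb
      · obtain ⟨i, rfl⟩ : ∃ i', i = i' + 1 := ⟨i - 1, by omega⟩
        exact .or_left (.symbol hb')
      · exact .or_right (ih.mpr ⟨rfl, h, ⟨b, hb, hb'⟩, rfl⟩)

theorem VRegex.parse_star_oneOf {s : List Alph} {l : List Alph} (hl : ∀ a, a ∈ l) {i j : ℕ}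
    {c : List (Var × Span)} :
    (star (oneOf l)).Parse s i j c ↔ c = [] ∧ 1 ≤ i ∧ i ≤ j ∧ j ≤ s.length + 1 := by
  constructor
  · intro h
    refine ⟨?_, h.bounds.1⟩
    generalize hγ : star (oneOf l) = γ at h
    induction h with
    | star_nil => rfl
    | star_cons h₁ _ _ ih₂ =>
      cases hγ
      rw [(parse_oneOf.mp h₁).1, ih₂ rfl]
      rfl
    | _ => cases hγ
  · rintro ⟨rfl, h₁, h₂, h₃⟩
    obtain ⟨m, rfl⟩ := Nat.exists_eq_add_of_le h₂
    clear h₂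
    induction m generalizing i with
    | zero => exact .star_nil h₁ h₃
    | succ m ih =>
      have hi : i - 1 < s.length := by omega
      have h₁ : (oneOf l : VRegex Alph Var).Parse s i (i + 1) [] :=
        parse_oneOf.mpr ⟨rfl, h₁, ⟨s[i - 1], hl _, List.getElem?_eq_getElem hi⟩, rfl⟩
      have h₂ := ih (i := i + 1) (by omega) (by omega)
      rw [show i + (m + 1) = i + 1 + m by omega]
      exact h₁.star_cons h₂

variable [Fintype Alph]

/-- The expression that is described by a value of `Simple`. -/
noncomputable def Simple.regex : Simple Alph → VRegex Alph Var
  | eps => .eps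
  | letter a => .symbol a
  | anyLetter => .oneOf Finset.univ.toList
  | any => .star (.oneOf Finset.univ.toList)

theorem Simple.parse_iff (A : Simple Alph) {s : List Alph} {i j : ℕ} {c : List (Var × Span)} :
    A.regex.Parse s i j c ↔ c = [] ∧ A.Matches s i j := by
  cases A with
  | eps =>
    constructor
    · intro h
      cases h with
      | eps h₁ h₂ => exact ⟨rfl, h₁, h₂, rfl⟩
    · rintro ⟨rfl, h₁, h₂, rfl⟩
      exact .eps h₁ h₂
  | letter a =>
    constructor
    · intro h
      cases h with
      | symbol h => exact ⟨rfl, by omega, h, rfl⟩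
    · rintro ⟨rfl, h₁, h₂, rfl⟩
      obtain ⟨i, rfl⟩ : ∃ i', i = i' + 1 := ⟨i - 1, by omega⟩
      exact .symbol h₂
  | anyLetter =>
    refine VRegex.parse_oneOf.trans (and_congr_right fun _ => ?_)
    simp only [Matches, Finset.mem_toList, Finset.mem_univ, true_and]
    refine and_congr_right fun h₁ => and_congr_left fun _ => ?_
    rw [← Option.isSome_iff_exists, Option.isSome_iff_ne_none, ne_eq, List.getElem?_eq_none_iff]
    omega
  | any => exact VRegex.parse_star_oneOf (by simp)

/-- A description of the binary regex formula `A x{B y{C} D} E`. -/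
structure Nested (Alph : Type) where
  A : Simple Alph
  B : Simple Alph
  C : Simple Alph
  D : Simple Alph
  E : Simple Alph

/-- The formula extracts the record `x ↦ σ, y ↦ τ`. -/
def Nested.Holds (s : List Alph) (κ : Nested Alph) (σ τ : Span) : Prop :=
  κ.A.Matches s 1 σ.start ∧ κ.B.Matches s σ.start τ.start ∧ κ.C.Matches s τ.start τ.finish ∧
    κ.D.Matches s τ.finish σ.finish ∧ κ.E.Matches s σ.finish (s.length + 1)

/-- The expression `A x{B y{C} D} E`. -/
noncomputable def Nested.regex (κ : Nested Alph) (x y : Var) : VRegex Alph Var :=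
  .cat κ.A.regex (.cat (.capture x (.cat κ.B.regex (.cat (.capture y κ.C.regex) κ.D.regex)))
    κ.E.regex)

theorem Nested.parse_iff (κ : Nested Alph) (x y : Var) {s : List Alph}
    {c : List (Var × Span)} :
    (κ.regex x y).Parse s 1 (s.length + 1) c ↔
      ∃ σ τ : Span, c = [(x, σ), (y, τ)] ∧ κ.Holds s σ τ := by
  constructor
  · intro h
    cases h with
    | cat hA h =>
      cases h with
      | cat h hE =>
        cases h with
        | capture h =>
          cases h with
          | cat hB h =>
            cases h with
            | cat h hD =>
              cases h with
              | capture hC =>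
                obtain ⟨rfl, hA'⟩ := (Simple.parse_iff _).mp hA
                obtain ⟨rfl, hB'⟩ := (Simple.parse_iff _).mp hB
                obtain ⟨rfl, hC'⟩ := (Simple.parse_iff _).mp hC
                obtain ⟨rfl, hD'⟩ := (Simple.parse_iff _).mp hD
                obtain ⟨rfl, hE'⟩ := (Simple.parse_iff _).mp hE
                exact ⟨_, _, rfl, hA', hB', hC', hD', hE'⟩
  · rintro ⟨σ, τ, rfl, hA, hB, hC, hD, hE⟩
    exact .cat ((Simple.parse_iff _).mpr ⟨rfl, hA⟩)
      (.cat (c₁ := [(x, σ), (y, τ)]) (.capture (.cat ((Simple.parse_iff _).mpr ⟨rfl, hB⟩)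
        (.cat (.capture ((Simple.parse_iff _).mpr ⟨rfl, hC⟩))
          ((Simple.parse_iff _).mpr ⟨rfl, hD⟩)))) ((Simple.parse_iff _).mpr ⟨rfl, hE⟩))

variable [DecidableEq Var]

omit [Fintype Alph] in
theorem VRegex.vars_oneOf (l : List Alph) : (oneOf l : VRegex Alph Var).vars = ∅ := by
  induction l with
  | nil => rfl
  | cons a l ih => exact (congrArg _ ih).trans (Finset.empty_union _)

theorem Simple.vars_regex (A : Simple Alph) : (A.regex : VRegex Alph Var).vars = ∅ := by
  cases A with
  | eps => rfl
  | letter a => rfl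
  | anyLetter => exact VRegex.vars_oneOf _
  | any => exact VRegex.vars_oneOf _

theorem Nested.vars_regex (κ : Nested Alph) (x y : Var) : (κ.regex x y).vars = {x, y} := by
  simp [regex, VRegex.vars, Simple.vars_regex]

theorem Nested.functional (κ : Nested Alph) {x y : Var} (h : x ≠ y) :
    (κ.regex x y).Functional := by
  intro s c hc z hz
  obtain ⟨σ, τ, rfl, -⟩ := (κ.parse_iff x y).mp hc
  rw [κ.vars_regex, Finset.mem_insert, Finset.mem_singleton] at hz
  rcases hz with rfl | rfl
  · simp [h.symm]
  · simp [h]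

theorem Nested.mem_rel (κ : Nested Alph) {x y : Var} (h : x ≠ y) {s : List Alph}
    (ν : Var → Span) :
    (fun z : (κ.regex x y).vars => ν z) ∈ (κ.regex x y).rel s ↔ κ.Holds s (ν x) (ν y) := by
  have hx : x ∈ (κ.regex x y).vars := by simp [κ.vars_regex]
  have hy : y ∈ (κ.regex x y).vars := by simp [κ.vars_regex]
  constructor
  · rintro ⟨c, hc, hm⟩
    obtain ⟨σ, τ, rfl, hκ⟩ := (κ.parse_iff x y).mp hc
    have h₁ := hm ⟨x, hx⟩
    have h₂ := hm ⟨y, hy⟩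
    simp only [List.mem_cons, Prod.mk.injEq, h, h.symm, true_and, false_and, List.not_mem_nil,
      or_false, false_or] at h₁ h₂
    rwa [h₁, h₂]
  · intro hκ
    refine ⟨_, (κ.parse_iff x y).mpr ⟨_, _, rfl, hκ⟩, ?_⟩
    rintro ⟨z, hz⟩
    rw [κ.vars_regex, Finset.mem_insert, Finset.mem_singleton] at hz
    rcases hz with rfl | rfl <;> simp

end

/-! ### Programs with binary regex formulas -/

/-- An atom, with arguments that are indexed by a type that depends on the relation symbol. -/
structure FamAtom (R : Type) (ar : R → Type) (V : Type) where
  rel : R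
  args : ar rel → V

/-- A rule whose regex formulas are of the form `A x{B y{C} D} E`, with variables `x ≠ y`. -/
structure FamRule (Alph R : Type) (ar : R → Type) (V : Type) where
  head : FamAtom R ar V
  body : List (FamAtom R ar V)
  regexes : List (Nested Alph × V × V)
  ne : ∀ p ∈ regexes, p.2.1 ≠ p.2.2
  safe : ∀ i, (∃ a ∈ body, ∃ j, a.args j = head.args i) ∨
    ∃ p ∈ regexes, p.2.1 = head.args i ∨ p.2.2 = head.args i

section

variable {Alph R V : Type} {ar : R → Type}

/-- The body of the rule holds under the assignment `ν`. -/
def FamRule.BodyHolds (ρ : FamRule Alph R ar V) (s : List Alph) (D : ∀ r, (ar r → Span) → Prop)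
    (ν : V → Span) : Prop :=
  (∀ a ∈ ρ.body, D a.rel fun i => ν (a.args i)) ∧
    ∀ p ∈ ρ.regexes, p.1.Holds s (ν p.2.1) (ν p.2.2)

/-- All rules hold in `D`. -/
def FamModel (rules : Set (FamRule Alph R ar V)) (s : List Alph)
    (D : ∀ r, (ar r → Span) → Prop) : Prop :=
  ∀ ρ ∈ rules, ∀ ν : V → Span, ρ.BodyHolds s D ν → D ρ.head.rel fun i => ν (ρ.head.args i)

variable {Var : Type u} [Finite R] [∀ r, Fintype (ar r)]

variable (R ar) in
/-- The signature in which the arguments are numbered. -/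
abbrev famSignature : Signature :=
  ⟨R, fun r => Fintype.card (ar r), inferInstance⟩

/-- The arguments of an atom as a tuple. -/
noncomputable def famTuple {α : Type*} {r : R} (t : ar r → α) : Fin (Fintype.card (ar r)) → α :=
  fun i => t ((Fintype.equivFin (ar r)).symm i)

/-- The atom in which the variables are renamed by `ι`. -/
noncomputable def FamAtom.toAtom (ι : V → Var) (a : FamAtom R ar V) :
    Atom (famSignature R ar) Var :=
  ⟨a.rel, famTuple fun i => ι (a.args i)⟩

variable [Fintype Alph] [DecidableEq Var] (ι : V ↪ Var)

/-- The regex formula `A x{B y{C} D} E`. -/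
noncomputable def Nested.toBodyAtom (I : Signature) (κ : Nested Alph) (x y : V) (h : x ≠ y) :
    BodyAtom Alph Var I :=
  .regex ⟨κ.regex (ι x) (ι y), κ.functional (ι.injective.ne h)⟩

/-- The rule in which the variables are renamed by `ι`. -/
noncomputable def FamRule.toRule (ρ : FamRule Alph R ar V) :
    Rule Alph Var (famSignature R ar) where
  head := ρ.head.toAtom ι
  body := ρ.body.map (fun a => .idb (a.toAtom ι)) ++
    ρ.regexes.attach.map fun p => p.1.1.toBodyAtom ι _ _ _ (ρ.ne p.1 p.2)
  safe i := by
    rcases ρ.safe ((Fintype.equivFin (ar ρ.head.rel)).symm i) with ⟨a, ha, j, hj⟩ | ⟨p, hp, h⟩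
    · refine ⟨.idb (a.toAtom ι), List.mem_append_left _ (List.mem_map_of_mem ha), ?_⟩
      refine Finset.mem_image.mpr ⟨Fintype.equivFin _ j, Finset.mem_univ _, ?_⟩
      exact congrArg ι ((congrArg a.args (Equiv.symm_apply_apply _ j)).trans hj)
    · refine ⟨p.1.toBodyAtom ι _ _ _ (ρ.ne p hp), List.mem_append_right _
        (List.mem_map.mpr ⟨⟨p, hp⟩, List.mem_attach _ _, rfl⟩), ?_⟩
      change _ ∈ (p.1.regex _ _).vars
      rw [Nested.vars_regex, Finset.mem_insert, Finset.mem_singleton]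
      exact h.imp (fun h => (congrArg ι h).symm) fun h => (congrArg ι h).symm

/-- The program that consists of the given rules. -/
noncomputable def famProgram (rules : Set (FamRule Alph R ar V)) (hfin : rules.Finite) (out : R)
    (ov : ar out ↪ Var) : Program Alph Var where
  I := famSignature R ar
  rules := FamRule.toRule ι '' rules
  rules_finite := hfin.image _
  out := out
  outVars := famTuple ov
  outVars_injective := ov.injective.comp (Equiv.injective _)

variable {ι} {rules : Set (FamRule Alph R ar V)} {hfin : rules.Finite} {out : R}
  {ov : ar out ↪ Var} {s : List Alph}

theorem isBinary_famProgram : (famProgram ι rules hfin out ov).IsBinary := by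
  rintro - ⟨ρ, -, rfl⟩ γ hγ
  rcases List.mem_append.mp hγ with h | h
  · obtain ⟨a, -, h⟩ := List.mem_map.mp h
    cases h
  · obtain ⟨p, -, h⟩ := List.mem_map.mp h
    obtain rfl := BodyAtom.regex.inj h
    change (p.1.1.regex _ _).vars.card = 2
    rw [Nested.vars_regex]
    exact Finset.card_pair (ι.injective.ne (ρ.ne p.1 p.2))

/-- The relations that the program defines. -/
def FamEval (ι : V ↪ Var) (rules : Set (FamRule Alph R ar V)) (hfin : rules.Finite) (out : R)
    (ov : ar out ↪ Var) (s : List Alph) (r : R) (t : ar r → Span) : Prop :=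
  famTuple t ∈ (famProgram ι rules hfin out ov).eval s r

/-- The program is sound for each database in which its rules hold. -/
theorem FamEval.of_model {D : ∀ r, (ar r → Span) → Prop} (hD : FamModel rules s D) {r : R}
    {t : ar r → Span} (h : FamEval ι rules hfin out ov s r t) : D r t := by
  have key : ∀ (r : R) (t : ar r → Span),
      (D r fun i => famTuple t (Fintype.equivFin (ar r) i)) ↔ D r t := by simp [famTuple]
  have := h (fun r : R => {t | D r fun i => t (Fintype.equivFin (ar r) i)}) ?_
  · exact (key _ _).mp this
  · rintro - ⟨ρ, hρ, rfl⟩ ν hν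
    have := hD ρ hρ (fun v => ν (ι v)) ⟨fun a ha => ?_, fun p hp => ?_⟩
    · exact (key _ _).mpr this
    · have := hν (.idb (a.toAtom ι)) (List.mem_append_left _ (List.mem_map_of_mem ha))
      exact (key _ _).mp this
    · have := hν (p.1.toBodyAtom ι _ _ _ (ρ.ne p hp)) (List.mem_append_right _
        (List.mem_map.mpr ⟨⟨p, hp⟩, List.mem_attach _ _, rfl⟩))
      exact (p.1.mem_rel (ι.injective.ne (ρ.ne p hp)) ν).mp this

/-- The minimal model satisfies the rules. -/
theorem famModel_famEval : FamModel rules s (FamEval ι rules hfin out ov s) := by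
  intro ρ hρ ν hν
  have h : ∀ v, Function.extend ι ν (fun _ => ⟨1, 1⟩) (ι v) = ν v :=
    fun v => ι.injective.extend_apply _ _ v
  have := ((famProgram ι rules hfin out ov).eval_isLeast s).1 (ρ.toRule ι)
    (Set.mem_image_of_mem _ hρ) (Function.extend ι ν fun _ => ⟨1, 1⟩) ?_
  · simp only [FamRule.toRule, FamAtom.toAtom, famTuple, h] at this
    exact this
  · intro b hb
    rcases List.mem_append.mp hb with hb | hb
    · obtain ⟨a, ha, rfl⟩ := List.mem_map.mp hb
      have := hν.1 a ha
      simp only [BodyAtom.Holds, FamAtom.toAtom, famTuple, h]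
      exact this
    · obtain ⟨⟨p, hp⟩, -, rfl⟩ := List.mem_map.mp hb
      refine (p.1.mem_rel (ι.injective.ne (ρ.ne p hp)) _).mpr ?_
      rw [h, h]
      exact hν.2 p hp

end

/-! ### Stack machines -/

/-- What a step of a stack machine does with one of the stacks. -/
inductive StackOp (G : Type) : Type
  | keep : StackOp G
  | pop : StackOp G
  | push (g : G) : StackOp G

/-- The stack after the operation. -/
def StackOp.apply {G : Type} : StackOp G → List G → List G
  | keep, l => l
  | pop, l => l.tail
  | push g, l => g :: l

/-- A machine with stacks over a common alphabet. In each step, it reads the top of the stack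
`key q` that belongs to its state `q`, modifies this stack by `op q`, and changes its state. -/
structure StackMachine (K St G : Type) where
  key : St → K
  next : St → Option G → St
  op : St → StackOp G

/-- A step of the machine on a state and the contents of the stacks. -/
def StackMachine.step {K St G : Type} [DecidableEq K] (M : StackMachine K St G)
    (c : St × (K → List G)) : St × (K → List G) :=
  (M.next c.1 (c.2 (M.key c.1)).head?,
    Function.update c.2 (M.key c.1) ((M.op c.1).apply (c.2 (M.key c.1))))

/-! ### Turing machines as stack machines -/

section Simulation

open Turing StateTransition

variable {K Λ σ : Type} [DecidableEq K] {Γ : K → Type} [Fintype Λ]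
  (m : Λ → TM2.Stmt Γ Λ σ) (k₀ : K)

/-- The states of the stack machine: what remains to be executed of a statement (`none` if the
Turing machine has halted), and the value of the internal variable. -/
abbrev SimState : Type := {o : Option (TM2.Stmt Γ Λ σ) // o ∈ TM2.stmts m Finset.univ} × σ

/-- The stack alphabet: symbols of the stack `k₀`, and states in which a symbol is pushed. A state
stands for the pushed symbol; so the alphabet is finite although that of the Turing machine may
be infinite. -/
abbrev SimSymbol : Type := SimState m ⊕ Γ k₀

variable {m}

omit [DecidableEq K] in
theorem none_mem_stmts : none ∈ TM2.stmts m Finset.univ := by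
  simp [TM2.stmts]

omit [DecidableEq K] in
theorem some_mem_stmts (l : Λ) : some (m l) ∈ TM2.stmts m Finset.univ := by
  simp only [TM2.stmts, Finset.some_mem_insertNone, Finset.mem_biUnion]
  exact ⟨l, Finset.mem_univ l, TM2.stmts₁_self⟩

variable (m)

open Classical in
/-- The state with the given components. -/
noncomputable def simState (o : Option (TM2.Stmt Γ Λ σ)) (v : σ) : SimState m :=
  if h : o ∈ TM2.stmts m Finset.univ then (⟨o, h⟩, v) else (⟨none, none_mem_stmts⟩, v)

variable {m k₀}

omit [DecidableEq K] in
theorem simState_of_mem {o : Option (TM2.Stmt Γ Λ σ)} (h : o ∈ TM2.stmts m Finset.univ) (v : σ) :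
    simState m o v = (⟨o, h⟩, v) := dif_pos h

/-- The symbol of the stack `k` that is represented. -/
def simDecode (k : K) : SimSymbol m k₀ → Option (Γ k)
  | .inl (⟨some (.push k' f _), _⟩, v) => if h : k' = k then some (h ▸ f v) else none
  | .inl _ => none
  | .inr g => if h : k₀ = k then some (h ▸ g) else none

variable (m k₀)

/-- The stack machine that simulates a Turing machine. -/
noncomputable def simMachine : StackMachine K (SimState m) (SimSymbol m k₀) where
  key q := match q.1.1 with
    | some (.push k _ _) => k
    | some (.peek k _ _) => k
    | some (.pop k _ _) => k
    | _ => k₀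
  next q a := match q.1.1 with
    | none => q
    | some (.push _ _ p) => simState m (some p) q.2
    | some (.peek k f p) => simState m (some p) (f q.2 (a.bind (simDecode k)))
    | some (.pop k f p) => simState m (some p) (f q.2 (a.bind (simDecode k)))
    | some (.load f p) => simState m (some p) (f q.2)
    | some (.branch f p₁ p₂) => simState m (some (cond (f q.2) p₁ p₂)) q.2
    | some (.goto f) => simState m (some (m (f q.2))) q.2
    | some .halt => simState m none q.2
  op q := match q.1.1 with
    | some (.push _ _ _) => .push (.inl q)
    | some (.pop _ _ _) => .pop
    | _ => .keep

variable {m k₀}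

/-- The stacks `S'` represent the stacks `S`. -/
def SimStacks (S : ∀ k, List (Γ k)) (S' : K → List (SimSymbol m k₀)) : Prop :=
  ∀ k, (S' k).map (simDecode k) = (S k).map some

theorem SimStacks.update {S : ∀ k, List (Γ k)} {S' : K → List (SimSymbol m k₀)}
    (h : SimStacks S S') {k : K} {l : List (Γ k)} {l' : List (SimSymbol m k₀)}
    (hl : l'.map (simDecode k) = l.map some) :
    SimStacks (Function.update S k l) (Function.update S' k l') := by
  intro k'
  by_cases hk : k' = k
  · subst hk
    simpa using hl
  · simpa [hk] using h k'

theorem SimStacks.bind_head? {S : ∀ k, List (Γ k)} {S' : K → List (SimSymbol m k₀)}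
    (h : SimStacks S S') (k : K) : (S' k).head?.bind (simDecode k) = (S k).head? := by
  have := h k
  cases h₁ : S' k <;> cases h₂ : S k <;> simp_all

theorem SimStacks.tail {S : ∀ k, List (Γ k)} {S' : K → List (SimSymbol m k₀)}
    (h : SimStacks S S') (k : K) : (S' k).tail.map (simDecode k) = (S k).tail.map some := by
  rw [List.map_tail, h k, List.map_tail]

theorem simMachine_step_keep {o : SimState m} {S' : K → List (SimSymbol m k₀)}
    (ho : (simMachine m k₀).op o = .keep) :
    (simMachine m k₀).step (o, S') =
      ((simMachine m k₀).next o (S' ((simMachine m k₀).key o)).head?, S') := by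
  simp [StackMachine.step, ho, StackOp.apply]

/-- The stack machine executes a statement in a bounded number of steps. -/
theorem exists_simulates_stmt (p : TM2.Stmt Γ Λ σ) (hp : some p ∈ TM2.stmts m Finset.univ) :
    ∃ B, ∀ (v : σ) (S : ∀ k, List (Γ k)) (S' : K → List (SimSymbol m k₀)), SimStacks S S' →
      ∃ i ≤ B, ∃ S'', (simMachine m k₀).step^[i] (simState m (some p) v, S') =
        (simState m ((TM2.stepAux p v S).l.map m) (TM2.stepAux p v S).var, S'') ∧
        SimStacks (TM2.stepAux p v S).stk S'' := by
  have hmem : ∀ q, q ∈ TM2.stmts₁ p → some q ∈ TM2.stmts m Finset.univ :=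
    fun q h => TM2.stmts_trans h hp
  induction p with
  | push k f p ih =>
    have hp' := hmem p (by simp [TM2.stmts₁, TM2.stmts₁_self])
    obtain ⟨B, hB⟩ := ih hp' fun q h => TM2.stmts_trans h hp'
    refine ⟨B + 1, fun v S S' hS => ?_⟩
    rw [simState_of_mem hp]
    obtain ⟨i, hi, S'', h, h'⟩ := hB v (Function.update S k (f v :: S k))
      (Function.update S' k (.inl (⟨_, hp⟩, v) :: S' k))
      (hS.update (by simp [simDecode, hS k]))
    exact ⟨i + 1, by omega, S'', h, h'⟩
  | peek k f p ih =>
    have hp' := hmem p (by simp [TM2.stmts₁, TM2.stmts₁_self])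
    obtain ⟨B, hB⟩ := ih hp' fun q h => TM2.stmts_trans h hp'
    refine ⟨B + 1, fun v S S' hS => ?_⟩
    rw [simState_of_mem hp]
    obtain ⟨i, hi, S'', h, h'⟩ := hB (f v (S k).head?) S S' hS
    refine ⟨i + 1, by omega, S'', ?_, h'⟩
    rw [Function.iterate_succ_apply, simMachine_step_keep rfl]
    simp only [simMachine, hS.bind_head?]
    exact h
  | pop k f p ih =>
    have hp' := hmem p (by simp [TM2.stmts₁, TM2.stmts₁_self])
    obtain ⟨B, hB⟩ := ih hp' fun q h => TM2.stmts_trans h hp'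
    refine ⟨B + 1, fun v S S' hS => ?_⟩
    rw [simState_of_mem hp]
    obtain ⟨i, hi, S'', h, h'⟩ := hB (f v (S k).head?) (Function.update S k (S k).tail)
      (Function.update S' k (S' k).tail) (hS.update (hS.tail k))
    refine ⟨i + 1, by omega, S'', ?_, h'⟩
    rw [Function.iterate_succ_apply, StackMachine.step]
    simp only [simMachine, hS.bind_head?]
    exact h
  | load f p ih =>
    have hp' := hmem p (by simp [TM2.stmts₁, TM2.stmts₁_self])
    obtain ⟨B, hB⟩ := ih hp' fun q h => TM2.stmts_trans h hp'
    refine ⟨B + 1, fun v S S' hS => ?_⟩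
    rw [simState_of_mem hp]
    obtain ⟨i, hi, S'', h, h'⟩ := hB (f v) S S' hS
    refine ⟨i + 1, by omega, S'', ?_, h'⟩
    rw [Function.iterate_succ_apply, simMachine_step_keep rfl]
    exact h
  | branch f p₁ p₂ ih₁ ih₂ =>
    have hp₁ := hmem p₁ (by simp [TM2.stmts₁, TM2.stmts₁_self])
    have hp₂ := hmem p₂ (by simp [TM2.stmts₁, TM2.stmts₁_self])
    obtain ⟨B₁, hB₁⟩ := ih₁ hp₁ fun q h => TM2.stmts_trans h hp₁
    obtain ⟨B₂, hB₂⟩ := ih₂ hp₂ fun q h => TM2.stmts_trans h hp₂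
    refine ⟨B₁ + B₂ + 1, fun v S S' hS => ?_⟩
    rw [simState_of_mem hp]
    cases hf : f v with
    | true =>
      obtain ⟨i, hi, S'', h, h'⟩ := hB₁ v S S' hS
      refine ⟨i + 1, by omega, S'', ?_, by simpa [hf] using h'⟩
      rw [Function.iterate_succ_apply, simMachine_step_keep rfl]
      simpa [simMachine, hf] using h
    | false =>
      obtain ⟨i, hi, S'', h, h'⟩ := hB₂ v S S' hS
      refine ⟨i + 1, by omega, S'', ?_, by simpa [hf] using h'⟩
      rw [Function.iterate_succ_apply, simMachine_step_keep rfl]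
      simpa [simMachine, hf] using h
  | goto f =>
    refine ⟨1, fun v S S' hS => ⟨1, le_rfl, S', ?_, hS⟩⟩
    rw [simState_of_mem hp, Function.iterate_one, simMachine_step_keep rfl]
    rfl
  | halt =>
    refine ⟨1, fun v S S' hS => ⟨1, le_rfl, S', ?_, hS⟩⟩
    rw [simState_of_mem hp, Function.iterate_one, simMachine_step_keep rfl]
    rfl

variable (m k₀) in
/-- A step of the Turing machine, which executes a whole statement, takes a bounded number of steps
of the stack machine. -/
theorem exists_simulates_step : ∃ B, ∀ (l : Λ) (v : σ) (S : ∀ k, List (Γ k))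
    (S' : K → List (SimSymbol m k₀)), SimStacks S S' →
      ∃ i ≤ B, ∃ S'', (simMachine m k₀).step^[i] (simState m (some (m l)) v, S') =
        (simState m ((TM2.stepAux (m l) v S).l.map m) (TM2.stepAux (m l) v S).var, S'') ∧
        SimStacks (TM2.stepAux (m l) v S).stk S'' := by
  choose B hB using fun l => exists_simulates_stmt (k₀ := k₀) (m l) (some_mem_stmts l)
  refine ⟨Finset.univ.sup B, fun l v S S' hS => ?_⟩
  obtain ⟨i, hi, h⟩ := hB l v S S' hS
  exact ⟨i, hi.trans (Finset.le_sup (Finset.mem_univ l)), h⟩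

/-- The simulation is iterated. In the last step the Turing machine may halt; then there is no
label. -/
theorem simulates_steps {B : ℕ} (hB : ∀ (l : Λ) (v : σ) (S : ∀ k, List (Γ k))
    (S' : K → List (SimSymbol m k₀)), SimStacks S S' →
      ∃ i ≤ B, ∃ S'', (simMachine m k₀).step^[i] (simState m (some (m l)) v, S') =
        (simState m ((TM2.stepAux (m l) v S).l.map m) (TM2.stepAux (m l) v S).var, S'') ∧
        SimStacks (TM2.stepAux (m l) v S).stk S'') (N : ℕ) (c c' : TM2.Cfg Γ Λ σ)
    (h : (flip bind (TM2.step m))^[N] (some c) = some c') (S' : K → List (SimSymbol m k₀))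
    (hS : SimStacks c.stk S') :
    ∃ i ≤ N * B, ∃ S'', (simMachine m k₀).step^[i] (simState m (c.l.map m) c.var, S') =
      (simState m (c'.l.map m) c'.var, S'') ∧ SimStacks c'.stk S'' := by
  induction N generalizing c S' with
  | zero =>
    obtain rfl : c = c' := by simpa using h
    exact ⟨0, by omega, S', rfl, hS⟩
  | succ N ih =>
    rw [Function.iterate_succ_apply] at h
    obtain ⟨_ | l, v, S⟩ := c
    · have hnone : ∀ N, (flip bind (TM2.step m))^[N] none = (none : Option (TM2.Cfg Γ Λ σ)) :=
        fun N => Function.iterate_fixed rfl N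
      change (flip bind (TM2.step m))^[N] none = some c' at h
      rw [hnone] at h
      cases h
    · obtain ⟨i, hi, S₁, h₁, h₁'⟩ := hB l v S S' hS
      obtain ⟨j, hj, S₂, h₂, h₂'⟩ := ih (TM2.stepAux (m l) v S) h S₁ h₁'
      refine ⟨j + i, by rw [Nat.succ_mul]; omega, S₂, ?_, h₂'⟩
      rw [Function.iterate_add_apply]
      exact (congrArg _ h₁).trans h₂

end Simulation

/-- A function computed by a Turing machine in polynomial time is computed by a stack machine in
polynomial time. The machine halts when it reaches a state in `halt`. Its result is then on the
stack `k₁`. -/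
theorem exists_stackMachine {Alph : Type} {n : ℕ} {f : List Alph → List (Fin n → Span)}
    (hf : Nonempty (TM2ComputableInPolyTime (id : List Alph → List Alph) encodeRelation f)) :
    ∃ (K St G : Type) (_ : DecidableEq K) (_ : Finite K) (_ : Finite St) (_ : Finite G)
      (M : StackMachine K St G) (k₀ k₁ : K) (q₀ : St) (halt : Set St) (emb : Alph → G)
      (dec : G → Option OutSymbol) (p : Polynomial ℕ), ∀ s : List Alph,
      (∃ i ≤ p.eval s.length,
        (M.step^[i] (q₀, fun k => if k = k₀ then s.map emb else [])).1 ∈ halt) ∧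
      ∀ i, (M.step^[i] (q₀, fun k => if k = k₀ then s.map emb else [])).1 ∈ halt →
        ((M.step^[i] (q₀, fun k => if k = k₀ then s.map emb else [])).2 k₁).map dec =
          (encodeRelation (f s)).map some := by
  obtain ⟨⟨⟨tm, ein, eout⟩, time, hout⟩⟩ := hf
  have := tm.kFin
  have := tm.ΛFin
  have := tm.σFin
  have := tm.Γk₀Fin
  obtain ⟨B, hB⟩ := exists_simulates_step tm.m tm.k₀
  refine ⟨tm.K, SimState tm.m, SimSymbol tm.m tm.k₀, tm.kDecidableEq, inferInstance, inferInstance,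
    inferInstance, simMachine tm.m tm.k₀, tm.k₀, tm.k₁, simState tm.m (some (tm.m tm.main))
    tm.initialState, {q | q.1.1 = none}, fun a => .inr (ein.symm a),
    fun g => (simDecode tm.k₁ g).map eout, time * Polynomial.C B, fun s => ?_⟩
  obtain ⟨⟨N, hN⟩, hle⟩ := hout s
  have hinit : SimStacks (initList tm (s.map ein.symm)).stk fun k =>
      if k = tm.k₀ then s.map fun a => (.inr (ein.symm a) : SimSymbol tm.m tm.k₀) else [] := by
    intro k
    by_cases hk : k = tm.k₀
    · subst hk
      simp only [initList, if_true, List.map_map, dif_pos]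
      change _ = List.map some (s.map ein.symm)
      rw [List.map_map]
      refine List.map_congr_left fun a _ => ?_
      simp [simDecode]
    · simp [initList, hk]
  obtain ⟨i, hi, S, h, hS⟩ := simulates_steps hB N _ _ hN _ hinit
  -- A halted machine does not change any more; so its result does not depend on the number of
  -- steps.
  have hhalt : ∀ j q S, q.1.1 = none → (simMachine tm.m tm.k₀).step^[j] (q, S) = (q, S) := by
    rintro j ⟨⟨_, hq⟩, v⟩ S rfl
    refine Function.iterate_fixed ?_ j
    rw [simMachine_step_keep rfl]
    rfl
  have hnone : (simState tm.m none tm.initialState).1.1 = none := by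
    rw [simState_of_mem none_mem_stmts]
  have hres : (S tm.k₁).map (fun g => (simDecode tm.k₁ g).map eout) =
      (encodeRelation (f s)).map some := by
    have := congrArg (List.map (Option.map eout)) (hS tm.k₁)
    simpa [haltList, List.map_map, Function.comp_def] using this
  refine ⟨⟨i, hi.trans ?_, ?_⟩, fun j hj => ?_⟩
  · simpa using Nat.mul_le_mul_right B hle
  · exact (congrArg (fun c => c.1.1.1) h).trans hnone
  · have heq := hhalt i _ ((simMachine tm.m tm.k₀).step^[j] (simState tm.m (some (tm.m tm.main))
      tm.initialState, fun k => if k = tm.k₀ then s.map fun a => .inr (ein.symm a) else [])).2 hj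
    change (simMachine tm.m tm.k₀).step^[i] ((simMachine tm.m tm.k₀).step^[j] _) = _ at heq
    rw [← Function.iterate_add_apply, add_comm, Function.iterate_add_apply] at heq
    refine Eq.trans ?_ hres
    refine congrArg (a₂ := (simState tm.m none tm.initialState, S))
      (fun c : _ × (tm.K → List (SimSymbol tm.m tm.k₀)) =>
      (c.2 tm.k₁).map fun g => (simDecode tm.k₁ g).map eout) (heq.symm.trans ?_)
    exact (congrArg _ h).trans (hhalt j _ S hnone)

/-! ### Rules that describe the run of a stack machine -/

section Formulas

variable {Alph : Type}

open Simple

/-- Both variables capture the empty span at the start of the string. -/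
def Nested.first : Nested Alph := ⟨eps, eps, eps, eps, any⟩

/-- Both variables capture the empty span at the end of the string. -/
def Nested.last : Nested Alph := ⟨any, eps, eps, eps, eps⟩

/-- Both variables capture the same empty span. -/
def Nested.point : Nested Alph := ⟨any, eps, eps, eps, any⟩

/-- The variables capture a symbol and the empty span before it. -/
def Nested.letterStart : Nested Alph := ⟨any, eps, eps, anyLetter, any⟩

/-- The variables capture a symbol and the empty span after it. -/
def Nested.letterEnd : Nested Alph := ⟨any, anyLetter, eps, eps, any⟩

/-- The variables capture a span and the empty span at its start. -/
def Nested.spanStart : Nested Alph := ⟨any, eps, eps, any, any⟩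

/-- The variables capture a span and the empty span at its end. -/
def Nested.spanEnd : Nested Alph := ⟨any, any, eps, eps, any⟩

/-- The variables capture a prefix that ends with `a`, and this prefix without its last symbol. -/
def Nested.pref (a : Alph) : Nested Alph := ⟨eps, eps, any, letter a, any⟩

/-- Both variables capture the string. -/
def Nested.whole : Nested Alph := ⟨eps, eps, any, eps, eps⟩

/-- Both variables capture the string, which is empty. -/
def Nested.emptyString : Nested Alph := ⟨eps, eps, eps, eps, eps⟩

variable {s : List Alph} {σ τ : Span}

theorem Nested.holds_first : first.Holds s σ τ ↔ σ = ⟨1, 1⟩ ∧ τ = ⟨1, 1⟩ := by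
  obtain ⟨a, b⟩ := σ
  obtain ⟨a', b'⟩ := τ
  simp only [Holds, first, Matches, Span.mk.injEq]
  omega

theorem Nested.holds_last : last.Holds s σ τ ↔
    σ = ⟨s.length + 1, s.length + 1⟩ ∧ τ = ⟨s.length + 1, s.length + 1⟩ := by
  obtain ⟨a, b⟩ := σ
  obtain ⟨a', b'⟩ := τ
  simp only [Holds, last, Matches, Span.mk.injEq]
  omega

theorem Nested.holds_point : point.Holds s σ τ ↔
    ∃ a ≤ s.length, σ = ⟨a + 1, a + 1⟩ ∧ τ = ⟨a + 1, a + 1⟩ := by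
  obtain ⟨a, b⟩ := σ
  obtain ⟨a', b'⟩ := τ
  simp only [Holds, point, Matches, Span.mk.injEq]
  exact ⟨fun h => ⟨a - 1, by omega⟩, fun ⟨c, hc⟩ => by omega⟩

theorem Nested.holds_letterStart : letterStart.Holds s σ τ ↔
    ∃ a < s.length, σ = ⟨a + 1, a + 2⟩ ∧ τ = ⟨a + 1, a + 1⟩ := by
  obtain ⟨a, b⟩ := σ
  obtain ⟨a', b'⟩ := τ
  simp only [Holds, letterStart, Matches, Span.mk.injEq]
  exact ⟨fun h => ⟨a - 1, by omega⟩, fun ⟨c, hc⟩ => by omega⟩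

theorem Nested.holds_letterEnd : letterEnd.Holds s σ τ ↔
    ∃ a < s.length, σ = ⟨a + 1, a + 2⟩ ∧ τ = ⟨a + 2, a + 2⟩ := by
  obtain ⟨a, b⟩ := σ
  obtain ⟨a', b'⟩ := τ
  simp only [Holds, letterEnd, Matches, Span.mk.injEq]
  exact ⟨fun h => ⟨a - 1, by omega⟩, fun ⟨c, hc⟩ => by omega⟩

theorem Nested.holds_spanStart : spanStart.Holds s σ τ ↔
    ∃ i j, i ≤ j ∧ j ≤ s.length ∧ σ = ⟨i + 1, j + 1⟩ ∧ τ = ⟨i + 1, i + 1⟩ := by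
  obtain ⟨a, b⟩ := σ
  obtain ⟨a', b'⟩ := τ
  simp only [Holds, spanStart, Matches, Span.mk.injEq]
  exact ⟨fun h => ⟨a - 1, b - 1, by omega⟩, fun ⟨i, j, hc⟩ => by omega⟩

theorem Nested.holds_spanEnd : spanEnd.Holds s σ τ ↔
    ∃ i j, i ≤ j ∧ j ≤ s.length ∧ σ = ⟨i + 1, j + 1⟩ ∧ τ = ⟨j + 1, j + 1⟩ := by
  obtain ⟨a, b⟩ := σ
  obtain ⟨a', b'⟩ := τ
  simp only [Holds, spanEnd, Matches, Span.mk.injEq]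
  exact ⟨fun h => ⟨a - 1, b - 1, by omega⟩, fun ⟨i, j, hc⟩ => by omega⟩

theorem Nested.holds_pref {a : Alph} : (pref a).Holds s σ τ ↔
    ∃ i, s[i]? = some a ∧ σ = ⟨1, i + 2⟩ ∧ τ = ⟨1, i + 1⟩ := by
  obtain ⟨b, c⟩ := σ
  obtain ⟨b', c'⟩ := τ
  simp only [Holds, pref, Matches, Span.mk.injEq]
  constructor
  · rintro ⟨h₁, h₂, h₃, ⟨h₄, h, h₅⟩, h₆⟩
    exact ⟨c' - 1, h, by omega⟩
  · rintro ⟨i, h, h₁, h₂⟩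
    have := (List.getElem?_eq_some_iff.mp h).1
    refine ⟨by omega, by omega, by omega, ⟨by omega, ?_, by omega⟩, by omega⟩
    rwa [h₂.2]

theorem Nested.holds_whole : whole.Holds s σ τ ↔
    σ = ⟨1, s.length + 1⟩ ∧ τ = ⟨1, s.length + 1⟩ := by
  obtain ⟨a, b⟩ := σ
  obtain ⟨a', b'⟩ := τ
  simp only [Holds, whole, Matches, Span.mk.injEq]
  omega

theorem Nested.holds_emptyString : emptyString.Holds s σ τ ↔
    s = [] ∧ σ = ⟨1, 1⟩ ∧ τ = ⟨1, 1⟩ := by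
  obtain ⟨a, b⟩ := σ
  obtain ⟨a', b'⟩ := τ
  simp only [Holds, emptyString, Matches, Span.mk.injEq, ← List.length_eq_zero_iff]
  omega

end Formulas

/-- The relation symbols. Tuples of `d` spans serve as times and as pointers to stack contents. -/
inductive SimRel (K St G : Type) : Type
  /-- the state at a time, and pointers to the stacks at this time -/
  | conf (q : St) : SimRel K St G
  /-- consecutive times -/
  | next : SimRel K St G
  /-- the top symbol of a stack (`none` if the stack is empty), and a pointer to the rest -/
  | cell (k : K) (a : Option G) : SimRel K St G
  /-- a pointer to the remaining output, at the start of a record -/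
  | start : SimRel K St G
  /-- a part of the output that consists of unary digits -/
  | ones : SimRel K St G
  /-- a part of the output that is a number -/
  | num : SimRel K St G
  /-- a part of the output that is a span -/
  | span : SimRel K St G
  /-- a record in the output -/
  | out : SimRel K St G

instance {K St G : Type} [Finite K] [Finite St] [Finite G] : Finite (SimRel K St G) := by
  let f : SimRel K St G → St ⊕ (K × Option G) ⊕ Fin 6
    | .conf q => .inl q
    | .cell k a => .inr (.inl (k, a))
    | .next => .inr (.inr 0)
    | .start => .inr (.inr 1)
    | .ones => .inr (.inr 2)
    | .num => .inr (.inr 3)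
    | .span => .inr (.inr 4)
    | .out => .inr (.inr 5)
  refine Finite.of_injective f ?_
  intro x y h
  cases x <;> cases y <;> simp_all [f]

/-- The indices of the arguments. -/
def SimRel.Args {K St G : Type} (d n : ℕ) : SimRel K St G → Type
  | conf _ => Option K × Fin d
  | next => Bool × Fin d
  | cell _ _ => Bool × Fin d
  | start => Fin d
  | ones => Option (Bool × Fin d)
  | num => Option (Bool × Fin d)
  | span => Option (Bool × Fin d)
  | out => Fin n

instance {K St G : Type} [Fintype K] {d n : ℕ} (r : SimRel K St G) : Fintype (r.Args d n) := by
  cases r <;> unfold SimRel.Args <;> infer_instance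

/-- The variables of the rules: a tuple for each stack, and further tuples and single variables. -/
abbrev SimVar (K : Type) (d : ℕ) : Type := ((K ⊕ ℕ) × Fin d) ⊕ ℕ

namespace SimVar

variable {K : Type} {d : ℕ}

/-- The variables that stand for a pointer to a stack. -/
abbrev ptr (k : K) (j : Fin d) : SimVar K d := .inl (.inl k, j)

/-- The variables of a tuple. -/
abbrev tup (m : ℕ) (j : Fin d) : SimVar K d := .inl (.inr m, j)

/-- A single variable. -/
abbrev one (m : ℕ) : SimVar K d := .inr m

/-- The assignment with the given values of pointers, tuples and single variables. -/
def assign (g : K → Fin d → Span) (U : ℕ → Fin d → Span) (X : ℕ → Span) : SimVar K d → Span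
  | .inl (.inl k, j) => g k j
  | .inl (.inr m, j) => U m j
  | .inr m => X m

end SimVar

section Args

variable {α β K : Type} {d : ℕ}

/-- The arguments of `SimRel.conf`. -/
def confArgs (t : Fin d → α) (g : K → Fin d → α) : Option K × Fin d → α
  | (none, j) => t j
  | (some k, j) => g k j

/-- Two tuples as arguments. -/
def pairArgs (u w : Fin d → α) : Bool × Fin d → α
  | (false, j) => u j
  | (true, j) => w j

/-- A single argument and two tuples. -/
def spanArgs (x : α) (u w : Fin d → α) : Option (Bool × Fin d) → α
  | none => x
  | some p => pairArgs u w p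

theorem comp_confArgs (ν : α → β) (t : Fin d → α) (g : K → Fin d → α) :
    (fun i => ν (confArgs t g i)) = confArgs (fun j => ν (t j)) fun k j => ν (g k j) := by
  funext i
  rcases i with ⟨_ | _, _⟩ <;> rfl

theorem comp_pairArgs (ν : α → β) (u w : Fin d → α) :
    (fun i => ν (pairArgs u w i)) = pairArgs (fun j => ν (u j)) fun j => ν (w j) := by
  funext i
  rcases i with ⟨_ | _, _⟩ <;> rfl

theorem comp_spanArgs (ν : α → β) (x : α) (u w : Fin d → α) :
    (fun i => ν (spanArgs x u w i)) = spanArgs (ν x) (fun j => ν (u j)) fun j => ν (w j) := by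
  funext i
  rcases i with _ | ⟨_ | _, _⟩ <;> rfl

/-- The pointer to a stack after an operation, given the previous pointer, a pointer to the
previous contents without the top symbol, and the time after the operation. -/
def StackOp.pointer {G : Type} (o : StackOp G) (u w t : α) : α :=
  match o with
  | keep => u
  | pop => w
  | push _ => t

end Args

section Rules

variable (Alph : Type) {K St G : Type} [DecidableEq K] (M : StackMachine K St G) (k₀ k₁ : K)
  (d n : ℕ)

open SimVar Nested

variable (K St G) in
/-- Rules over the symbols in `SimRel`. -/
abbrev SimRule : Type := FamRule Alph (SimRel K St G) (SimRel.Args d n) (SimVar K d)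

variable (K G) in
/-- Initially, each pointer is the initial time. -/
def initRule (q₀ : St) : SimRule Alph K St G d n where
  head := ⟨.conf q₀, confArgs (tup 0) fun _ => tup 0⟩
  body := []
  regexes := (List.finRange d).map fun j => (first, tup 0 j, one 0)
  ne := by simp
  safe := by
    rintro ⟨_ | k, j⟩ <;>
    exact .inr ⟨(first, tup 0 j, one 0), List.mem_map.mpr ⟨j, List.mem_finRange j, rfl⟩, .inl rfl⟩

variable (St G) in
/-- At the initial time, the stack `k` is empty. -/
def emptyRule (k : K) : SimRule Alph K St G d n where
  head := ⟨.cell k none, pairArgs (tup 0) (tup 0)⟩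
  body := []
  regexes := (List.finRange d).map fun j => (first, tup 0 j, one 0)
  ne := by simp
  safe := by
    rintro ⟨_ | _, j⟩ <;>
    exact .inr ⟨(first, tup 0 j, one 0), List.mem_map.mpr ⟨j, List.mem_finRange j, rfl⟩, .inl rfl⟩

variable {Alph} (St) in
/-- The prefixes of the string serve as pointers to the remaining input. -/
def inputRule (a : Alph) (g : G) : SimRule Alph K St G d n where
  head := ⟨.cell k₀ (some g), pairArgs (fun _ => one 0) fun _ => one 1⟩
  body := []
  regexes := [(pref a, one 1, one 0)]
  ne := by simp
  safe := by
    rintro ⟨_ | _, j⟩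
    · exact .inr ⟨_, List.mem_singleton_self _, .inr rfl⟩
    · exact .inr ⟨_, List.mem_singleton_self _, .inl rfl⟩

variable (St G) in
/-- The whole string is a pointer to the end of the input. -/
def inputEndRule : SimRule Alph K St G d n where
  head := ⟨.cell k₀ none, pairArgs (fun _ => one 0) fun _ => one 0⟩
  body := []
  regexes := [(whole, one 0, one 1)]
  ne := by simp
  safe := by
    rintro ⟨_ | _, j⟩ <;> exact .inr ⟨_, List.mem_singleton_self _, .inl rfl⟩

/-- The conditions on the digit `i` of two consecutive times that differ up to the digit `j`. -/
def nextRegexes (j i : Fin d) : List (Nested Alph × SimVar K d × SimVar K d) :=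
  if i < j then [(last, tup 0 i, tup 2 i), (first, tup 1 i, tup 3 i)]
  else if i = j then [(letterStart, one 0, tup 0 i), (letterEnd, one 0, tup 1 i)]
  else [(point, tup 0 i, tup 2 i)]

variable (K St G) in
/-- Times are numbers, least significant digit first. The digit `j` is incremented if all previous
digits are maximal. -/
def nextRule (j : Fin d) : SimRule Alph K St G d n where
  head := ⟨.next, pairArgs (tup 0) fun i => if i ≤ j then tup 1 i else tup 0 i⟩
  body := []
  regexes := (List.finRange d).flatMap (nextRegexes Alph d j)
  ne := by
    intro p hp
    obtain ⟨i, -, hi⟩ := List.mem_flatMap.mp hp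
    unfold nextRegexes at hi
    split_ifs at hi <;> simp at hi
    · rcases hi with rfl | rfl <;> simp
    · rcases hi with rfl | rfl <;> simp
    · subst hi
      simp
  safe := by
    have key : ∀ i p, p ∈ nextRegexes Alph d j i → p ∈
        (List.finRange d).flatMap (nextRegexes (K := K) Alph d j) :=
      fun i p hp => List.mem_flatMap.mpr ⟨i, List.mem_finRange i, hp⟩
    have h₀ : ∀ i, ∃ p ∈ nextRegexes (K := K) Alph d j i, p.2.1 = tup 0 i ∨ p.2.2 = tup 0 i := by
      intro i
      unfold nextRegexes
      split_ifs <;> simp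
    rintro ⟨_ | _, i⟩
    · obtain ⟨p, hp, h⟩ := h₀ i
      exact .inr ⟨p, key i p hp, h⟩
    · by_cases hi : i ≤ j
      · have : ∃ p ∈ nextRegexes (K := K) Alph d j i, p.2.1 = tup 1 i ∨ p.2.2 = tup 1 i := by
          unfold nextRegexes
          rcases hi.lt_or_eq with h | h
          · simp [h]
          · simp [h]
        obtain ⟨p, hp, h⟩ := this
        refine .inr ⟨p, key i p hp, ?_⟩
        simpa [pairArgs, hi] using h
      · obtain ⟨p, hp, h⟩ := h₀ i
        refine .inr ⟨p, key i p hp, ?_⟩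
        simpa [pairArgs, hi] using h

/-- The atoms that describe a step from the state `q` with the top symbol `a`. -/
def stepBody (q : St) (a : Option G) :
    List (FamAtom (SimRel K St G) (SimRel.Args d n) (SimVar K d)) :=
  [⟨.conf q, confArgs (tup 0) ptr⟩, ⟨.cell (M.key q) a, pairArgs (ptr (M.key q)) (tup 1)⟩,
    ⟨.next, pairArgs (tup 0) (tup 2)⟩]

/-- A step of the machine. -/
def stepRule (q : St) (a : Option G) : SimRule Alph K St G d n where
  head := ⟨.conf (M.next q a), confArgs (tup 2) (Function.update ptr (M.key q)
    ((M.op q).pointer (ptr (M.key q)) (tup 1) (tup 2)))⟩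
  body := stepBody M d n q a
  regexes := []
  ne := by simp
  safe := by
    have h₀ : ∀ j, ∃ b ∈ stepBody M d n q a, ∃ i, b.args i = tup 2 j := fun j =>
      ⟨⟨.next, pairArgs (tup 0) (tup 2)⟩, by simp [stepBody], (true, j), rfl⟩
    have h₁ : ∀ k j, ∃ b ∈ stepBody M d n q a, ∃ i, b.args i = ptr k j := fun k j =>
      ⟨⟨.conf q, confArgs (tup 0) ptr⟩, by simp [stepBody], (some k, j), rfl⟩
    have h₂ : ∀ j, ∃ b ∈ stepBody M d n q a, ∃ i, b.args i = tup 1 j := fun j =>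
      ⟨⟨.cell (M.key q) a, pairArgs (ptr (M.key q)) (tup 1)⟩, by simp [stepBody], (true, j), rfl⟩
    rintro ⟨_ | k, j⟩
    · exact .inl (h₀ j)
    · by_cases hk : k = M.key q
      · subst hk
        cases ho : M.op q with
        | keep => simpa [confArgs, ho, StackOp.pointer] using (h₁ (M.key q) j)
        | pop => simpa [confArgs, ho, StackOp.pointer] using (h₂ j)
        | push g => simpa [confArgs, ho, StackOp.pointer] using (h₀ j)
      · simpa [confArgs, hk] using (h₁ k j)

/-- The time after a push operation is a pointer to the new contents. -/
def pushRule (q : St) (a : Option G) (g : G) : SimRule Alph K St G d n where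
  head := ⟨.cell (M.key q) (some g), pairArgs (tup 2) (ptr (M.key q))⟩
  body := stepBody M d n q a
  regexes := []
  ne := by simp
  safe := by
    rintro ⟨_ | _, j⟩
    · exact .inl ⟨⟨.next, pairArgs (tup 0) (tup 2)⟩, by simp [stepBody], (true, j), rfl⟩
    · exact .inl ⟨⟨.conf q, confArgs (tup 0) ptr⟩, by simp [stepBody], (some _, j), rfl⟩

variable (G) in
/-- In the halting state `q`, the output is on the stack `k₁`. -/
def startRule (q : St) : SimRule Alph K St G d n where
  head := ⟨.start, ptr k₁⟩
  body := [⟨.conf q, confArgs (tup 0) ptr⟩]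
  regexes := []
  ne := by simp
  safe := fun j => .inl ⟨_, List.mem_singleton_self _, (some k₁, j), rfl⟩

variable (St) in
/-- The atoms that describe a record in the output, followed by the symbol `g`. -/
def recordBody (g : G) : List (FamAtom (SimRel K St G) (SimRel.Args d n) (SimVar K d)) :=
  ⟨.start, tup 0⟩ :: ⟨.cell k₁ (some g), pairArgs (tup n) (tup (n + 1))⟩ ::
    (List.finRange n).map fun i : Fin n => ⟨.span, spanArgs (one i) (tup i) (tup (i + 1))⟩

variable (St) in
/-- A record is followed by another one. -/
def nextStartRule (g : G) : SimRule Alph K St G d n where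
  head := ⟨.start, tup (n + 1)⟩
  body := recordBody St k₁ d n g
  regexes := []
  ne := by simp
  safe := fun j => .inl ⟨⟨.cell k₁ (some g), pairArgs (tup n) (tup (n + 1))⟩, by simp [recordBody],
    (true, j), rfl⟩

variable (St) in
/-- A record is in the result. -/
def outRule (g : G) : SimRule Alph K St G d n where
  head := ⟨.out, fun i : Fin n => one i⟩
  body := recordBody St k₁ d n g
  regexes := []
  ne := by simp
  safe := fun i : Fin n => .inl ⟨⟨.span, spanArgs (one i) (tup i) (tup (i + 1))⟩,
    by simp [recordBody], none, rfl⟩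

variable (St) in
/-- The number `1` in unary notation. -/
def onesFirstRule (g : G) : SimRule Alph K St G d n where
  head := ⟨.ones, spanArgs (one 0) (tup 0) (tup 1)⟩
  body := [⟨.cell k₁ (some g), pairArgs (tup 0) (tup 1)⟩]
  regexes := [(first, one 0, one 1)]
  ne := by simp
  safe := by
    rintro (_ | p)
    · exact .inr ⟨_, List.mem_singleton_self _, .inl rfl⟩
    · exact .inl ⟨_, List.mem_singleton_self _, p, rfl⟩

variable (St) in
/-- Another unary digit. -/
def onesNextRule (g : G) : SimRule Alph K St G d n where
  head := ⟨.ones, spanArgs (one 1) (tup 0) (tup 2)⟩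
  body := [⟨.ones, spanArgs (one 0) (tup 1) (tup 2)⟩,
    ⟨.cell k₁ (some g), pairArgs (tup 0) (tup 1)⟩]
  regexes := [(letterStart, one 2, one 0), (letterEnd, one 2, one 1)]
  ne := by simp
  safe := by
    rintro (_ | ⟨_ | _, j⟩)
    · exact .inr ⟨_, List.mem_cons_of_mem _ (List.mem_singleton_self _), .inr rfl⟩
    · exact .inl ⟨_, List.mem_cons_of_mem _ (List.mem_singleton_self _), (false, j), rfl⟩
    · exact .inl ⟨_, List.mem_cons_self, some (true, j), rfl⟩

variable (St) in
/-- Unary digits and a separator. -/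
def numRule (g : G) : SimRule Alph K St G d n where
  head := ⟨.num, spanArgs (one 0) (tup 0) (tup 2)⟩
  body := [⟨.ones, spanArgs (one 0) (tup 0) (tup 1)⟩,
    ⟨.cell k₁ (some g), pairArgs (tup 1) (tup 2)⟩]
  regexes := []
  ne := by simp
  safe := by
    rintro (_ | ⟨_ | _, j⟩)
    · exact .inl ⟨_, List.mem_cons_self, none, rfl⟩
    · exact .inl ⟨_, List.mem_cons_self, some (false, j), rfl⟩
    · exact .inl ⟨_, List.mem_cons_of_mem _ (List.mem_singleton_self _), (true, j), rfl⟩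

variable (K St G) in
/-- The two positions of a span. -/
def spanRule : SimRule Alph K St G d n where
  head := ⟨.span, spanArgs (one 2) (tup 0) (tup 2)⟩
  body := [⟨.num, spanArgs (one 0) (tup 0) (tup 1)⟩, ⟨.num, spanArgs (one 1) (tup 1) (tup 2)⟩]
  regexes := [(spanStart, one 2, one 0), (spanEnd, one 2, one 1)]
  ne := by simp
  safe := by
    rintro (_ | ⟨_ | _, j⟩)
    · exact .inr ⟨_, List.mem_cons_self, .inl rfl⟩
    · exact .inl ⟨_, List.mem_cons_self, some (false, j), rfl⟩
    · exact .inl ⟨_, List.mem_cons_of_mem _ (List.mem_singleton_self _), some (true, j), rfl⟩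

variable (K St G) in
/-- The only possible record on the empty string. -/
def emptyStringRule : SimRule Alph K St G d n where
  head := ⟨.out, fun _ => one 0⟩
  body := []
  regexes := [(emptyString, one 0, one 1)]
  ne := by simp
  safe := fun _ => .inr ⟨_, List.mem_singleton_self _, .inl rfl⟩

end Rules

/-! ### Databases that are closed under the rules -/

section Closed

open SimVar Nested

/-- A database over the symbols in `SimRel`, as a family of predicates. -/
structure SimDb (K St G : Type) (d n : ℕ) where
  conf : St → (Fin d → Span) → (K → Fin d → Span) → Prop
  next : (Fin d → Span) → (Fin d → Span) → Prop
  cell : K → Option G → (Fin d → Span) → (Fin d → Span) → Prop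
  start : (Fin d → Span) → Prop
  ones : Span → (Fin d → Span) → (Fin d → Span) → Prop
  num : Span → (Fin d → Span) → (Fin d → Span) → Prop
  span : Span → (Fin d → Span) → (Fin d → Span) → Prop
  out : (Fin n → Span) → Prop

variable {K St G : Type} {d n : ℕ}

/-- The predicates as relations. -/
def SimDb.toRel (D : SimDb K St G d n) : ∀ r : SimRel K St G, (r.Args d n → Span) → Prop
  | .conf q, (x : Option K × Fin d → Span) =>
    D.conf q (fun j => x (none, j)) fun k j => x (some k, j)
  | .next, (x : Bool × Fin d → Span) => D.next (fun j => x (false, j)) fun j => x (true, j)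
  | .cell k a, (x : Bool × Fin d → Span) =>
    D.cell k a (fun j => x (false, j)) fun j => x (true, j)
  | .start, x => D.start x
  | .ones, (x : Option (Bool × Fin d) → Span) =>
    D.ones (x none) (fun j => x (some (false, j))) fun j => x (some (true, j))
  | .num, (x : Option (Bool × Fin d) → Span) =>
    D.num (x none) (fun j => x (some (false, j))) fun j => x (some (true, j))
  | .span, (x : Option (Bool × Fin d) → Span) =>
    D.span (x none) (fun j => x (some (false, j))) fun j => x (some (true, j))
  | .out, x => D.out x

/-- Relations as predicates. -/
def SimDb.ofRel (E : ∀ r : SimRel K St G, (r.Args d n → Span) → Prop) : SimDb K St G d n where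
  conf q t g := E (.conf q) (confArgs t g)
  next t t' := E .next (pairArgs t t')
  cell k a u w := E (.cell k a) (pairArgs u w)
  start u := E .start u
  ones x u w := E .ones (spanArgs x u w)
  num x u w := E .num (spanArgs x u w)
  span x u w := E .span (spanArgs x u w)
  out x := E .out x

/-- The tuple of empty spans at the given positions. -/
def pointTuple (a : Fin d → ℕ) (i : Fin d) : Span := ⟨a i + 1, a i + 1⟩

/-- The tuple of prefixes of length `i`. -/
def prefixTuple (i : ℕ) (_ : Fin d) : Span := ⟨1, i + 1⟩

variable {Alph : Type} [DecidableEq K] (M : StackMachine K St G) (k₀ k₁ : K) (q₀ : St)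
  (halt : Set St) (emb : Alph → G) (dec : G → Option OutSymbol) (B : Prop)

/-- The database is closed under the rules. The proposition `B` tells whether there is a record on
the empty string. -/
structure SimDb.Closed (s : List Alph) (D : SimDb K St G d n) : Prop where
  init : D.conf q₀ (prefixTuple 0) fun _ => prefixTuple 0
  empty : ∀ k ≠ k₀, D.cell k none (prefixTuple 0) (prefixTuple 0)
  input : ∀ i a, s[i]? = some a → D.cell k₀ (some (emb a)) (prefixTuple i) (prefixTuple (i + 1))
  inputEnd : D.cell k₀ none (prefixTuple s.length) (prefixTuple s.length)
  next : ∀ (j : Fin d) (a a' : Fin d → ℕ), (∀ i < j, a i = s.length ∧ a' i = 0) →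
    a' j = a j + 1 → a j < s.length → (∀ i > j, a' i = a i ∧ a i ≤ s.length) →
    D.next (pointTuple a) (pointTuple a')
  step : ∀ q a t g w t', D.conf q t g → D.cell (M.key q) a (g (M.key q)) w → D.next t t' →
    D.conf (M.next q a) t' (Function.update g (M.key q) ((M.op q).pointer (g (M.key q)) w t'))
  push : ∀ q a b t g w t', M.op q = .push b → D.conf q t g →
    D.cell (M.key q) a (g (M.key q)) w → D.next t t' → D.cell (M.key q) (some b) t' (g (M.key q))
  start : ∀ q t g, q ∈ halt → D.conf q t g → D.start (g k₁)
  record : ∀ b (x : Fin n → Span) (u : ℕ → Fin d → Span), dec b = some .mark → D.start (u 0) →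
    (∀ i : Fin n, D.span (x i) (u i) (u (i + 1))) → D.cell k₁ (some b) (u n) (u (n + 1)) →
    D.start (u (n + 1)) ∧ D.out x
  onesFirst : ∀ b u w, dec b = some .one → D.cell k₁ (some b) u w → D.ones ⟨1, 1⟩ u w
  onesNext : ∀ b i u v w, dec b = some .one → i < s.length → D.ones ⟨i + 1, i + 1⟩ v w →
    D.cell k₁ (some b) u v → D.ones ⟨i + 2, i + 2⟩ u w
  num : ∀ b x u v w, dec b = some .sep → D.ones x u v → D.cell k₁ (some b) v w → D.num x u w
  span : ∀ i j u v w, i ≤ j → j ≤ s.length → D.num ⟨i + 1, i + 1⟩ u v →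
    D.num ⟨j + 1, j + 1⟩ v w → D.span ⟨i + 1, j + 1⟩ u w
  emptyString : B → s = [] → D.out fun _ => ⟨1, 1⟩

/-- The rules of the simulation. -/
inductive IsSimRule : SimRule Alph K St G d n → Prop
  | init : IsSimRule (initRule Alph K G d n q₀)
  | empty (k : K) (h : k ≠ k₀) : IsSimRule (emptyRule Alph St G d n k)
  | input (a : Alph) : IsSimRule (inputRule St k₀ d n a (emb a))
  | inputEnd : IsSimRule (inputEndRule Alph St G k₀ d n)
  | next (j : Fin d) : IsSimRule (nextRule Alph K St G d n j)
  | step (q : St) (a : Option G) : IsSimRule (stepRule Alph M d n q a)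
  | push (q : St) (a : Option G) (b : G) (h : M.op q = .push b) :
    IsSimRule (pushRule Alph M d n q a b)
  | start (q : St) (h : q ∈ halt) : IsSimRule (startRule Alph G k₁ d n q)
  | nextStart (b : G) (h : dec b = some .mark) : IsSimRule (nextStartRule Alph St k₁ d n b)
  | out (b : G) (h : dec b = some .mark) : IsSimRule (outRule Alph St k₁ d n b)
  | onesFirst (b : G) (h : dec b = some .one) : IsSimRule (onesFirstRule Alph St k₁ d n b)
  | onesNext (b : G) (h : dec b = some .one) : IsSimRule (onesNextRule Alph St k₁ d n b)
  | num (b : G) (h : dec b = some .sep) : IsSimRule (numRule Alph St k₁ d n b)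
  | span : IsSimRule (spanRule Alph K St G d n)
  | emptyString (h : B) : IsSimRule (emptyStringRule Alph K St G d n)

/-- The set of the rules of the simulation. -/
def simRules : Set (SimRule Alph K St G d n) :=
  {ρ | IsSimRule M k₀ k₁ q₀ halt emb dec B ρ}

theorem finite_simRules [Finite K] [Finite St] [Finite G] [Finite Alph] :
    (simRules (d := d) (n := n) M k₀ k₁ q₀ halt emb dec B).Finite := by
  refine Set.Finite.subset (s := {initRule Alph K G d n q₀, inputEndRule Alph St G k₀ d n,
    spanRule Alph K St G d n, emptyStringRule Alph K St G d n} ∪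
    (Set.range (emptyRule Alph St G d n) ∪
    (Set.range (fun a : Alph => inputRule St k₀ d n a (emb a)) ∪
    (Set.range (nextRule Alph K St G d n) ∪
    (Set.range (fun p : St × Option G => stepRule Alph M d n p.1 p.2) ∪
    (Set.range (fun p : St × Option G × G => pushRule Alph M d n p.1 p.2.1 p.2.2) ∪
    (Set.range (startRule Alph G k₁ d n) ∪
    (Set.range (nextStartRule Alph St k₁ d n) ∪
    (Set.range (outRule Alph St k₁ d n) ∪
    (Set.range (onesFirstRule Alph St k₁ d n) ∪
    (Set.range (onesNextRule Alph St k₁ d n) ∪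
    Set.range (numRule Alph St k₁ d n))))))))))))
    ?_ ?_
  · exact (Set.toFinite _).union ((Set.finite_range _).union ((Set.finite_range _).union
      ((Set.finite_range _).union ((Set.finite_range _).union ((Set.finite_range _).union
      ((Set.finite_range _).union ((Set.finite_range _).union ((Set.finite_range _).union
      ((Set.finite_range _).union ((Set.finite_range _).union (Set.finite_range _)))))))))))
  · intro ρ hρ
    cases hρ with
    | step q a =>
      exact .inr (.inr (.inr (.inr (.inl ⟨(q, a), rfl⟩))))
    | push q a b h =>
      exact .inr (.inr (.inr (.inr (.inr (.inl ⟨(q, a, b), rfl⟩)))))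
    | _ => simp

variable {M k₀ k₁ q₀ halt emb dec B} {s : List Alph}

/-- A closed database satisfies the rules. -/
theorem SimDb.Closed.famModel {D : SimDb K St G d n}
    (hD : D.Closed M k₀ k₁ q₀ halt emb dec B s) :
    FamModel (simRules M k₀ k₁ q₀ halt emb dec B) s D.toRel := by
  rintro ρ hρ ν ⟨hb, hr⟩
  cases hρ with
  | init =>
    have h : ∀ j, ν (tup 0 j) = ⟨1, 1⟩ := fun j => (holds_first.mp
      (hr _ (List.mem_map.mpr ⟨j, List.mem_finRange j, rfl⟩))).1
    change D.conf q₀ (fun j => ν (tup 0 j)) fun _ j => ν (tup 0 j)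
    simp only [h]
    exact hD.init
  | empty k hk =>
    have h : ∀ j, ν (tup 0 j) = ⟨1, 1⟩ := fun j => (holds_first.mp
      (hr _ (List.mem_map.mpr ⟨j, List.mem_finRange j, rfl⟩))).1
    change D.cell k none (fun j => ν (tup 0 j)) fun j => ν (tup 0 j)
    simp only [h]
    exact hD.empty k hk
  | input a =>
    obtain ⟨i, hi, h₁, h₂⟩ := holds_pref.mp (hr _ (List.mem_singleton_self _))
    change D.cell k₀ (some (emb a)) (fun _ => ν (one 0)) fun _ => ν (one 1)
    rw [h₁, h₂]
    exact hD.input i a hi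
  | inputEnd =>
    obtain ⟨h₁, -⟩ := holds_whole.mp (hr _ (List.mem_singleton_self _))
    change D.cell k₀ none (fun _ => ν (one 0)) fun _ => ν (one 0)
    rw [h₁]
    exact hD.inputEnd
  | next j =>
    have hr' : ∀ i, ∀ p ∈ nextRegexes Alph d j i, p.1.Holds s (ν p.2.1) (ν p.2.2) :=
      fun i p hp => hr p (List.mem_flatMap.mpr ⟨i, List.mem_finRange i, hp⟩)
    have h₁ : ∀ i < j, ν (tup 0 i) = ⟨s.length + 1, s.length + 1⟩ ∧ ν (tup 1 i) = ⟨1, 1⟩ := by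
      intro i hi
      have := hr' i
      simp only [nextRegexes, if_pos hi] at this
      exact ⟨(holds_last.mp (this _ List.mem_cons_self)).1,
        (holds_first.mp (this _ (List.mem_cons_of_mem _ List.mem_cons_self))).1⟩
    have h₂ : ∃ a < s.length, ν (tup 0 j) = ⟨a + 1, a + 1⟩ ∧ ν (tup 1 j) = ⟨a + 2, a + 2⟩ := by
      have := hr' j
      simp only [nextRegexes, lt_irrefl, if_false, if_true] at this
      obtain ⟨a, ha, h, h'⟩ := holds_letterStart.mp (this _ List.mem_cons_self)
      obtain ⟨b, hb, h₃, h₄⟩ := holds_letterEnd.mp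
        (this _ (List.mem_cons_of_mem _ List.mem_cons_self))
      rw [h] at h₃
      obtain rfl : a = b := by simpa using congrArg Span.start h₃
      exact ⟨a, ha, h', h₄⟩
    have h₃ : ∀ i > j, ∃ a ≤ s.length, ν (tup 0 i) = ⟨a + 1, a + 1⟩ := by
      intro i hi
      have := hr' i
      simp only [nextRegexes, if_neg (not_lt_of_gt hi), if_neg hi.ne'] at this
      obtain ⟨a, ha, h, -⟩ := holds_point.mp (this _ List.mem_cons_self)
      exact ⟨a, ha, h⟩
    obtain ⟨b, hb, hb₀, hb₁⟩ := h₂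
    have h₄ : ∀ i, ∃ a, ν (tup 0 i) = ⟨a + 1, a + 1⟩ := by
      intro i
      rcases lt_trichotomy i j with hi | rfl | hi
      · exact ⟨_, (h₁ i hi).1⟩
      · exact ⟨b, hb₀⟩
      · obtain ⟨a, -, ha⟩ := h₃ i hi
        exact ⟨a, ha⟩
    have h₅ : ∀ i, ∃ a, ν (if i ≤ j then tup 1 i else tup 0 i) = ⟨a + 1, a + 1⟩ := by
      intro i
      rcases lt_trichotomy i j with hi | rfl | hi
      · rw [if_pos hi.le]
        exact ⟨0, (h₁ i hi).2⟩
      · rw [if_pos le_rfl]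
        exact ⟨b + 1, hb₁⟩
      · rw [if_neg (not_le_of_gt hi)]
        exact h₄ i
    choose a ha using h₄
    choose a' ha' using h₅
    change D.next (fun i => ν (tup 0 i)) fun i => ν (if i ≤ j then tup 1 i else tup 0 i)
    simp only [ha, ha']
    have haj : a j = b := by simpa [ha j] using hb₀
    refine hD.next j a a' (fun i hi => ⟨?_, ?_⟩) ?_ (haj ▸ hb) fun i hi => ?_
    · simpa [ha i] using (h₁ i hi).1
    · have := ha' i
      rw [if_pos hi.le, (h₁ i hi).2] at this
      simpa using this
    · have := ha' j
      rw [if_pos le_rfl, hb₁] at this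
      rw [haj]
      have := congrArg Span.start this
      simp only at this
      omega
    · have := ha' i
      rw [if_neg (not_le_of_gt hi), ha i] at this
      obtain ⟨c, hc, hc'⟩ := h₃ i hi
      rw [ha i] at hc'
      have h₁ := congrArg Span.start this
      have h₂ := congrArg Span.start hc'
      simp only at h₁ h₂
      omega
  | step q a =>
    have h₁ : D.conf q (fun j => ν (tup 0 j)) fun k j => ν (ptr k j) := hb _ List.mem_cons_self
    have h₂ : D.cell (M.key q) a (fun j => ν (ptr (M.key q) j)) fun j => ν (tup 1 j) :=
      hb _ (List.mem_cons_of_mem _ List.mem_cons_self)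
    have h₃ : D.next (fun j => ν (tup 0 j)) fun j => ν (tup 2 j) :=
      hb _ (List.mem_cons_of_mem _ (List.mem_cons_of_mem _ List.mem_cons_self))
    have h := hD.step q a _ _ _ _ h₁ h₂ h₃
    change D.conf (M.next q a) (fun j => ν (tup 2 j)) fun k j => ν (Function.update ptr (M.key q)
      ((M.op q).pointer (ptr (M.key q)) (tup 1) (tup 2)) k j)
    convert h using 1
    funext k j
    by_cases hk : k = M.key q
    · subst hk
      simp only [Function.update_self]
      cases M.op q <;> rfl
    · simp only [Function.update_of_ne hk]
  | push q a b h => 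
    exact hD.push q a b _ (fun k j => ν (ptr k j)) _ _ h (hb _ List.mem_cons_self)
      (hb _ (List.mem_cons_of_mem _ List.mem_cons_self))
      (hb _ (List.mem_cons_of_mem _ (List.mem_cons_of_mem _ List.mem_cons_self)))
  | start q h => exact hD.start q _ (fun k j => ν (ptr k j)) h (hb _ List.mem_cons_self)
  | nextStart b h =>
    exact (hD.record b (fun i => ν (one i)) (fun m j => ν (tup m j)) h (hb _ List.mem_cons_self)
      (fun i => hb _ (List.mem_cons_of_mem _ (List.mem_cons_of_mem _
        (List.mem_map.mpr ⟨i, List.mem_finRange i, rfl⟩))))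
      (hb _ (List.mem_cons_of_mem _ List.mem_cons_self))).1
  | out b h =>
    exact (hD.record b (fun i => ν (one i)) (fun m j => ν (tup m j)) h (hb _ List.mem_cons_self)
      (fun i => hb _ (List.mem_cons_of_mem _ (List.mem_cons_of_mem _
        (List.mem_map.mpr ⟨i, List.mem_finRange i, rfl⟩))))
      (hb _ (List.mem_cons_of_mem _ List.mem_cons_self))).2
  | onesFirst b h =>
    obtain ⟨h₁, -⟩ := holds_first.mp (hr _ (List.mem_singleton_self _))
    change D.ones (ν (one 0)) (fun j => ν (tup 0 j)) fun j => ν (tup 1 j)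
    rw [h₁]
    exact hD.onesFirst b _ _ h (hb _ List.mem_cons_self)
  | onesNext b h =>
    obtain ⟨i, hi, h₁, h₂⟩ := holds_letterStart.mp (hr _ List.mem_cons_self)
    obtain ⟨i', -, h₃, h₄⟩ := holds_letterEnd.mp
      (hr _ (List.mem_cons_of_mem _ List.mem_cons_self))
    rw [h₁] at h₃
    obtain rfl : i = i' := by simpa using congrArg Span.start h₃
    change D.ones (ν (one 1)) (fun j => ν (tup 0 j)) fun j => ν (tup 2 j)
    rw [h₄]
    have h₅ : D.ones (ν (one 0)) (fun j => ν (tup 1 j)) fun j => ν (tup 2 j) :=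
      hb _ List.mem_cons_self
    rw [h₂] at h₅
    exact hD.onesNext b i _ _ _ h hi h₅ (hb _ (List.mem_cons_of_mem _ List.mem_cons_self))
  | num b h =>
    exact hD.num b (ν (one 0)) _ _ _ h (hb _ List.mem_cons_self)
      (hb _ (List.mem_cons_of_mem _ List.mem_cons_self))
  | span =>
    obtain ⟨i, j, hij, hj, h₁, h₂⟩ := holds_spanStart.mp (hr _ List.mem_cons_self)
    obtain ⟨i', j', -, -, h₃, h₄⟩ := holds_spanEnd.mp
      (hr _ (List.mem_cons_of_mem _ List.mem_cons_self))
    rw [h₁] at h₃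
    obtain rfl : j = j' := by simpa using congrArg Span.finish h₃
    have h₅ : D.num (ν (one 0)) (fun j => ν (tup 0 j)) fun j => ν (tup 1 j) :=
      hb _ List.mem_cons_self
    have h₆ : D.num (ν (one 1)) (fun j => ν (tup 1 j)) fun j => ν (tup 2 j) :=
      hb _ (List.mem_cons_of_mem _ List.mem_cons_self)
    change D.span (ν (one 2)) (fun j => ν (tup 0 j)) fun j => ν (tup 2 j)
    rw [h₂] at h₅
    rw [h₄] at h₆
    rw [h₁]
    exact hD.span i j _ _ _ hij hj h₅ h₆
  | emptyString h =>
    obtain ⟨hs, h₁, -⟩ := holds_emptyString.mp (hr _ (List.mem_singleton_self _))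
    change D.out fun _ => ν (one 0)
    rw [h₁]
    exact hD.emptyString h hs

end Closed

section Minimal

open SimVar Nested

variable {K St G : Type} {d n : ℕ} {Alph : Type} [DecidableEq K] {M : StackMachine K St G}
  {k₀ k₁ : K} {q₀ : St} {halt : Set St} {emb : Alph → G} {dec : G → Option OutSymbol} {B : Prop}
  {s : List Alph} {E : ∀ r : SimRel K St G, (r.Args d n → Span) → Prop}

omit [DecidableEq K] in
theorem ofRel_conf {q : St} {ν : SimVar K d → Span} {t : Fin d → SimVar K d}
    {g : K → Fin d → SimVar K d} : E (.conf q) (fun i => ν (confArgs t g i)) ↔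
      (SimDb.ofRel E).conf q (fun j => ν (t j)) fun k j => ν (g k j) :=
  iff_of_eq (congrArg (E (.conf q)) (comp_confArgs ν t g))

omit [DecidableEq K] in
theorem ofRel_next {ν : SimVar K d → Span} {u w : Fin d → SimVar K d} :
    E .next (fun i => ν (pairArgs u w i)) ↔
      (SimDb.ofRel E).next (fun j => ν (u j)) fun j => ν (w j) :=
  iff_of_eq (congrArg (E .next) (comp_pairArgs ν u w))

omit [DecidableEq K] in
theorem ofRel_cell {k : K} {a : Option G} {ν : SimVar K d → Span} {u w : Fin d → SimVar K d} :
    E (.cell k a) (fun i => ν (pairArgs u w i)) ↔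
      (SimDb.ofRel E).cell k a (fun j => ν (u j)) fun j => ν (w j) :=
  iff_of_eq (congrArg (E (.cell k a)) (comp_pairArgs ν u w))

omit [DecidableEq K] in
theorem ofRel_ones {ν : SimVar K d → Span} {x : SimVar K d} {u w : Fin d → SimVar K d} :
    E .ones (fun i => ν (spanArgs x u w i)) ↔
      (SimDb.ofRel E).ones (ν x) (fun j => ν (u j)) fun j => ν (w j) :=
  iff_of_eq (congrArg (E .ones) (comp_spanArgs ν x u w))

omit [DecidableEq K] in
theorem ofRel_num {ν : SimVar K d → Span} {x : SimVar K d} {u w : Fin d → SimVar K d} :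
    E .num (fun i => ν (spanArgs x u w i)) ↔
      (SimDb.ofRel E).num (ν x) (fun j => ν (u j)) fun j => ν (w j) :=
  iff_of_eq (congrArg (E .num) (comp_spanArgs ν x u w))

omit [DecidableEq K] in
theorem ofRel_span {ν : SimVar K d → Span} {x : SimVar K d} {u w : Fin d → SimVar K d} :
    E .span (fun i => ν (spanArgs x u w i)) ↔
      (SimDb.ofRel E).span (ν x) (fun j => ν (u j)) fun j => ν (w j) :=
  iff_of_eq (congrArg (E .span) (comp_spanArgs ν x u w))

/-- A database that satisfies the rules is closed. -/
theorem closed_ofRel (hE : FamModel (simRules M k₀ k₁ q₀ halt emb dec B) s E) :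
    (SimDb.ofRel E).Closed M k₀ k₁ q₀ halt emb dec B s := by
  have hstep : ∀ q a t g w t', (SimDb.ofRel E).conf q t g →
      (SimDb.ofRel E).cell (M.key q) a (g (M.key q)) w → (SimDb.ofRel E).next t t' →
      ∀ b ∈ stepBody M d n q a, E b.rel fun i => assign g
        (fun | 0 => t | 1 => w | _ => t') (fun _ => ⟨1, 1⟩) (b.args i) := by
    intro q a t g w t' h₁ h₂ h₃ b hb
    simp only [stepBody, List.mem_cons, List.not_mem_nil, or_false] at hb
    rcases hb with rfl | rfl | rfl
    · exact ofRel_conf.mpr h₁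
    · exact ofRel_cell.mpr h₂
    · exact ofRel_next.mpr h₃
  have hrecord : ∀ b (x : Fin n → Span) (u : ℕ → Fin d → Span), (SimDb.ofRel E).start (u 0) →
      (∀ i : Fin n, (SimDb.ofRel E).span (x i) (u i) (u (i + 1))) →
      (SimDb.ofRel E).cell k₁ (some b) (u n) (u (n + 1)) →
      ∀ a ∈ recordBody St k₁ d n b, E a.rel fun i => assign (fun _ _ => ⟨1, 1⟩) u
        (fun m => if h : m < n then x ⟨m, h⟩ else ⟨1, 1⟩) (a.args i) := by
    intro b x u h₁ h₂ h₃ a ha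
    simp only [recordBody, List.mem_cons, List.mem_map] at ha
    rcases ha with rfl | rfl | ⟨i, -, rfl⟩
    · exact h₁
    · exact ofRel_cell.mpr h₃
    · refine ofRel_span.mpr ?_
      have := h₂ i
      simpa only [assign, i.isLt, dif_pos] using this
  constructor
  · have := hE _ IsSimRule.init
      (assign (fun _ _ => ⟨1, 1⟩) (fun _ _ => ⟨1, 1⟩) fun _ => ⟨1, 1⟩)
      ⟨by simp [initRule], fun p hp => ?_⟩
    · exact ofRel_conf.mp this
    · obtain ⟨j, -, rfl⟩ := List.mem_map.mp hp
      exact holds_first.mpr ⟨rfl, rfl⟩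
  · intro k hk
    have := hE _ (IsSimRule.empty k hk)
      (assign (fun _ _ => ⟨1, 1⟩) (fun _ _ => ⟨1, 1⟩) fun _ => ⟨1, 1⟩)
      ⟨by simp [emptyRule], fun p hp => ?_⟩
    · exact ofRel_cell.mp this
    · obtain ⟨j, -, rfl⟩ := List.mem_map.mp hp
      exact holds_first.mpr ⟨rfl, rfl⟩
  · intro i a hi
    have := hE _ (IsSimRule.input a)
      (assign (fun _ _ => ⟨1, 1⟩) (fun _ _ => ⟨1, 1⟩) fun | 0 => ⟨1, i + 1⟩ | _ => ⟨1, i + 2⟩)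
      ⟨by simp [inputRule], fun p hp => ?_⟩
    · exact ofRel_cell.mp this
    · obtain rfl := List.mem_singleton.mp hp
      exact holds_pref.mpr ⟨i, hi, rfl, rfl⟩
  · have := hE _ IsSimRule.inputEnd
      (assign (fun _ _ => ⟨1, 1⟩) (fun _ _ => ⟨1, 1⟩) fun _ => ⟨1, s.length + 1⟩)
      ⟨by simp [inputEndRule], fun p hp => ?_⟩
    · exact ofRel_cell.mp this
    · obtain rfl := List.mem_singleton.mp hp
      exact holds_whole.mpr ⟨rfl, rfl⟩
  · intro j a a' h₁ h₂ h₃ h₄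
    let ν : SimVar K d → Span := assign (fun _ _ => ⟨1, 1⟩)
      (fun | 0 => pointTuple a | 1 => pointTuple a' | 2 => pointTuple a | _ => fun _ => ⟨1, 1⟩)
      fun _ => ⟨a j + 1, a j + 2⟩
    have heq : (fun i => ν (if i ≤ j then tup 1 i else tup 0 i)) = pointTuple a' := by
      funext i
      by_cases hi : i ≤ j
      · rw [if_pos hi]
        rfl
      · rw [if_neg hi, pointTuple, (h₄ i (not_le.mp hi)).1]
        rfl
    have := hE _ (IsSimRule.next j) ν ⟨by simp [nextRule], fun p hp => ?_⟩
    · exact (congrArg ((SimDb.ofRel E).next (pointTuple a)) heq).mp (ofRel_next.mp this)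
    · obtain ⟨i, -, hi⟩ := List.mem_flatMap.mp hp
      unfold nextRegexes at hi
      rcases lt_trichotomy i j with h | rfl | h
      · simp only [if_pos h, List.mem_cons, List.not_mem_nil, or_false] at hi
        obtain ⟨h₅, h₆⟩ := h₁ i h
        rcases hi with rfl | rfl
        · exact holds_last.mpr (by simp [ν, assign, pointTuple, h₅])
        · exact holds_first.mpr (by simp [ν, assign, pointTuple, h₆])
      · simp only [lt_irrefl, if_false, if_true, List.mem_cons, List.not_mem_nil, or_false] at hi
        rcases hi with rfl | rfl
        · exact holds_letterStart.mpr ⟨a i, h₃, rfl, rfl⟩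
        · exact holds_letterEnd.mpr ⟨a i, h₃, rfl, by simp [ν, assign, pointTuple, h₂]⟩
      · simp only [if_neg (not_lt_of_gt h), if_neg h.ne', List.mem_singleton] at hi
        subst hi
        exact holds_point.mpr ⟨a i, (h₄ i h).2, rfl, rfl⟩
  · intro q a t g w t' h₁ h₂ h₃
    let ν : SimVar K d → Span := assign g (fun | 0 => t | 1 => w | _ => t') fun _ => ⟨1, 1⟩
    have heq : (fun k j => ν (Function.update ptr (M.key q)
        ((M.op q).pointer (ptr (M.key q)) (tup 1) (tup 2)) k j)) =
        Function.update g (M.key q) ((M.op q).pointer (g (M.key q)) w t') := by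
      funext k j
      by_cases hk : k = M.key q
      · subst hk
        simp only [Function.update_self]
        cases M.op q <;> rfl
      · simp only [Function.update_of_ne hk]
        rfl
    have := hE _ (IsSimRule.step q a) ν ⟨hstep q a t g w t' h₁ h₂ h₃, by simp [stepRule]⟩
    exact (congrArg ((SimDb.ofRel E).conf (M.next q a) t') heq).mp (ofRel_conf.mp this)
  · intro q a b t g w t' h h₁ h₂ h₃
    have := hE _ (IsSimRule.push q a b h) _ ⟨hstep q a t g w t' h₁ h₂ h₃, by simp [pushRule]⟩
    exact ofRel_cell.mp this
  · intro q t g h h₁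
    refine hE _ (IsSimRule.start q h) (assign g (fun _ => t) fun _ => ⟨1, 1⟩)
      ⟨fun a ha => ?_, by simp [startRule]⟩
    obtain rfl := List.mem_singleton.mp ha
    exact ofRel_conf.mpr h₁
  · intro b x u h h₁ h₂ h₃
    refine ⟨hE _ (IsSimRule.nextStart b h) _ ⟨hrecord b x u h₁ h₂ h₃, by simp [nextStartRule]⟩, ?_⟩
    have := hE _ (IsSimRule.out b h) _ ⟨hrecord b x u h₁ h₂ h₃, by simp [outRule]⟩
    refine (congrArg (SimDb.ofRel E).out (funext fun i => ?_)).mp this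
    exact dif_pos i.isLt
  · intro b u w h h₁
    have := hE _ (IsSimRule.onesFirst b h) (assign (fun _ _ => ⟨1, 1⟩)
      (fun | 0 => u | _ => w) fun _ => ⟨1, 1⟩) ⟨fun a ha => ?_, fun p hp => ?_⟩
    · exact ofRel_ones.mp this
    · obtain rfl := List.mem_singleton.mp ha
      exact ofRel_cell.mpr h₁
    · obtain rfl := List.mem_singleton.mp hp
      exact holds_first.mpr ⟨rfl, rfl⟩
  · intro b i u v w h hi h₁ h₂
    have := hE _ (IsSimRule.onesNext b h) (assign (fun _ _ => ⟨1, 1⟩)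
      (fun | 0 => u | 1 => v | _ => w)
      fun | 0 => ⟨i + 1, i + 1⟩ | 1 => ⟨i + 2, i + 2⟩ | _ => ⟨i + 1, i + 2⟩)
      ⟨fun a ha => ?_, fun p hp => ?_⟩
    · exact ofRel_ones.mp this
    · simp only [onesNextRule, List.mem_cons, List.not_mem_nil, or_false] at ha
      rcases ha with rfl | rfl
      · exact ofRel_ones.mpr h₁
      · exact ofRel_cell.mpr h₂
    · simp only [onesNextRule, List.mem_cons, List.not_mem_nil, or_false] at hp
      rcases hp with rfl | rfl
      · exact holds_letterStart.mpr ⟨i, hi, rfl, rfl⟩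
      · exact holds_letterEnd.mpr ⟨i, hi, rfl, rfl⟩
  · intro b x u v w h h₁ h₂
    have := hE _ (IsSimRule.num b h) (assign (fun _ _ => ⟨1, 1⟩)
      (fun | 0 => u | 1 => v | _ => w) fun _ => x) ⟨fun a ha => ?_, by simp [numRule]⟩
    · exact ofRel_num.mp this
    · simp only [numRule, List.mem_cons, List.not_mem_nil, or_false] at ha
      rcases ha with rfl | rfl
      · exact ofRel_ones.mpr h₁
      · exact ofRel_cell.mpr h₂
  · intro i j u v w hij hj h₁ h₂
    have := hE _ IsSimRule.span (assign (fun _ _ => ⟨1, 1⟩)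
      (fun | 0 => u | 1 => v | _ => w)
      fun | 0 => ⟨i + 1, i + 1⟩ | 1 => ⟨j + 1, j + 1⟩ | _ => ⟨i + 1, j + 1⟩)
      ⟨fun a ha => ?_, fun p hp => ?_⟩
    · exact ofRel_span.mp this
    · simp only [spanRule, List.mem_cons, List.not_mem_nil, or_false] at ha
      rcases ha with rfl | rfl
      · exact ofRel_num.mpr h₁
      · exact ofRel_num.mpr h₂
    · simp only [spanRule, List.mem_cons, List.not_mem_nil, or_false] at hp
      rcases hp with rfl | rfl
      · exact holds_spanStart.mpr ⟨i, j, hij, hj, rfl, rfl⟩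
      · exact holds_spanEnd.mpr ⟨i, j, hij, hj, rfl, rfl⟩
  · intro h hs
    refine hE _ (IsSimRule.emptyString h) (fun _ => ⟨1, 1⟩)
      ⟨by simp [emptyStringRule], fun p hp => ?_⟩
    obtain rfl := List.mem_singleton.mp hp
    exact holds_emptyString.mpr ⟨hs, rfl, rfl⟩

end Minimal

/-! ### Times as numbers -/

section Time

/-- The number with the digits `a`, least significant digit first. -/
def timeVal {d : ℕ} (N : ℕ) (a : Fin d → ℕ) : ℕ := ∑ i, a i * (N + 1) ^ (i : ℕ)

theorem timeVal_succ {d : ℕ} (N : ℕ) (a : Fin (d + 1) → ℕ) :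
    timeVal N a = a 0 + (N + 1) * timeVal N fun i => a i.succ := by
  simp only [timeVal, Fin.sum_univ_succ, Fin.val_zero, pow_zero, mul_one, Fin.val_succ,
    Finset.mul_sum]
  congr 1
  exact Finset.sum_congr rfl fun i _ => by ring

/-- The carry of an increment. -/
theorem timeVal_next {d N : ℕ} (j : Fin d) (a a' : Fin d → ℕ)
    (h₁ : ∀ i < j, a i = N ∧ a' i = 0) (h₂ : a' j = a j + 1) (h₃ : ∀ i > j, a' i = a i) :
    timeVal N a' = timeVal N a + 1 := by
  induction d with
  | zero => exact j.elim0
  | succ d ih =>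
    rw [timeVal_succ, timeVal_succ N a]
    induction j using Fin.cases with
    | zero =>
      have : (fun i : Fin d => a' i.succ) = fun i => a i.succ :=
        funext fun i => h₃ _ (Fin.succ_pos i)
      rw [this, h₂]
      ring
    | succ j =>
      obtain ⟨h₄, h₅⟩ := h₁ 0 (Fin.succ_pos j)
      rw [ih j (fun i => a i.succ) (fun i => a' i.succ)
        (fun i hi => h₁ _ (Fin.succ_lt_succ_iff.mpr hi)) h₂
        fun i hi => h₃ _ (Fin.succ_lt_succ_iff.mpr hi), h₄, h₅]
      ring

theorem timeVal_max {d N : ℕ} (a : Fin d → ℕ) (h : ∀ i, a i = N) :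
    timeVal N a + 1 = (N + 1) ^ d := by
  induction d with
  | zero => simp [timeVal]
  | succ d ih =>
    have := ih (fun i => a i.succ) fun i => h _
    rw [timeVal_succ, h, pow_succ, ← this]
    ring

/-- The tuple `u` represents the time `i`. -/
def IsTime {d : ℕ} (N : ℕ) (u : Fin d → Span) (i : ℕ) : Prop :=
  ∃ a : Fin d → ℕ, (∀ j, a j ≤ N) ∧ u = pointTuple a ∧ timeVal N a = i

theorem IsTime.unique {d N : ℕ} {u : Fin d → Span} {i j : ℕ} (hi : IsTime N u i)
    (hj : IsTime N u j) : i = j := by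
  obtain ⟨a, -, rfl, rfl⟩ := hi
  obtain ⟨b, -, h, rfl⟩ := hj
  congr 1
  funext k
  simpa [pointTuple] using congrArg Span.start (congrFun h k)

theorem isTime_zero (d N : ℕ) : IsTime N (prefixTuple 0 : Fin d → Span) 0 :=
  ⟨fun _ => 0, by simp, rfl, by simp [timeVal]⟩

/-- Each time but the last one has a successor. -/
theorem IsTime.exists_next {d N : ℕ} {u : Fin d → Span} {i : ℕ} (h : IsTime N u i)
    (hi : i + 1 < (N + 1) ^ d) : ∃ (j : Fin d) (a a' : Fin d → ℕ), u = pointTuple a ∧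
      (∀ i < j, a i = N ∧ a' i = 0) ∧ a' j = a j + 1 ∧ a j < N ∧
      (∀ i > j, a' i = a i ∧ a i ≤ N) ∧ IsTime N (pointTuple a') (i + 1) := by
  obtain ⟨a, ha, rfl, rfl⟩ := h
  have hne : {j | a j < N}.Nonempty := by
    by_contra hne
    have h : ∀ j, a j = N := fun j => le_antisymm (ha j) (not_lt.mp fun hj => hne ⟨j, hj⟩)
    have := timeVal_max a h
    omega
  obtain ⟨j, hj, hmin⟩ := wellFounded_lt.has_min _ hne
  have hlt : ∀ i < j, a i = N := fun i hi =>
    le_antisymm (ha i) (not_lt.mp fun h => hmin i h hi)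
  let a' : Fin d → ℕ := fun i => if i < j then 0 else if i = j then a j + 1 else a i
  have h₁ : ∀ i < j, a i = N ∧ a' i = 0 := fun i hi => ⟨hlt i hi, if_pos hi⟩
  have h₂ : a' j = a j + 1 := by simp [a']
  have h₃ : ∀ i > j, a' i = a i := fun i hi => by
    simp [a', not_lt_of_gt hi, hi.ne']
  refine ⟨j, a, a', rfl, h₁, h₂, hj, fun i hi => ⟨h₃ i hi, ha i⟩, a', fun i => ?_, rfl,
    timeVal_next j a a' h₁ h₂ h₃⟩
  rcases lt_trichotomy i j with hi | rfl | hi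
  · rw [(h₁ i hi).2]
    omega
  · rw [h₂]
    exact hj
  · rw [h₃ i hi]
    exact ha i

end Time

/-! ### Unique decoding of the output -/

section Decoding

theorem encodeSpan_append_inj {σ τ : Span} {r r' : List OutSymbol}
    (h : encodeSpan σ ++ r = encodeSpan τ ++ r') : σ = τ ∧ r = r' := by
  have key : ∀ (a b : ℕ) (l l' : List OutSymbol),
      List.replicate a OutSymbol.one ++ .sep :: l = List.replicate b OutSymbol.one ++ .sep :: l' →
      a = b ∧ l = l' := by
    intro a
    induction a with
    | zero =>
      intro b l l' h
      cases b with
      | zero => simpa using h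
      | succ b => simp [List.replicate_succ] at h
    | succ a ih =>
      intro b l l' h
      cases b with
      | zero => simp [List.replicate_succ] at h
      | succ b =>
        obtain ⟨h₁, h₂⟩ := ih b l l' (by simpa [List.replicate_succ] using h)
        exact ⟨by omega, h₂⟩
  obtain ⟨h₁, h₂⟩ := key σ.start τ.start (List.replicate σ.finish .one ++ .sep :: r)
    (List.replicate τ.finish .one ++ .sep :: r') (by simpa [encodeSpan] using h)
  obtain ⟨h₃, h₄⟩ := key _ _ _ _ h₂
  exact ⟨Span.ext h₁ h₃, h₄⟩

theorem flatMap_encodeSpan_append_inj {l l' : List Span} (hl : l.length = l'.length)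
    {r r' : List OutSymbol} (h : l.flatMap encodeSpan ++ r = l'.flatMap encodeSpan ++ r') :
    l = l' ∧ r = r' := by
  induction l generalizing l' with
  | nil =>
    obtain rfl := List.length_eq_zero_iff.mp hl.symm
    exact ⟨rfl, h⟩
  | cons σ l ih =>
    cases l' with
    | nil => simp at hl
    | cons τ l' =>
      simp only [List.flatMap_cons, List.append_assoc] at h
      obtain ⟨rfl, h₁⟩ := encodeSpan_append_inj h
      obtain ⟨rfl, h₂⟩ := ih (by simpa using hl) h₁
      exact ⟨rfl, h₂⟩

/-- The code of a tuple is prefix-free; so the output can be split into records in one way only. -/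
theorem encodeTuple_append_inj {n : ℕ} {t t' : Fin n → Span} {r r' : List OutSymbol}
    (h : encodeTuple t ++ r = encodeTuple t' ++ r') : t = t' ∧ r = r' := by
  simp only [encodeTuple, List.append_assoc] at h
  obtain ⟨h₁, h₂⟩ := flatMap_encodeSpan_append_inj (by simp) h
  exact ⟨List.ofFn_injective h₁, by simpa using h₂⟩

end Decoding

/-! ### The intended database -/

section Soundness

variable {K St G Alph : Type} {d n : ℕ} [NeZero d] [DecidableEq K] (M : StackMachine K St G)
  (k₀ k₁ : K) (q₀ : St) (emb : Alph → G) (dec : G → Option OutSymbol)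

/-- The configuration at the time `i`. -/
def StackMachine.config (s : List Alph) (i : ℕ) : St × (K → List G) :=
  M.step^[i] (q₀, fun k => if k = k₀ then s.map emb else [])

open Classical in
/-- The contents of the stack `k` to which a tuple points. A time points to the contents at this
time; other tuples point to parts of the input. -/
noncomputable def content (s : List Alph) (k : K) (u : Fin d → Span) : List G :=
  if h : ∃ i, IsTime s.length u i then (M.config k₀ q₀ emb s h.choose).2 k
  else if k = k₀ then (s.drop ((u 0).finish - 1)).map emb else []

variable {M k₀ k₁ q₀ emb dec} {s : List Alph}

theorem content_of_isTime {k : K} {u : Fin d → Span} {i : ℕ} (h : IsTime s.length u i) :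
    content M k₀ q₀ emb s k u = (M.config k₀ q₀ emb s i).2 k := by
  have hex : ∃ i, IsTime s.length u i := ⟨i, h⟩
  rw [content, dif_pos hex, hex.choose_spec.unique h]

/-- The empty prefix is the time `0`, at which the whole input is on the stack. -/
theorem content_prefixTuple {i : ℕ} :
    content M k₀ q₀ emb s k₀ (prefixTuple i : Fin d → Span) = (s.drop i).map emb := by
  rcases Nat.eq_zero_or_pos i with rfl | hi
  · rw [content_of_isTime (isTime_zero d s.length)]
    simp [StackMachine.config]
  -- A prefix that is not empty is not a tuple of empty spans, hence no time.
  · rw [content, dif_neg, if_pos rfl]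
    · rfl
    · rintro ⟨j, a, -, h, -⟩
      have := congrFun h 0
      simp only [prefixTuple, pointTuple, Span.mk.injEq] at this
      omega

variable (M k₀ k₁ q₀ emb dec) in
/-- The intended meaning of the relations, if `f` is the result of the machine on `s`. -/
noncomputable def simDb (d : ℕ) [NeZero d] (s : List Alph) (f : List (Fin n → Span)) :
    SimDb K St G d n where
  conf q t g := ∃ i, IsTime s.length t i ∧ (M.config k₀ q₀ emb s i).1 = q ∧
    ∀ k, content M k₀ q₀ emb s k (g k) = (M.config k₀ q₀ emb s i).2 k
  next t t' := ∃ i, IsTime s.length t i ∧ IsTime s.length t' (i + 1)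
  cell k a u w := (content M k₀ q₀ emb s k u).head? = a ∧
    content M k₀ q₀ emb s k w = (content M k₀ q₀ emb s k u).tail
  start u := ∃ l₁ l₂, f = l₁ ++ l₂ ∧
    (content M k₀ q₀ emb s k₁ u).map dec = (encodeRelation l₂).map some
  ones x u w := ∃ i, x = ⟨i, i⟩ ∧ (content M k₀ q₀ emb s k₁ u).map dec =
    (List.replicate i OutSymbol.one).map some ++ (content M k₀ q₀ emb s k₁ w).map dec
  num x u w := ∃ i, x = ⟨i, i⟩ ∧ (content M k₀ q₀ emb s k₁ u).map dec =
    (List.replicate i OutSymbol.one ++ [OutSymbol.sep]).map some ++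
      (content M k₀ q₀ emb s k₁ w).map dec
  span x u w := (content M k₀ q₀ emb s k₁ u).map dec =
    (encodeSpan x).map some ++ (content M k₀ q₀ emb s k₁ w).map dec
  out x := x ∈ f

theorem eq_cons_of_cell {α : Type} {l l' : List α} {a : α} (h : l.head? = some a ∧ l' = l.tail) :
    l = a :: l' := by
  cases l <;> simp_all

/-- The intended database is closed under the rules; so the rules derive only correct facts. -/
theorem closed_simDb {halt : Set St} {B : Prop} {f : List (Fin n → Span)}
    (hhalt : ∀ i, (M.config k₀ q₀ emb s i).1 ∈ halt →
      ((M.config k₀ q₀ emb s i).2 k₁).map dec = (encodeRelation f).map some)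
    (hB : B → s = [] → (fun _ => ⟨1, 1⟩) ∈ f) :
    (simDb M k₀ k₁ q₀ emb dec d s f).Closed M k₀ k₁ q₀ halt emb dec B s where
  init := ⟨0, isTime_zero d _, rfl, fun k => content_of_isTime (isTime_zero d _)⟩
  empty k hk := by
    have : content M k₀ q₀ emb s k (prefixTuple 0 : Fin d → Span) = [] := by
      rw [content_of_isTime (isTime_zero d _)]
      simp [StackMachine.config, hk]
    simp [simDb, this]
  input i a hi := by
    simp [simDb, content_prefixTuple, List.head?_drop, hi]
  inputEnd := by
    simp [simDb, content_prefixTuple]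
  next j a a' h₁ h₂ h₃ h₄ := by
    refine ⟨timeVal s.length a, ⟨a, fun i => ?_, rfl, rfl⟩, a', fun i => ?_, rfl,
      timeVal_next j a a' h₁ h₂ fun i hi => (h₄ i hi).1⟩
    · rcases lt_trichotomy i j with hi | rfl | hi
      · exact (h₁ i hi).1.le
      · exact h₃.le
      · exact (h₄ i hi).2
    · rcases lt_trichotomy i j with hi | rfl | hi
      · rw [(h₁ i hi).2]
        omega
      · rw [h₂]
        exact h₃
      · rw [(h₄ i hi).1]
        exact (h₄ i hi).2
  step q a t g w t' := by
    rintro ⟨i, hi, rfl, hg⟩ ⟨ha, hw⟩ ⟨j, hj, hj'⟩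
    obtain rfl := hi.unique hj
    have hstep : M.config k₀ q₀ emb s (i + 1) = M.step (M.config k₀ q₀ emb s i) :=
      Function.iterate_succ_apply' _ _ _
    rw [hg] at ha hw
    refine ⟨i + 1, hj', ?_, fun k => ?_⟩
    · rw [hstep, StackMachine.step, ha]
    · by_cases hk : k = M.key (M.config k₀ q₀ emb s i).1
      · subst hk
        rw [Function.update_self]
        cases ho : M.op (M.config k₀ q₀ emb s i).1 with
        | keep => simp [hstep, StackMachine.step, ho, StackOp.apply, StackOp.pointer, hg]
        | pop => simp [hstep, StackMachine.step, ho, StackOp.apply, StackOp.pointer, hw]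
        | push b => simp [StackOp.pointer, content_of_isTime hj']
      · simp [hstep, StackMachine.step, hk, hg]
  push q a b t g w t' h := by
    rintro ⟨i, hi, rfl, hg⟩ - ⟨j, hj, hj'⟩
    obtain rfl := hi.unique hj
    have hstep : M.config k₀ q₀ emb s (i + 1) = M.step (M.config k₀ q₀ emb s i) :=
      Function.iterate_succ_apply' _ _ _
    simp [simDb, content_of_isTime hj', hstep, StackMachine.step, h, StackOp.apply, hg]
  start q t g hq := by
    rintro ⟨i, hi, rfl, hg⟩
    exact ⟨[], f, rfl, by rw [hg, hhalt i hq]⟩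
  record b x u hb := by
    rintro ⟨l₁, l₂, hf, hl⟩ hspan hcell
    have hcell := eq_cons_of_cell hcell
    -- The first `m` spans precede the pointer `u m` in the output.
    have key : ∀ m, m ≤ n → (content M k₀ q₀ emb s k₁ (u 0)).map dec =
        ((((List.ofFn x).take m).flatMap encodeSpan).map some) ++
          (content M k₀ q₀ emb s k₁ (u m)).map dec := by
      intro m hm
      induction m with
      | zero => simp
      | succ m ih =>
        have h₁ := ih (by omega)
        have h₂ := hspan ⟨m, hm⟩
        simp only [simDb] at h₂
        rw [h₁, h₂, List.take_succ_eq_append_getElem (by simpa using hm)]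
        simp
    have h := key n le_rfl
    rw [hl, hcell, List.take_of_length_le (by simp), List.map_cons, hb,
      ← List.singleton_append, ← List.append_assoc] at h
    rw [show ((List.ofFn x).flatMap encodeSpan).map some ++ [some OutSymbol.mark] =
      (encodeTuple x).map some by simp [encodeTuple]] at h
    obtain ⟨r₁, r₂, hr, hr₁, hr₂⟩ := List.map_eq_append_iff.mp h
    obtain rfl := List.map_injective_iff.mpr (Option.some_injective _) hr₁
    cases l₂ with
    | nil => simp [encodeRelation, encodeTuple] at hr
    | cons t l₂ =>
      obtain ⟨rfl, rfl⟩ := encodeTuple_append_inj (r := encodeRelation l₂) hr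
      refine ⟨⟨l₁ ++ [t], l₂, by simp [hf], hr₂.symm⟩, ?_⟩
      simp [simDb, hf]
  onesFirst b u w hb hcell := by
    refine ⟨1, rfl, ?_⟩
    rw [eq_cons_of_cell hcell]
    simp [hb]
  onesNext b i u v w hb hi hones hcell := by
    obtain ⟨j, hj, h⟩ := hones
    simp only [Span.mk.injEq, and_self] at hj
    subst hj
    refine ⟨i + 2, rfl, ?_⟩
    rw [eq_cons_of_cell hcell, List.map_cons, h, hb]
    rfl
  num b x u v w hb hones hcell := by
    obtain ⟨i, rfl, h⟩ := hones
    refine ⟨i, rfl, ?_⟩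
    rw [h, eq_cons_of_cell hcell]
    simp [hb]
  span i j u v w hij hj h₁ h₂ := by
    obtain ⟨i', hi', h₁⟩ := h₁
    obtain ⟨j', hj', h₂⟩ := h₂
    simp only [Span.mk.injEq, and_self] at hi' hj'
    subst hi' hj'
    change _ = _
    rw [h₁, h₂]
    simp [encodeSpan]
  emptyString := hB

end Soundness

/-! ### Derivation of the run and of its result -/

section Completeness

variable {K St G Alph : Type} {d n : ℕ} [DecidableEq K] {M : StackMachine K St G}
  {k₀ k₁ : K} {q₀ : St} {emb : Alph → G} {dec : G → Option OutSymbol} {halt : Set St} {B : Prop}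
  {s : List Alph} {D : SimDb K St G d n}

/-- The cells of the stack contents `l`, to which `u` points, are in the database. -/
inductive SimDb.Stored (D : SimDb K St G d n) (k : K) : (Fin d → Span) → List G → Prop
  | nil {u : Fin d → Span} (h : D.cell k none u u) : Stored D k u []
  | cons {u w : Fin d → Span} {a : G} {l : List G} (h : D.cell k (some a) u w)
      (hl : Stored D k w l) : Stored D k u (a :: l)

omit [DecidableEq K] in
theorem SimDb.Stored.exists_tail {k : K} {u : Fin d → Span} {l : List G} (h : D.Stored k u l) :
    ∃ w, D.cell k l.head? u w ∧ D.Stored k w l.tail := by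
  cases h with
  | nil h => exact ⟨u, h, .nil h⟩
  | cons h hl => exact ⟨_, h, hl⟩

/-- Prefixes of the string point to what remains of the input after them. -/
theorem SimDb.Closed.stored_input (hD : D.Closed M k₀ k₁ q₀ halt emb dec B s) {i : ℕ}
    (hi : i ≤ s.length) : D.Stored k₀ (prefixTuple i) ((s.drop i).map emb) := by
  induction hi using Nat.decreasingInduction with
  | self =>
    rw [List.drop_length]
    exact .nil hD.inputEnd
  | of_succ i hi ih =>
    rw [List.drop_eq_getElem_cons hi]
    exact .cons (hD.input i _ (List.getElem?_eq_getElem hi)) ih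

/-- Each configuration of the run is derived, as long as there are times. -/
theorem SimDb.Closed.exists_conf (hD : D.Closed M k₀ k₁ q₀ halt emb dec B s) {i : ℕ}
    (hi : i < (s.length + 1) ^ d) : ∃ t g, IsTime s.length t i ∧
      D.conf (M.config k₀ q₀ emb s i).1 t g ∧
      ∀ k, D.Stored k (g k) ((M.config k₀ q₀ emb s i).2 k) := by
  induction i with
  | zero =>
    refine ⟨_, _, isTime_zero d _, hD.init, fun k => ?_⟩
    by_cases hk : k = k₀
    · subst hk
      simpa [StackMachine.config] using hD.stored_input (i := 0) (by omega)
    · simpa [StackMachine.config, hk] using Stored.nil (hD.empty k hk)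
  | succ i ih =>
    -- The next time exists because the times are not exhausted, and the pointers are updated as
    -- the operation requires.
    obtain ⟨t, g, ht, hconf, hst⟩ := ih (by omega)
    obtain ⟨j, a, a', rfl, h₁, h₂, h₃, h₄, ht'⟩ := ht.exists_next hi
    have hnext := hD.next j a a' h₁ h₂ h₃ h₄
    obtain ⟨w, hw, hw'⟩ := (hst (M.key (M.config k₀ q₀ emb s i).1)).exists_tail
    have hstep : M.config k₀ q₀ emb s (i + 1) = M.step (M.config k₀ q₀ emb s i) :=
      Function.iterate_succ_apply' _ _ _
    refine ⟨_, _, ht', by rw [hstep]; exact hD.step _ _ _ _ _ _ hconf hw hnext, fun k => ?_⟩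
    rw [hstep]
    by_cases hk : k = M.key (M.config k₀ q₀ emb s i).1
    · subst hk
      simp only [StackMachine.step, Function.update_self]
      cases ho : M.op (M.config k₀ q₀ emb s i).1 with
      | keep => exact hst _
      | pop => exact hw'
      | push b => exact .cons (hD.push _ _ b _ _ _ _ ho hconf hw hnext) (hst _)
    · simp only [StackMachine.step, Function.update_of_ne hk]
      exact hst k

omit [DecidableEq K] in
theorem SimDb.Stored.exists_of_map_eq {k : K} {u : Fin d → Span} {l : List G}
    (h : D.Stored k u l) {o : Option OutSymbol} {r : List (Option OutSymbol)}
    (hl : l.map dec = o :: r) :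
    ∃ b w l', dec b = o ∧ D.cell k (some b) u w ∧ D.Stored k w l' ∧ l'.map dec = r := by
  cases h with
  | nil h => simp at hl
  | cons h h' =>
    simp only [List.map_cons, List.cons.injEq] at hl
    exact ⟨_, _, _, hl.1, h, h', hl.2⟩

theorem SimDb.Closed.exists_ones (hD : D.Closed M k₀ k₁ q₀ halt emb dec B s) {i : ℕ}
    (hi : i ≤ s.length) {u : Fin d → Span} {l : List G} {r : List (Option OutSymbol)}
    (h : D.Stored k₁ u l)
    (hl : l.map dec = (List.replicate (i + 1) OutSymbol.one).map some ++ r) :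
    ∃ w l', D.ones ⟨i + 1, i + 1⟩ u w ∧ D.Stored k₁ w l' ∧ l'.map dec = r := by
  induction i generalizing u l with
  | zero =>
    obtain ⟨b, w, l', hb, hc, h', hl'⟩ := h.exists_of_map_eq (dec := dec) (r := r) hl
    exact ⟨w, l', hD.onesFirst b u w hb hc, h', hl'⟩
  | succ i ih =>
    obtain ⟨b, v, l', hb, hc, h', hl'⟩ := h.exists_of_map_eq (dec := dec)
      (r := (List.replicate (i + 1) OutSymbol.one).map some ++ r) hl
    obtain ⟨w, l'', hv, h'', hl''⟩ := ih (by omega) h' hl'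
    exact ⟨w, l'', hD.onesNext b i u v w hb (by omega) hv hc, h'', hl''⟩

theorem SimDb.Closed.exists_num (hD : D.Closed M k₀ k₁ q₀ halt emb dec B s) {i : ℕ}
    (hi : i ≤ s.length) {u : Fin d → Span} {l : List G} {r : List (Option OutSymbol)}
    (h : D.Stored k₁ u l)
    (hl : l.map dec = (List.replicate (i + 1) OutSymbol.one).map some ++
      some OutSymbol.sep :: r) :
    ∃ w l', D.num ⟨i + 1, i + 1⟩ u w ∧ D.Stored k₁ w l' ∧ l'.map dec = r := by
  obtain ⟨v, l', hv, h', hl'⟩ := hD.exists_ones hi h hl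
  obtain ⟨b, w, l'', hb, hc, h'', hl''⟩ := h'.exists_of_map_eq hl'
  exact ⟨w, l'', hD.num b _ u v w hb hv hc, h'', hl''⟩

theorem SimDb.Closed.exists_span (hD : D.Closed M k₀ k₁ q₀ halt emb dec B s) {σ : Span}
    (hσ : σ.IsSpanOf s) {u : Fin d → Span} {l : List G} {r : List (Option OutSymbol)}
    (h : D.Stored k₁ u l) (hl : l.map dec = (encodeSpan σ).map some ++ r) :
    ∃ w l', D.span σ u w ∧ D.Stored k₁ w l' ∧ l'.map dec = r := by
  obtain ⟨i, j⟩ := σ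
  obtain ⟨h₁, h₂, h₃⟩ := hσ
  simp only at h₁ h₂ h₃
  obtain ⟨i, rfl⟩ : ∃ i', i = i' + 1 := ⟨i - 1, by omega⟩
  obtain ⟨j, rfl⟩ : ∃ j', j = j' + 1 := ⟨j - 1, by omega⟩
  obtain ⟨v, l', hv, h', hl'⟩ := hD.exists_num (i := i) (by omega) h
    (r := ((List.replicate (j + 1) OutSymbol.one).map some ++ some OutSymbol.sep :: r))
    (by simpa [encodeSpan] using hl)
  obtain ⟨w, l'', hw, h'', hl''⟩ := hD.exists_num (i := j) (by omega) h' hl'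
  exact ⟨w, l'', hD.span i j u v w (by omega) (by omega) hv hw, h'', hl''⟩

/-- A tuple of spans is parsed by a chain of pointers `U`. -/
theorem SimDb.Closed.exists_spans (hD : D.Closed M k₀ k₁ q₀ halt emb dec B s) {xs : List Span}
    (hxs : ∀ σ ∈ xs, σ.IsSpanOf s) {u : Fin d → Span} {l : List G} {r : List (Option OutSymbol)}
    (h : D.Stored k₁ u l) (hl : l.map dec = (xs.flatMap encodeSpan).map some ++ r) :
    ∃ U : ℕ → Fin d → Span, U 0 = u ∧ (∀ i (hi : i < xs.length), D.span xs[i] (U i) (U (i + 1))) ∧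
      ∃ l', D.Stored k₁ (U xs.length) l' ∧ l'.map dec = r := by
  induction xs generalizing u l with
  | nil => exact ⟨fun _ => u, rfl, by simp, l, h, hl⟩
  | cons σ xs ih =>
    obtain ⟨w, l', hw, h', hl'⟩ := hD.exists_span (hxs σ List.mem_cons_self) h
      (r := (xs.flatMap encodeSpan).map some ++ r) (by simpa using hl)
    obtain ⟨U, rfl, hU, h''⟩ := ih (fun τ hτ => hxs τ (List.mem_cons_of_mem _ hτ)) h' hl'
    refine ⟨fun | 0 => u | i + 1 => U i, rfl, fun i hi => ?_, h''⟩
    cases i with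
    | zero => exact hw
    | succ i => exact hU i (by simpa using hi)

/-- All records in the output are derived. -/
theorem SimDb.Closed.out_of_stored (hD : D.Closed M k₀ k₁ q₀ halt emb dec B s)
    {f : List (Fin n → Span)} (hf : ∀ t ∈ f, ∀ i, (t i).IsSpanOf s) {u : Fin d → Span}
    {l : List G} (hu : D.start u) (h : D.Stored k₁ u l)
    (hl : l.map dec = (encodeRelation f).map some) : ∀ t ∈ f, D.out t := by
  induction f generalizing u l with
  | nil => simp
  | cons x f ih =>
    obtain ⟨U, rfl, hU, l', h', hl'⟩ := hD.exists_spans (xs := List.ofFn x)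
      (by simpa [List.mem_ofFn] using hf x List.mem_cons_self) h
      (r := some OutSymbol.mark :: (encodeRelation f).map some)
      (by simpa [encodeRelation, encodeTuple] using hl)
    obtain ⟨b, w, l'', hb, hc, h'', hl''⟩ := h'.exists_of_map_eq hl'
    simp only [List.length_ofFn, List.getElem_ofFn] at hU hc
    obtain ⟨hw, hx⟩ := hD.record b x (fun i => if i ≤ n then U i else w) hb (by simpa using hu)
      (fun i => by
        have := hU i i.isLt
        simpa [i.isLt.le, Nat.succ_le_of_lt i.isLt] using this) (by simpa using hc)
    rw [if_neg (by omega)] at hw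
    intro t ht
    rcases List.mem_cons.mp ht with rfl | ht
    · exact hx
    · exact ih (fun t ht => hf t (List.mem_cons_of_mem _ ht)) hw h'' hl'' t ht

/-- If the machine halts before the times are exhausted, all records of its result are derived. -/
theorem SimDb.Closed.out_of_mem (hD : D.Closed M k₀ k₁ q₀ halt emb dec B s)
    {f : List (Fin n → Span)} (hf : ∀ t ∈ f, ∀ i, (t i).IsSpanOf s)
    (hhalt : ∀ i, (M.config k₀ q₀ emb s i).1 ∈ halt →
      ((M.config k₀ q₀ emb s i).2 k₁).map dec = (encodeRelation f).map some)
    {i : ℕ} (hi : (M.config k₀ q₀ emb s i).1 ∈ halt) (hid : i < (s.length + 1) ^ d) :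
    ∀ t ∈ f, D.out t := by
  obtain ⟨t, g, -, hconf, hst⟩ := hD.exists_conf hid
  exact hD.out_of_stored hf (hD.start _ _ _ hi hconf) (hst k₁) (hhalt i hi)

end Completeness

/-! ### Spanners computable in polynomial time are defined by programs -/

/-- A polynomial is bounded by a power of `n + 1`, except at `n = 0`. -/
theorem exists_eval_lt_pow (p : Polynomial ℕ) :
    ∃ d, 0 < d ∧ ∀ n, n ≠ 0 → p.eval n < (n + 1) ^ d := by
  induction p using Polynomial.induction_on' with
  | add p q hp hq =>
    obtain ⟨d, hd, hp⟩ := hp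
    obtain ⟨e, -, hq⟩ := hq
    refine ⟨d + e + 1, by omega, fun n hn => ?_⟩
    have h₁ : (n + 1) ^ d ≤ (n + 1) ^ (d + e) := Nat.pow_le_pow_right (by omega) (by omega)
    have h₂ : (n + 1) ^ e ≤ (n + 1) ^ (d + e) := Nat.pow_le_pow_right (by omega) (by omega)
    have h₃ : (n + 1) ^ (d + e) * 2 ≤ (n + 1) ^ (d + e) * (n + 1) :=
      Nat.mul_le_mul_left _ (by omega)
    have := hp n hn
    have := hq n hn
    rw [Polynomial.eval_add, pow_succ]
    omega
  | monomial k a =>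
    refine ⟨a + k + 1, by omega, fun n hn => ?_⟩
    have h₁ : a < (n + 1) ^ (a + 1) := calc
      a < 2 ^ a := Nat.lt_two_pow_self
      _ ≤ 2 ^ (a + 1) := Nat.pow_le_pow_right (by omega) (by omega)
      _ ≤ (n + 1) ^ (a + 1) := Nat.pow_le_pow_left (by omega) _
    rw [Polynomial.eval_monomial, show a + k + 1 = a + 1 + k by omega, pow_add]
    exact Nat.mul_lt_mul_of_lt_of_le h₁ (Nat.pow_le_pow_left (by omega) k) (by positivity)

section

variable {Alph : Type} {Var : Type u} [DecidableEq Var]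

omit [DecidableEq Var] in
theorem Spanner.eq_of_rel_iff {P P' : Spanner Alph Var} (hv : P.vars = P'.vars)
    (h : ∀ (s : List Alph) (r : Var → Span), (fun x : P.vars => r x) ∈ P.rel s ↔
      (fun x : P'.vars => r x) ∈ P'.rel s) : P = P' := by
  classical
  obtain ⟨V, R, hR⟩ := P
  obtain ⟨V', R', hR'⟩ := P'
  obtain rfl : V = V' := hv
  congr
  funext s
  ext r
  have := h s fun y => if hy : y ∈ V then r ⟨y, hy⟩ else ⟨1, 1⟩
  simpa using this

/-- A spanner that is computable in polynomial time is defined by a program with binary regex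
formulas. -/
theorem Spanner.PolyTime.exists_program [Finite Alph] [Infinite Var] {P : Spanner Alph Var}
    (hP : P.PolyTime) : ∃ Q : Program Alph Var, Q.IsBinary ∧ Q.toSpanner = P := by
  obtain ⟨n, e, f, hf, hPf⟩ := hP
  obtain ⟨K, St, G, _, _, _, _, M, k₀, k₁, q₀, halt, emb, dec, p, hM⟩ := exists_stackMachine hf
  obtain ⟨d, hd, hpd⟩ := exists_eval_lt_pow p
  have : NeZero d := ⟨hd.ne'⟩
  cases nonempty_fintype K
  cases nonempty_fintype Alph
  -- The variables of the rules are names from the infinite set of variables; the output variables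
  -- are those of the spanner.
  obtain ⟨ι₀, hι₀⟩ := Countable.exists_injective_nat (SimVar K d)
  let ι : SimVar K d ↪ Var := ⟨_, (Infinite.natEmbedding Var).injective.comp hι₀⟩
  let ov : (SimRel.out : SimRel K St G).Args d n ↪ Var :=
    ⟨fun i : Fin n => (e.symm i : Var), Subtype.val_injective.comp e.symm.injective⟩
  have hspan : ∀ s, ∀ t ∈ f s, ∀ i, (t i).IsSpanOf s := by
    intro s t ht i
    have := P.isSpanOf s (fun x => t (e x)) ((hPf s _).mpr ⟨t, ht, fun _ => rfl⟩) (e.symm i)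
    simpa using this
  -- On the empty string there is only one span. Thus there is only one time there, and the run is
  -- not described; the result consists of the only possible record or is empty.
  have hnil : ∀ t : Fin n → Span, (∀ i, (t i).IsSpanOf ([] : List Alph)) → t = fun _ => ⟨1, 1⟩ := by
    intro t ht
    funext i
    obtain ⟨h₁, h₂, h₃⟩ := ht i
    simp only [List.length_nil] at h₃
    ext <;> simp only <;> omega
  have hfin := finite_simRules (d := d) (n := n) M k₀ k₁ q₀ halt emb dec (f [] ≠ [])
  have heval : ∀ s (t : Fin n → Span), FamEval ι (simRules M k₀ k₁ q₀ halt emb dec (f [] ≠ [])) hfin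
      .out ov s .out t ↔ t ∈ f s := by
    intro s t
    obtain ⟨⟨i, hi, hi'⟩, hhalt⟩ := hM s
    constructor
    · intro h
      -- Soundness: the intended database satisfies the rules.
      refine h.of_model (SimDb.Closed.famModel (closed_simDb hhalt ?_))
      rintro hne rfl
      obtain ⟨t, ht⟩ := List.exists_mem_of_ne_nil _ hne
      rwa [← hnil t (hspan [] t ht)]
    · intro ht
      -- Completeness: the relations of the program are closed under the rules.
      have hclosed := closed_ofRel (famModel_famEval (ι := ι)
        (rules := simRules M k₀ k₁ q₀ halt emb dec (f [] ≠ [])) (hfin := hfin)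
        (out := .out) (ov := ov) (s := s))
      rcases eq_or_ne s [] with rfl | hs
      · rw [hnil t (hspan [] t ht)]
        exact hclosed.emptyString (List.ne_nil_of_mem ht) rfl
      · exact hclosed.out_of_mem (hspan s) hhalt hi'
          (hi.trans_lt (hpd _ (by simpa using hs))) t ht
  refine ⟨famProgram ι _ hfin .out ov, isBinary_famProgram, Spanner.eq_of_rel_iff ?_ fun s r => ?_⟩
  · ext x
    constructor
    · intro hx
      obtain ⟨i, -, rfl⟩ := Finset.mem_image.mp hx
      exact (e.symm _).2
    · intro hx
      refine Finset.mem_image.mpr ⟨Fintype.equivFin _ (e ⟨x, hx⟩), Finset.mem_univ _, ?_⟩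
      exact (congrArg ov (Equiv.symm_apply_apply _ _)).trans
        (congrArg Subtype.val (e.symm_apply_apply ⟨x, hx⟩))
  · trans (fun i => r (e.symm i)) ∈ f s
    · rw [← heval]
      constructor
      · rintro ⟨t, ht, h⟩
        obtain rfl : t = _ := funext fun i => (h i).symm
        exact ht
      · exact fun h => ⟨_, h, fun i => rfl⟩
    · rw [hPf]
      constructor
      · exact fun h => ⟨_, h, fun x => by simp⟩
      · rintro ⟨t, ht, h⟩
        convert ht using 1
        funext i
        simpa using h (e.symm i)

end

end RGXlog

theorem mainTheorem1 {Alph : Type} [Finite Alph] {Var : Type*} [DecidableEq Var] [Infinite Var]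
    (P : RGXlog.Spanner Alph Var) :
    ((∃ Q : RGXlog.Program Alph Var, Q.toSpanner = P) ↔ P.PolyTime) ∧
      (P.PolyTime → ∃ Q : RGXlog.Program Alph Var, Q.IsBinary ∧ Q.toSpanner = P) := by
  refine ⟨⟨?_, fun hP => ?_⟩, fun hP => hP.exists_program⟩
  · rintro ⟨Q, rfl⟩
    exact Q.polyTime_toSpanner
  · obtain ⟨Q, -, hQ⟩ := hP.exists_program
    exact ⟨Q, hQ⟩
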